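/- Let $p$ be a prime, $R=\mathbb F_p[[t]]$ with its $t$-adic topology, and $\mathfrak m=tR$. Let $K_m$ be the $m\times m$ matrix with ones on the antidiagonal and zeros elsewhere, let $J_{2n}=\begin{pmatrix}0&K_n\\-K_n&0\end{pmatrix}$, and put $$\mathrm{Sp}_{2n}(R)=\{A\in \mathrm{Mat}_{2n}(R): A^{t}J_{2n}A=J_{2n}\},\qquad \mathrm{SO}_{m}(R)=\{A\in \mathrm{Mat}_{m}(R): A^{t}K_{m}A=K_{m}\}.$$ Let $G$ be one of these groups, with its topology and $R$-analytic structure as a submanifold of the space of matrices. An open $R$-standard subgroup $(S,\varphi)$ of $G$, of level $N\ge 1$ and dimension $d$, is an open subgroup $S$ with a homeomorphism $\varphi:S\to(\mathfrak m^N)^{d}$ that is an isomorphism of $R$-analytic manifolds, such that $\varphi(1)=0$ and $\varphi(xy)=F(\varphi(x),\varphi(y))$ for all $x,y\in S$, where $F$ is a $d$-dimensional formal group law over $R$. It defines the filtration series $S_k=\varphi^{-1}((\mathfrak m^{N+k})^{d})$, $k\ge 0$, of $G$, and hence the metric $\rho(x,y)=\inf\{|G:S_k|^{-1}: xy^{-1}\in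 S_k\}$ on $G$ (with the value $1$ if $xy^{-1}$ lies in no $S_k$). The standard Hausdorff dimension of a closed subgroup $H\le G$ is its Hausdorff dimension with respect to this metric; such $(S,\varphi)$ exist, and the dimension does not depend on the choice. The $\mathbb F_p[[t]]$-standard Hausdorff spectrum of $G$ is the set of the standard Hausdorff dimensions of the closed subgroups of $G$. Then for every $n\ge 1$: (i) the $\mathbb F_p[[t]]$-standard Hausdorff spectrum of $\mathrm{Sp}_{2n}(\mathbb F_p[[t]])$ contains the real interval $\left[0,\frac{n+1}{2n+1}\right]$; (ii) if $p\neq 2$, that of $\mathrm{SO}_{2n}(\mathbb F_p[[t]])$ contains $\left[0,\frac{n}{2n-1}\right]$; (iii) that of $\mathrm{SO}_{2n+1}(\mathbb F_p[[t]])$ contains $\left[0,\frac{n+1}{2n+1}\right]$. -/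

import Mathlib

open scoped PowerSeries.WithPiTopology ENNReal Matrix

/-! ### Filtration series and the Hausdorff dimension they define -/

/-- A filtration series of an infinite topological group: a descending sequence of open subgroups
with trivial intersection. (Open subgroups of a profinite group have finite index, so
`index_ne_zero` is automatic there.) -/
structure FiltrationSeries (Γ : Type*) [Group Γ] [TopologicalSpace Γ] where
  toFun : ℕ → Subgroup Γ
  infinite : Infinite Γ
  antitone' : Antitone toFun
  isOpen' : ∀ n, IsOpen (toFun n : Set Γ)
  index_ne_zero : ∀ n, (toFun n).index ≠ 0
  iInf_eq_bot : ⨅ n, toFun n = ⊥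

namespace FiltrationSeries

variable {Γ : Type*} [Group Γ] [TopologicalSpace Γ] (𝓕 : FiltrationSeries Γ)

theorem index_mono {m n : ℕ} (h : m ≤ n) : (𝓕.toFun m).index ≤ (𝓕.toFun n).index :=
  Nat.le_of_dvd (Nat.pos_of_ne_zero (𝓕.index_ne_zero n))
    (Subgroup.index_dvd_of_le (𝓕.antitone' h))

theorem exists_lt_index (K : ℕ) : ∃ n, K < (𝓕.toFun n).index := by
  by_contra! hK
  obtain ⟨n₀, hn₀⟩ : ∃ n₀, ∀ n, (𝓕.toFun n).index ≤ (𝓕.toFun n₀).index := by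
    have hfin : (Set.range fun n => (𝓕.toFun n).index).Finite :=
      (Set.finite_Iic K).subset (by rintro _ ⟨n, rfl⟩; exact hK n)
    obtain ⟨_, ⟨n₀, rfl⟩, h⟩ := Set.exists_max_image _ id hfin ⟨_, ⟨0, rfl⟩⟩
    exact ⟨n₀, fun n => h _ ⟨n, rfl⟩⟩
  have heq : ∀ n, 𝓕.toFun n₀ ≤ 𝓕.toFun n := by
    intro n
    rcases le_total n n₀ with h | h
    · exact 𝓕.antitone' h
    · have h1 := Subgroup.relIndex_mul_index (𝓕.antitone' h)
      have h2 : (𝓕.toFun n).index = (𝓕.toFun n₀).index :=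
        le_antisymm (hn₀ n) (𝓕.index_mono h)
      rw [h2] at h1
      have h3 : (𝓕.toFun n).relIndex (𝓕.toFun n₀) = 1 := by
        have := Nat.pos_of_ne_zero (𝓕.index_ne_zero n₀)
        exact Nat.eq_of_mul_eq_mul_right this (by rw [h1, one_mul])
      exact Subgroup.relIndex_eq_one.mp h3
  have hbot : 𝓕.toFun n₀ = ⊥ := by
    rw [eq_bot_iff, ← 𝓕.iInf_eq_bot]
    exact le_iInf heq
  have := 𝓕.index_ne_zero n₀
  rw [hbot, Subgroup.index_bot] at this
  have hinf := 𝓕.infinite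
  exact this (@Nat.card_eq_zero_of_infinite Γ hinf)

/-- `d(x, y) = inf {|Γ : Γ_n|⁻¹ | x y⁻¹ ∈ Γ_n}`, with the value `1 = |Γ : Γ|⁻¹` if `x y⁻¹` lies in
no `Γ_n`. -/
noncomputable def dist (x y : Γ) : ℝ≥0∞ :=
  1 ⊓ ⨅ (n : ℕ) (_ : x * y⁻¹ ∈ 𝓕.toFun n), (((𝓕.toFun n).index : ℝ≥0∞))⁻¹

theorem exists_index_inv_lt {ε : ℝ≥0∞} (hε : ε ≠ 0) :
    ∃ n, (((𝓕.toFun n).index : ℝ≥0∞))⁻¹ < ε := by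
  obtain ⟨K, hK⟩ := ENNReal.exists_inv_nat_lt hε
  obtain ⟨n, hn⟩ := 𝓕.exists_lt_index K
  exact ⟨n, lt_of_le_of_lt (ENNReal.inv_le_inv.mpr (by exact_mod_cast hn.le)) hK⟩

theorem dist_self (x : Γ) : 𝓕.dist x x = 0 := by
  by_contra h
  obtain ⟨n, hn⟩ := 𝓕.exists_index_inv_lt h
  refine absurd hn (not_lt.mpr ?_)
  exact inf_le_right.trans (iInf₂_le n (by simp [one_mem]))

theorem dist_comm (x y : Γ) : 𝓕.dist x y = 𝓕.dist y x := by
  have : ∀ n, x * y⁻¹ ∈ 𝓕.toFun n ↔ y * x⁻¹ ∈ 𝓕.toFun n := fun n => by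
    rw [← inv_mem_iff]; simp
  simp only [dist, this]

theorem exists_of_dist_lt {x y : Γ} {r : ℝ≥0∞} (h : 𝓕.dist x y < r) (hr : r ≤ 1) :
    ∃ n, x * y⁻¹ ∈ 𝓕.toFun n ∧ (((𝓕.toFun n).index : ℝ≥0∞))⁻¹ < r := by
  rcases inf_lt_iff.mp h with h | h
  · exact absurd h (not_lt.mpr hr)
  · simp only [iInf_lt_iff] at h
    obtain ⟨n, hn, h⟩ := h
    exact ⟨n, hn, h⟩

theorem dist_le_max (x y z : Γ) : 𝓕.dist x z ≤ max (𝓕.dist x y) (𝓕.dist y z) := by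
  refine le_of_forall_gt fun r hr => ?_
  obtain ⟨h1, h2⟩ := max_lt_iff.mp hr
  by_cases hr1 : r ≤ 1
  · obtain ⟨n, hn, hn'⟩ := 𝓕.exists_of_dist_lt h1 hr1
    obtain ⟨m, hm, hm'⟩ := 𝓕.exists_of_dist_lt h2 hr1
    have key : ∀ k, n ≥ k → m ≥ k → (((𝓕.toFun k).index : ℝ≥0∞))⁻¹ < r → 𝓕.dist x z < r := by
      intro k hk hk' hlt
      have : x * z⁻¹ ∈ 𝓕.toFun k := by
        have := mul_mem (𝓕.antitone' hk hn) (𝓕.antitone' hk' hm)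
        simpa [mul_assoc] using this
      exact lt_of_le_of_lt (inf_le_right.trans (iInf₂_le k this)) hlt
    rcases le_total n m with h | h
    · exact key n le_rfl h hn'
    · exact key m h le_rfl hm'
  · exact lt_of_le_of_lt inf_le_left (not_le.mp hr1)

theorem eq_of_dist_eq_zero {x y : Γ} (h : 𝓕.dist x y = 0) : x = y := by
  have hmem : x * y⁻¹ ∈ ⨅ n, 𝓕.toFun n := by
    refine Subgroup.mem_iInf.mpr fun m => ?_
    have hpos : (0 : ℝ≥0∞) < (((𝓕.toFun m).index : ℝ≥0∞))⁻¹ := by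
      simp [ENNReal.inv_pos]
    have hle : (((𝓕.toFun m).index : ℝ≥0∞))⁻¹ ≤ 1 := by
      rw [ENNReal.inv_le_one]
      exact_mod_cast Nat.one_le_iff_ne_zero.mpr (𝓕.index_ne_zero m)
    obtain ⟨n, hn, hlt⟩ := 𝓕.exists_of_dist_lt (h ▸ hpos) hle
    have hlt' : (𝓕.toFun m).index < (𝓕.toFun n).index := by
      exact_mod_cast ENNReal.inv_lt_inv.mp hlt
    have hmn : m ≤ n := by
      by_contra hmn
      exact absurd (𝓕.index_mono (not_le.mp hmn).le) (not_le.mpr hlt')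
    exact 𝓕.antitone' hmn hn
  rw [𝓕.iInf_eq_bot, Subgroup.mem_bot] at hmem
  exact mul_inv_eq_one.mp hmem

/-- The metric defined by a filtration series. -/
@[reducible] noncomputable def metric : EMetricSpace Γ where
  edist := 𝓕.dist
  edist_self := 𝓕.dist_self
  edist_comm := 𝓕.dist_comm
  edist_triangle x y z :=
    (𝓕.dist_le_max x y z).trans (max_le le_self_add le_add_self)
  eq_of_edist_eq_zero := 𝓕.eq_of_dist_eq_zero

/-- The Hausdorff dimension of a subset of `Γ` relative to the filtration series `𝓕`. -/
noncomputable def hdim (s : Set Γ) : ℝ≥0∞ := @dimH Γ 𝓕.metric s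

end FiltrationSeries

/-! ### Formal group laws -/

/-- A `d`-dimensional formal group law over `A`: a `d`-tuple `F(X, Y)` of power series in the
variables `X = (X_i)`, indexed by `Sum.inl i`, and `Y = (Y_i)`, indexed by `Sum.inr i`, with
`F(X, 0) = X`, `F(0, Y) = Y` and `F(F(X, Y), Z) = F(X, F(Y, Z))`. -/
structure FormalGroupLaw (A : Type*) [CommRing A] (d : ℕ) where
  F : Fin d → MvPowerSeries (Fin d ⊕ Fin d) A
  right_zero : ∀ i,
    (F i).subst (Sum.elim MvPowerSeries.X 0 : Fin d ⊕ Fin d → MvPowerSeries (Fin d) A)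
      = MvPowerSeries.X i
  left_zero : ∀ i,
    (F i).subst (Sum.elim 0 MvPowerSeries.X : Fin d ⊕ Fin d → MvPowerSeries (Fin d) A)
      = MvPowerSeries.X i
  assoc : ∀ i,
    (F i).subst (Sum.elim
        (fun j => (F j).subst (Sum.elim
          (fun k => MvPowerSeries.X (Sum.inl k))
          (fun k => MvPowerSeries.X (Sum.inr (Sum.inl k))) :
            Fin d ⊕ Fin d → MvPowerSeries (Fin d ⊕ Fin d ⊕ Fin d) A))
        (fun k => MvPowerSeries.X (Sum.inr (Sum.inr k))) :
          Fin d ⊕ Fin d → MvPowerSeries (Fin d ⊕ Fin d ⊕ Fin d) A)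
      = (F i).subst (Sum.elim
        (fun k => MvPowerSeries.X (Sum.inl k))
        (fun j => (F j).subst (Sum.elim
          (fun k => MvPowerSeries.X (Sum.inr (Sum.inl k)))
          (fun k => MvPowerSeries.X (Sum.inr (Sum.inr k))) :
            Fin d ⊕ Fin d → MvPowerSeries (Fin d ⊕ Fin d ⊕ Fin d) A)) :
          Fin d ⊕ Fin d → MvPowerSeries (Fin d ⊕ Fin d ⊕ Fin d) A)

/-! ### Analytic maps over `𝔽_p[[t]]`

The ring `(ZMod p)⟦X⟧` carries the `t`-adic topology (product topology over the discrete field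
`ZMod p`); its maximal ideal `𝔪` is generated by `t = PowerSeries.X`, so `x ∈ 𝔪 ^ N` is
`PowerSeries.X ^ N ∣ x`. -/

/-- The power series `F` converges at the point `x`, with value `v`. -/
def HasValueAt {p : ℕ} {σ : Type*} [Fintype σ] (F : MvPowerSeries σ (PowerSeries (ZMod p)))
    (x : σ → PowerSeries (ZMod p)) (v : PowerSeries (ZMod p)) : Prop :=
  HasSum (fun α : σ →₀ ℕ => MvPowerSeries.coeff α F * ∏ i, x i ^ α i) v

/-- Let `A` be identified with a subset of the affine space `𝔽_p[[t]]^σ` through the injection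
`e`. A function `f : A → 𝔽_p[[t]]` is analytic if near every point of `A` it is the restriction of
an analytic function of the ambient space: for every `a` there are `N` and a power series `F` over
`𝔽_p[[t]]` with `f (a + t ^ N x) = F(x)` for all points `a + t ^ N x` of `A` with `x ∈ 𝔪^σ`. -/
def IsAnalyticOn {p : ℕ} {A σ : Type*} [Fintype σ] (e : A → σ → PowerSeries (ZMod p))
    (f : A → PowerSeries (ZMod p)) : Prop :=
  ∀ a : A, ∃ (N : ℕ) (F : MvPowerSeries σ (PowerSeries (ZMod p))),
    ∀ (b : A) (x : σ → PowerSeries (ZMod p)), (∀ i, PowerSeries.X ∣ x i) →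
      (∀ i, e b i = e a i + PowerSeries.X ^ N * x i) → HasValueAt F x (f b)

/-- The polydisc `(𝔪 ^ N)^d`. -/
def polydisc (p N d : ℕ) : Set (Fin d → PowerSeries (ZMod p)) :=
  {x | ∀ i, PowerSeries.X ^ N ∣ x i}

/-! ### Open standard subgroups of linear groups, and the standard Hausdorff spectrum -/

/-- An open `𝔽_p[[t]]`-standard subgroup `(S, φ)`, of level `N` and dimension `d`, of a closed
linear group `G` over `𝔽_p[[t]]`, where `G` has the analytic structure of a submanifold of the
space of matrices: `φ` is both a homeomorphism and an analytic isomorphism from `S` to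
`(𝔪 ^ N)^d`, it maps `1` to `0`, and the multiplication of `S` is given in the coordinates `φ` by
a formal group law over `𝔽_p[[t]]`. -/
structure OpenStandardSubgroup {p : ℕ} {ι : Type*} [Fintype ι] [DecidableEq ι]
    (G : Subgroup (GL ι (PowerSeries (ZMod p)))) where
  S : Subgroup G
  isOpen' : IsOpen (S : Set G)
  N : ℕ
  one_le_N : 1 ≤ N
  d : ℕ
  φ : S ≃ₜ polydisc p N d
  analytic_φ : ∀ i, IsAnalyticOn
    (fun (g : S) (jk : ι × ι) => ((g : G) : GL ι (PowerSeries (ZMod p))).val jk.1 jk.2)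
    (fun g => (φ g).1 i)
  analytic_φ_symm : ∀ j k, IsAnalyticOn
    (fun x : polydisc p N d => x.1)
    (fun x => ((φ.symm x : G) : GL ι (PowerSeries (ZMod p))).val j k)
  φ_one : ∀ i, (φ 1).1 i = 0
  law : FormalGroupLaw (PowerSeries (ZMod p)) d
  φ_mul : ∀ (x y : S) (i : Fin d),
    HasValueAt (law.F i) (Sum.elim (φ x).1 (φ y).1) ((φ (x * y)).1 i)

/-- The set `S_n = φ⁻¹((𝔪 ^ (N + n))^d)`. -/
def OpenStandardSubgroup.level {p : ℕ} {ι : Type*} [Fintype ι] [DecidableEq ι]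
    {G : Subgroup (GL ι (PowerSeries (ZMod p)))} (T : OpenStandardSubgroup G) (n : ℕ) : Set G :=
  {g | ∃ hg : g ∈ T.S, (T.φ ⟨g, hg⟩).1 ∈ polydisc p (T.N + n) T.d}

/-- The subgroup `H` of `G` has standard Hausdorff dimension `η`: the group `G` has an open
standard subgroup, and for every open standard subgroup `(S, φ)` of `G` the sets `S_n` form a
filtration series of `G` relative to which `H` has Hausdorff dimension `η`. -/
def HasStandardHausdorffDim {p : ℕ} {ι : Type*} [Fintype ι] [DecidableEq ι]
    (G : Subgroup (GL ι (PowerSeries (ZMod p)))) (H : Subgroup G) (η : ℝ≥0∞) : Prop :=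
  Nonempty (OpenStandardSubgroup G) ∧
    ∀ T : OpenStandardSubgroup G, ∃ 𝓕 : FiltrationSeries G,
      (∀ n, (𝓕.toFun n : Set G) = T.level n) ∧ 𝓕.hdim (H : Set G) = η

/-- The standard Hausdorff spectrum of `G`: the standard Hausdorff dimensions of its closed
subgroups. -/
def standardHausdorffSpectrum {p : ℕ} {ι : Type*} [Fintype ι] [DecidableEq ι]
    (G : Subgroup (GL ι (PowerSeries (ZMod p)))) : Set ℝ :=
  {η | 0 ≤ η ∧ ∃ H : Subgroup G, IsClosed (H : Set G) ∧
    HasStandardHausdorffDim G H (ENNReal.ofReal η)}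

/-! ### The classical groups -/

/-- The matrix with ones on the antidiagonal and zeros elsewhere. -/
def antidiagonalMatrix (A : Type*) [Zero A] [One A] (n : ℕ) : Matrix (Fin n) (Fin n) A :=
  Matrix.of fun i j => if j = i.rev then 1 else 0

/-- The group of invertible matrices `M` with `Mᵀ B M = B`. -/
def isometryGroup {ι A : Type*} [Fintype ι] [DecidableEq ι] [CommRing A] (B : Matrix ι ι A) :
    Subgroup (GL ι A) where
  carrier := {M | M.valᵀ * B * M.val = B}
  one_mem' := by simp
  mul_mem' {M M'} h h' := by
    simp only [Set.mem_ofPred_eq] at h h' ⊢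
    calc ((M * M').val)ᵀ * B * (M * M').val
        = M'.valᵀ * (M.valᵀ * B * M.val) * M'.val := by
          simp [Matrix.transpose_mul, Matrix.mul_assoc]
      _ = B := by rw [h, h']
  inv_mem' {M} h := by
    simp only [Set.mem_ofPred_eq] at h ⊢
    have h1 : M.val * (M⁻¹).val = 1 := by rw [← Units.val_mul]; simp
    have h2 : (M⁻¹).valᵀ * M.valᵀ = 1 := by rw [← Matrix.transpose_mul, h1, Matrix.transpose_one]
    calc (M⁻¹).valᵀ * B * (M⁻¹).val
        = (M⁻¹).valᵀ * (M.valᵀ * B * M.val) * (M⁻¹).val := by rw [h]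
      _ = ((M⁻¹).valᵀ * M.valᵀ) * B * (M.val * (M⁻¹).val) := by simp only [Matrix.mul_assoc]
      _ = B := by rw [h1, h2, Matrix.one_mul, Matrix.mul_one]

/-- `Sp_{2n}(A)`, for the form with matrix `[[0, K], [-K, 0]]`, where `K` is antidiagonal. -/
def classicalSp (A : Type*) [CommRing A] (n : ℕ) : Subgroup (GL (Fin n ⊕ Fin n) A) :=
  isometryGroup (Matrix.fromBlocks 0 (antidiagonalMatrix A n) (-antidiagonalMatrix A n) 0)

/-- `SO_m(A)`, the group of all `m × m` matrices `M` with `Mᵀ K M = K`, where `K` is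
antidiagonal. No condition on the determinant is imposed. -/
def classicalSO (A : Type*) [CommRing A] (m : ℕ) : Subgroup (GL (Fin m) A) :=
  isometryGroup (antidiagonalMatrix A m)

/-!
Write `Γ_k` for the subgroup of the elements of `G` that are congruent to `1` modulo `t ^ k`.

*Reduction to counting.* Let `(S, φ)` be an open standard subgroup of `G`. Analyticity of `φ` and of
its inverse at the identity shows that the filtrations `S_k` and `Γ_k` are cofinal up to a bounded
shift, and the formal group law gives `|S : S_k| = p ^ (d k)`. Covering a closed subgroup `H` by
cosets of `H ∩ Γ_k`, and, in the other direction, the mass distribution principle for the Haar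
measure of `H`, show: if `|H : H ∩ Γ_k| = p ^ (a k)` and `a k / k → η d`, then `H` has Hausdorff
dimension `η` with respect to `S_k` (`hasStandardHausdorffDim_of_relIndex`). The growth of `a` does
not mention `(S, φ)`, and the dimension `d` is an invariant of `G`, so this handles all open
standard subgroups at once.

*Existence of an open standard subgroup.* The isometries `g` of a form `J` with `Jᵀ = ε J` for which
`1 - g` is invertible correspond to the bilinear forms `M = J (1 - g)⁻¹` with `M + ε Mᵀ = J`, an
affine space. Translating by an isometry `g₀` without the eigenvalue `1` gives a chart at the
identity, defined over every local `𝔽_p[[t]]`-algebra, which requires only some invertible `M₀` with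
`M₀ + ε M₀ᵀ = J` (`CayleyDatum.formalChart`). In the symplectic case there is such an `M₀` also for
`p = 2`. The chart and its inverse are natural in the algebra; applied to power series rings, this
yields the formal group law and the analyticity (`FormalChart.openStandardSubgroup`).

*The subgroups.* Order the basis so that `J` is antidiagonal. An upper triangular isometry congruent
to `1` is determined to leading order by its entries at the `L` positions `(i, j)` on or above the
diagonal that lie on one side of the antidiagonal, the antidiagonal itself being included in the
alternating case only (`AntidiagonalForm.live`). Order the positions by the distance from the
diagonal. Demanding that the entries before a live position `q₀` be trivial cuts out a group, in
which the entry at `q₀` is multiplicative if `q₀` is diagonal and additive otherwise; so one may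
moreover restrict that entry to a closed subgroup of `1 + t 𝔽_p[[t]]` or of `𝔽_p[[t]]`. For a set
`M` of integers prime to `p`, the closed subgroup generated by the `1 + t ^ m` with `m ∈ M` has its
leading exponents in `Z = ⋃ j, M p ^ j`, and the density of `Z` may be any `θ ∈ [0, 1]`
(`exists_powMultiples_density`); in the additive case one takes the series in the `t ^ k` with
`k ∈ Z`. If `t` live positions come after `q₀`, the resulting group has `a k / k → t + θ`
(`AntidiagonalForm.exists_hasIndexGrowth`). So the spectrum contains `[0, L / d]`, and
`d = n (2 n + 1)`, `L = n (n + 1)` for `Sp_{2n}` and `SO_{2n+1}`, while `d = n (2 n - 1)` and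
`L = n ^ 2` for `SO_{2n}`.

*Characteristic two.* For `p = 2` the form `K_{2n+1}` is the sum of an alternating form and the
square of the middle coordinate. Hence `x ↦ x_mid ^ 2` is preserved by `SO_{2n+1}`, which therefore
fixes the middle basis vector and coordinate and is isomorphic to `Sp_{2n}`, compatibly with all
congruence subgroups (`AntidiagonalForm.isometryGroup_addFixedIndex`).
-/

open Filter Topology
open scoped PowerSeries

/-! ### The `t`-adic topology and values of power series -/

section PowerSeriesTopology

variable {p : ℕ}

theorem mem_nhds_iff_exists_X_pow_dvd {x : (ZMod p)⟦X⟧} {s : Set (ZMod p)⟦X⟧} :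
    s ∈ 𝓝 x ↔ ∃ k : ℕ, ∀ y, PowerSeries.X ^ k ∣ y - x → y ∈ s := by
  constructor
  · intro hs
    have h : 𝓝 x = ⨅ d : Unit →₀ ℕ, comap (fun y : (ZMod p)⟦X⟧ => y d) (𝓝 (x d)) :=
      nhds_pi
    rw [h, mem_iInf] at hs
    obtain ⟨I, hI, V, hV, rfl⟩ := hs
    have hbd : BddAbove ((fun d : Unit →₀ ℕ => d ()) '' I) := (hI.image _).bddAbove
    obtain ⟨K, hK⟩ := hbd
    refine ⟨K + 1, fun y hy => Set.mem_iInter.mpr fun i => ?_⟩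
    obtain ⟨U, hU, hUV⟩ := mem_comap.mp (hV i)
    apply hUV
    rw [PowerSeries.X_pow_dvd_iff] at hy
    have hi : i.1 () < K + 1 := Nat.lt_succ_of_le (hK ⟨i.1, i.2, rfl⟩)
    have h1 := hy _ hi
    rw [map_sub, sub_eq_zero] at h1
    have h3 : y i.1 = x i.1 := by
      rw [PowerSeries.coeff_def (s := i.1) rfl] at h1
      exact h1
    simpa [h3] using mem_of_mem_nhds hU
  · rintro ⟨k, hk⟩
    have : (⋂ i ∈ Finset.range k, {y : (ZMod p)⟦X⟧ | PowerSeries.coeff i y = PowerSeries.coeff i x})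
        ∈ 𝓝 x := by
      rw [Filter.biInter_finset_mem]
      intro i _
      refine (PowerSeries.WithPiTopology.continuous_coeff (ZMod p) i).continuousAt.preimage_mem_nhds
        (t := {PowerSeries.coeff i x}) ?_
      simp
    refine mem_of_superset this fun y hy => hk y ?_
    rw [PowerSeries.X_pow_dvd_iff]
    intro m hm
    have := Set.mem_iInter₂.mp hy m (Finset.mem_range.mpr hm)
    simpa [sub_eq_zero] using this

theorem isOpen_setOf_X_pow_dvd_sub (k : ℕ) (x : (ZMod p)⟦X⟧) :
    IsOpen {y : (ZMod p)⟦X⟧ | PowerSeries.X ^ k ∣ y - x} := by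
  rw [isOpen_iff_mem_nhds]
  intro y hy
  refine mem_nhds_iff_exists_X_pow_dvd.mpr ⟨k, fun z hz => ?_⟩
  have := dvd_add hz hy
  simpa using this

theorem isClosed_setOf_X_pow_dvd (k : ℕ) :
    IsClosed {y : (ZMod p)⟦X⟧ | PowerSeries.X ^ k ∣ y} := by
  rw [← isOpen_compl_iff, isOpen_iff_mem_nhds]
  intro y hy
  refine mem_nhds_iff_exists_X_pow_dvd.mpr ⟨k, fun z hz hz' => hy ?_⟩
  have := dvd_sub hz' hz
  simpa using this

theorem X_pow_dvd_of_hasSum {β : Type*} {f : β → (ZMod p)⟦X⟧} {v : (ZMod p)⟦X⟧} {k : ℕ}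
    (h : HasSum f v) (hf : ∀ b, PowerSeries.X ^ k ∣ f b) : PowerSeries.X ^ k ∣ v :=
  (isClosed_setOf_X_pow_dvd k).mem_of_tendsto h
    (Eventually.of_forall fun _ => Finset.dvd_sum fun b _ => hf b)

theorem PowerSeries.eq_zero_of_forall_X_pow_dvd {A : Type*} [Semiring A] {x : A⟦X⟧}
    (h : ∀ k, PowerSeries.X ^ k ∣ x) : x = 0 := by
  ext k
  exact PowerSeries.X_pow_dvd_iff.mp (h (k + 1)) k (Nat.lt_succ_self k)

instance : IsLinearTopology (ZMod p)⟦X⟧ (ZMod p)⟦X⟧ := by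
  refine IsLinearTopology.mk_of_hasBasis' (ι := ℕ) (p := fun _ => True)
    (s := fun k => Ideal.span {(PowerSeries.X ^ k : (ZMod p)⟦X⟧)}) (R := (ZMod p)⟦X⟧) ?_
    (fun I r m hm => Submodule.smul_mem _ r hm)
  refine ⟨fun t => ?_⟩
  rw [mem_nhds_iff_exists_X_pow_dvd]
  simp [Set.subset_def, Ideal.mem_span_singleton]

/-- Every power series over `𝔽_p[[t]]` can be evaluated at the points of the maximal ideal, and
evaluation is a homomorphism of `𝔽_p[[t]]`-algebras. -/
theorem exists_algHom_hasValueAt {σ : Type*} [Fintype σ] {x : σ → (ZMod p)⟦X⟧}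
    (hx : ∀ i, PowerSeries.X ∣ x i) :
    ∃ f : MvPowerSeries σ (ZMod p)⟦X⟧ →ₐ[(ZMod p)⟦X⟧] (ZMod p)⟦X⟧,
      (∀ F, HasValueAt F x (f F)) ∧ ∀ i, f (MvPowerSeries.X i) = x i := by
  let : UniformSpace (ZMod p) := ⊥
  have : DiscreteUniformity (ZMod p) := ⟨rfl⟩
  have ha : MvPowerSeries.HasEval x := by
    refine ⟨fun s => ?_, by simp⟩
    refine PowerSeries.WithPiTopology.isTopologicallyNilpotent_of_constantCoeff_zero ?_
    exact PowerSeries.X_dvd_iff.mp (hx s)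
  have : IsUniformAddGroup (ZMod p) := inferInstance
  have : CompleteSpace (ZMod p) := inferInstance
  refine ⟨MvPowerSeries.aeval ha, fun F => ?_, fun i => ?_⟩
  · have := MvPowerSeries.hasSum_aeval ha F
    have h : (fun d : σ →₀ ℕ => MvPowerSeries.coeff d F * ∏ i, x i ^ d i) =
        fun d => MvPowerSeries.coeff d F • d.prod fun s e => x s ^ e := by
      funext d
      rw [smul_eq_mul, Finsupp.prod_fintype _ _ fun i => pow_zero _]
    rw [HasValueAt, h]
    exact this
  · rw [← MvPolynomial.coe_X, MvPowerSeries.aeval_coe, MvPolynomial.aeval_X]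

theorem HasValueAt.X_pow_dvd_sub {σ : Type*} [Fintype σ] {F : MvPowerSeries σ (ZMod p)⟦X⟧}
    {x : σ → (ZMod p)⟦X⟧} {v v₀ : (ZMod p)⟦X⟧} {k : ℕ} (h : HasValueAt F x v)
    (h₀ : HasValueAt F 0 v₀) (hx : ∀ i, PowerSeries.X ^ k ∣ x i) :
    PowerSeries.X ^ k ∣ v - v₀ := by
  refine X_pow_dvd_of_hasSum (HasSum.sub h h₀) fun α => ?_
  rw [← mul_sub]
  refine Dvd.dvd.mul_left ?_ _
  by_cases hα : α = 0
  · simp [hα]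
  · obtain ⟨i, hi⟩ := Finsupp.ne_iff.mp hα
    rw [Finsupp.coe_zero, Pi.zero_apply] at hi
    rw [Finset.prod_eq_zero (f := fun i => (0 : σ → (ZMod p)⟦X⟧) i ^ α i) (Finset.mem_univ i)
      (by simp [hi]), sub_zero]
    exact ((hx i).trans (dvd_pow_self _ hi)).trans (Finset.dvd_prod_of_mem _ (Finset.mem_univ i))

/-- A monomial is constant, or it vanishes at `0` and is small at small points. -/
theorem prod_pow_eq_or_dvd {σ : Type*} [Fintype σ] {z : σ → (ZMod p)⟦X⟧} (β : σ → ℕ) {c : ℕ}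
    (hz : ∀ i, PowerSeries.X ^ c ∣ z i) :
    (∏ i, z i ^ β i = ∏ i, (0 : σ → (ZMod p)⟦X⟧) i ^ β i) ∨
      (∏ i, (0 : σ → (ZMod p)⟦X⟧) i ^ β i = 0 ∧ PowerSeries.X ^ c ∣ ∏ i, z i ^ β i) := by
  by_cases hβ : β = 0
  · left; simp [hβ]
  · right
    obtain ⟨i, hi⟩ := Function.ne_iff.mp hβ
    rw [Pi.zero_apply] at hi
    exact ⟨Finset.prod_eq_zero (Finset.mem_univ i) (by simp [hi]),
      ((hz i).trans (dvd_pow_self _ hi)).trans (Finset.dvd_prod_of_mem _ (Finset.mem_univ i))⟩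

/-- The mixed difference `F(x, y) - F(x, 0) - F(0, y) + F(0, 0)` only involves monomials in which
some `X_i` and some `Y_j` occur. -/
theorem HasValueAt.X_pow_dvd_mixed_difference {σ τ : Type*} [Fintype σ] [Fintype τ]
    {F : MvPowerSeries (σ ⊕ τ) (ZMod p)⟦X⟧} {x : σ → (ZMod p)⟦X⟧} {y : τ → (ZMod p)⟦X⟧}
    {v vx vy v₀ : (ZMod p)⟦X⟧} {a b : ℕ} (h : HasValueAt F (Sum.elim x y) v)
    (hvx : HasValueAt F (Sum.elim x 0) vx) (hvy : HasValueAt F (Sum.elim 0 y) vy)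
    (h₀ : HasValueAt F (Sum.elim 0 0) v₀) (hx : ∀ i, PowerSeries.X ^ a ∣ x i)
    (hy : ∀ i, PowerSeries.X ^ b ∣ y i) :
    PowerSeries.X ^ (a + b) ∣ v - vx - vy + v₀ := by
  refine X_pow_dvd_of_hasSum (((HasSum.sub h hvx).sub hvy).add h₀) fun α => ?_
  rw [← mul_sub, ← mul_sub, ← mul_add]
  refine Dvd.dvd.mul_left ?_ _
  simp only [Fintype.prod_sum_type, Sum.elim_inl, Sum.elim_inr]
  rcases prod_pow_eq_or_dvd (fun i => α (Sum.inl i)) hx with h1 | ⟨h1, h1'⟩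
  · rw [h1]; ring_nf; exact dvd_zero _
  · rcases prod_pow_eq_or_dvd (fun i => α (Sum.inr i)) hy with h2 | ⟨h2, h2'⟩
    · rw [h2]; ring_nf; exact dvd_zero _
    · rw [h1, h2, pow_add]
      simpa using mul_dvd_mul h1' h2'

end PowerSeriesTopology

/-! ### Congruence subgroups -/

section CongruenceSubgroup

variable {p : ℕ} {ι : Type*} [Fintype ι] [DecidableEq ι]

/-- The elements of `G` that are congruent to `1` modulo `t ^ k`. -/
noncomputable def congruenceSubgroup (G : Subgroup (GL ι (ZMod p)⟦X⟧)) (k : ℕ) : Subgroup G :=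
  ((Matrix.GeneralLinearGroup.map
    (Ideal.Quotient.mk (Ideal.span {(PowerSeries.X ^ k : (ZMod p)⟦X⟧)}))).comp G.subtype).ker

variable {G : Subgroup (GL ι (ZMod p)⟦X⟧)}

instance (k : ℕ) : (congruenceSubgroup G k).Normal := MonoidHom.normal_ker _

theorem mem_congruenceSubgroup {k : ℕ} {g : G} :
    g ∈ congruenceSubgroup G k ↔
      ∀ i j, PowerSeries.X ^ k ∣ (g : GL ι (ZMod p)⟦X⟧).val i j - (1 : Matrix ι ι (ZMod p)⟦X⟧) i j := by
  rw [congruenceSubgroup, MonoidHom.mem_ker, Units.ext_iff, ← Matrix.ext_iff]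
  refine forall₂_congr fun i j => ?_
  rw [← Ideal.mem_span_singleton, ← Ideal.Quotient.eq]
  have : (1 : Matrix ι ι ((ZMod p)⟦X⟧ ⧸ Ideal.span {(PowerSeries.X ^ k : (ZMod p)⟦X⟧)})) i j =
      Ideal.Quotient.mk _ ((1 : Matrix ι ι (ZMod p)⟦X⟧) i j) := by
    simp only [Matrix.one_apply]; split_ifs <;> simp
  rw [← this]
  rfl

theorem congruenceSubgroup_antitone : Antitone (congruenceSubgroup G) := by
  intro k l h g hg
  rw [mem_congruenceSubgroup] at hg ⊢
  exact fun i j => (pow_dvd_pow _ h).trans (hg i j)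

theorem eq_one_of_forall_mem_congruenceSubgroup {g : G} (h : ∀ k, g ∈ congruenceSubgroup G k) :
    g = 1 := by
  refine Subtype.ext (Units.ext (Matrix.ext fun i j => ?_))
  exact sub_eq_zero.mp
    (PowerSeries.eq_zero_of_forall_X_pow_dvd fun k => mem_congruenceSubgroup.mp (h k) i j)

theorem mul_inv_mem_congruenceSubgroup {k : ℕ} {g h : G} :
    g * h⁻¹ ∈ congruenceSubgroup G k ↔
      ∀ i j, PowerSeries.X ^ k ∣
        (g : GL ι (ZMod p)⟦X⟧).val i j - (h : GL ι (ZMod p)⟦X⟧).val i j := by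
  rw [congruenceSubgroup, MonoidHom.mem_ker, map_mul, map_inv, mul_inv_eq_one, Units.ext_iff,
    ← Matrix.ext_iff]
  refine forall₂_congr fun i j => ?_
  rw [← Ideal.mem_span_singleton, ← Ideal.Quotient.eq]
  rfl

theorem inv_mul_mem_congruenceSubgroup {k : ℕ} {g h : G} :
    g⁻¹ * h ∈ congruenceSubgroup G k ↔
      ∀ i j, PowerSeries.X ^ k ∣
        (g : GL ι (ZMod p)⟦X⟧).val i j - (h : GL ι (ZMod p)⟦X⟧).val i j := by
  rw [← mul_inv_mem_congruenceSubgroup, ← inv_mem_iff (x := g * h⁻¹), mul_inv_rev, inv_inv,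
    (inferInstance : (congruenceSubgroup G k).Normal).mem_comm_iff]

theorem continuous_entry (i j : ι) :
    Continuous fun g : G => (g : GL ι (ZMod p)⟦X⟧).val i j :=
  (Units.continuous_val.comp continuous_subtype_val).matrix_elem i j

theorem isOpen_congruenceSubgroup (k : ℕ) : IsOpen (congruenceSubgroup G k : Set G) := by
  have : (congruenceSubgroup G k : Set G) = ⋂ i, ⋂ j, (fun g : G =>
      (g : GL ι (ZMod p)⟦X⟧).val i j) ⁻¹' {y | PowerSeries.X ^ k ∣
        y - (1 : Matrix ι ι (ZMod p)⟦X⟧) i j} := by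
    ext g; simp [mem_congruenceSubgroup]
  rw [this]
  exact isOpen_iInter_of_finite fun i => isOpen_iInter_of_finite fun j =>
    (isOpen_setOf_X_pow_dvd_sub k _).preimage (continuous_entry i j)

variable [Fact p.Prime]

instance : CompactSpace (ZMod p)⟦X⟧ :=
  inferInstanceAs (CompactSpace ((Unit →₀ ℕ) → ZMod p))

theorem exists_congruenceSubgroup_subset [CompactSpace G] {U : Set G} (hU : U ∈ 𝓝 1) :
    ∃ k, (congruenceSubgroup G k : Set G) ⊆ U := by
  refine exists_subset_nhds_of_compactSpace
    (V := fun k => (congruenceSubgroup G k : Set G))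
    (Antitone.directed_ge fun _ _ h => congruenceSubgroup_antitone h)
    (fun k => Subgroup.isClosed_of_isOpen _ (isOpen_congruenceSubgroup k)) fun g hg => ?_
  rw [eq_one_of_forall_mem_congruenceSubgroup fun k => Set.mem_iInter.mp hg k]
  exact hU

theorem compactSpace_of_isClosed (hG : IsClosed (G : Set (GL ι (ZMod p)⟦X⟧))) :
    CompactSpace G := by
  have : CompactSpace (Matrix ι ι (ZMod p)⟦X⟧) :=
    inferInstanceAs (CompactSpace (ι → ι → (ZMod p)⟦X⟧))
  have : CompactSpace (GL ι (ZMod p)⟦X⟧) :=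
    inferInstanceAs (CompactSpace (Matrix ι ι (ZMod p)⟦X⟧)ˣ)
  exact isCompact_iff_compactSpace.mp hG.isCompact

end CongruenceSubgroup

/-! ### The filtration of an open standard subgroup -/

namespace OpenStandardSubgroup

variable {p : ℕ} {ι : Type*} [Fintype ι] [DecidableEq ι] {G : Subgroup (GL ι (ZMod p)⟦X⟧)}
  (T : OpenStandardSubgroup G)

/-- In the coordinates `φ` the multiplication is addition up to the terms of `F` that mix the two
sets of variables. -/
theorem mul_coordinates {x y : T.S} {a b : ℕ} (hx : (T.φ x).1 ∈ polydisc p a T.d)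
    (hy : (T.φ y).1 ∈ polydisc p b T.d) (i : Fin T.d) :
    PowerSeries.X ^ (a + b) ∣ (T.φ (x * y)).1 i - (T.φ x).1 i - (T.φ y).1 i := by
  have h1 : (T.φ 1).1 = 0 := funext T.φ_one
  have hvx := T.φ_mul x 1 i
  have hvy := T.φ_mul 1 y i
  have h0 := T.φ_mul 1 1 i
  rw [mul_one, h1] at hvx
  rw [one_mul, h1] at hvy
  rw [mul_one, h1] at h0
  simpa using (T.φ_mul x y i).X_pow_dvd_mixed_difference hvx hvy h0 hx hy

theorem inv_coordinates {x : T.S} {a : ℕ} (hx : (T.φ x).1 ∈ polydisc p a T.d) :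
    (T.φ x⁻¹).1 ∈ polydisc p a T.d := by
  intro i
  have h := T.mul_coordinates hx (b := 0) (y := x⁻¹) (fun i => by simp) i
  rw [mul_inv_cancel, T.φ_one, add_zero, zero_sub] at h
  have h2 := dvd_neg.mpr (dvd_add h (hx i))
  have e : -((-(T.φ x).1 i - (T.φ x⁻¹).1 i) + (T.φ x).1 i) = (T.φ x⁻¹).1 i := by ring
  rwa [e] at h2

/-- The subgroup `S_n`, as a subgroup of `S`. -/
def levelSubgroup (n : ℕ) : Subgroup T.S where
  carrier := {x | (T.φ x).1 ∈ polydisc p (T.N + n) T.d}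
  one_mem' i := by rw [T.φ_one]; exact dvd_zero _
  mul_mem' {x y} hx hy i := by
    have h := T.mul_coordinates hx (b := 0) (y := y) (fun i => by simp) i
    rw [add_zero] at h
    have h2 := dvd_add (dvd_add h (hx i)) (hy i)
    have e : (T.φ (x * y)).1 i - (T.φ x).1 i - (T.φ y).1 i + (T.φ x).1 i + (T.φ y).1 i =
      (T.φ (x * y)).1 i := by ring
    rwa [e] at h2
  inv_mem' hx := T.inv_coordinates hx

theorem mem_levelSubgroup {n : ℕ} {x : T.S} :
    x ∈ T.levelSubgroup n ↔ (T.φ x).1 ∈ polydisc p (T.N + n) T.d := Iff.rfl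

theorem mul_inv_mem_levelSubgroup {n : ℕ} {x y : T.S} :
    x * y⁻¹ ∈ T.levelSubgroup n ↔
      ∀ i, PowerSeries.X ^ (T.N + n) ∣ (T.φ x).1 i - (T.φ y).1 i := by
  obtain ⟨z, rfl⟩ : ∃ z, x = z * y := ⟨x * y⁻¹, by group⟩
  rw [mul_inv_cancel_right, mem_levelSubgroup]
  constructor
  · intro hz i
    have h := T.mul_coordinates hz (b := 0) (y := y) (fun i => by simp) i
    rw [add_zero] at h
    have h2 := dvd_add h (hz i)
    rwa [show (T.φ (z * y)).1 i - (T.φ z).1 i - (T.φ y).1 i + (T.φ z).1 i =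
      (T.φ (z * y)).1 i - (T.φ y).1 i by ring] at h2
  · intro h
    -- each step improves the congruence for `φ z` because `φ y` lies in `𝔪 ^ N` with `N ≥ 1`
    have key : ∀ j ≤ T.N + n, (T.φ z).1 ∈ polydisc p j T.d := by
      intro j
      induction j with
      | zero => intro _ i; simp
      | succ j ih =>
        intro hj i
        have h1 := T.mul_coordinates (ih (by omega)) (T.φ y).2 i
        have h2 : (PowerSeries.X : (ZMod p)⟦X⟧) ^ (j + 1) ∣
            (T.φ (z * y)).1 i - (T.φ z).1 i - (T.φ y).1 i :=
          (pow_dvd_pow _ (by have := T.one_le_N; omega)).trans h1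
        have h3 := dvd_sub ((pow_dvd_pow _ hj).trans (h i)) h2
        rwa [show (T.φ (z * y)).1 i - (T.φ y).1 i -
          ((T.φ (z * y)).1 i - (T.φ z).1 i - (T.φ y).1 i) = (T.φ z).1 i by ring] at h3
    exact key _ le_rfl

/-- The cosets of `S_n` are the fibres of the `n` leading coefficients of the coordinates. -/
theorem index_levelSubgroup [Fact p.Prime] (n : ℕ) :
    (T.levelSubgroup n).index = p ^ (T.d * n) := by
  let f : T.S → Fin T.d → Fin n → ZMod p :=
    fun x i j => PowerSeries.coeff (T.N + j) ((T.φ x⁻¹).1 i)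
  have hf : ∀ x y, f x = f y ↔ (QuotientGroup.leftRel (T.levelSubgroup n)) x y := by
    intro x y
    rw [QuotientGroup.leftRel_apply]
    have := T.mul_inv_mem_levelSubgroup (n := n) (x := x⁻¹) (y := y⁻¹)
    rw [inv_inv] at this
    rw [this, funext_iff]
    refine forall_congr' fun i => ?_
    rw [PowerSeries.X_pow_dvd_iff, funext_iff]
    constructor
    · intro h m hm
      rw [map_sub, sub_eq_zero]
      by_cases hmN : m < T.N
      · rw [PowerSeries.X_pow_dvd_iff.mp ((T.φ x⁻¹).2 i) m hmN,
          PowerSeries.X_pow_dvd_iff.mp ((T.φ y⁻¹).2 i) m hmN]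
      · have := h ⟨m - T.N, by omega⟩
        simp only [f] at this
        rwa [Nat.add_sub_cancel' (not_lt.mp hmN)] at this
    · intro h j
      exact sub_eq_zero.mp (by rw [← map_sub]; exact h _ (by omega))
  have hsurj : Function.Surjective f := by
    intro v
    let w : Fin T.d → (ZMod p)⟦X⟧ := fun i =>
      PowerSeries.X ^ T.N * PowerSeries.mk fun j => if hj : j < n then v i ⟨j, hj⟩ else 0
    have hw : w ∈ polydisc p T.N T.d := fun i => dvd_mul_right _ _
    refine ⟨(T.φ.symm ⟨w, hw⟩)⁻¹, ?_⟩
    funext i j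
    simp only [f, inv_inv, Homeomorph.apply_symm_apply, w]
    rw [PowerSeries.coeff_X_pow_mul']
    simp
  let g : T.S ⧸ T.levelSubgroup n → Fin T.d → Fin n → ZMod p :=
    Quotient.lift f fun x y h => (hf x y).mpr h
  have hg : Function.Bijective g := by
    refine ⟨?_, fun v => ?_⟩
    · intro a b
      induction a using Quotient.inductionOn with | _ x
      induction b using Quotient.inductionOn with | _ y
      exact fun h => Quotient.sound ((hf x y).mp h)
    · obtain ⟨x, hx⟩ := hsurj v
      exact ⟨Quotient.mk _ x, hx⟩
  rw [Subgroup.index, Nat.card_eq_of_bijective g hg, Nat.card_eq_fintype_card, Fintype.card_fun,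
    Fintype.card_fun, ZMod.card, Fintype.card_fin, Fintype.card_fin, ← pow_mul, mul_comm]

/-- The subgroup `S_n`, as a subgroup of `G`. -/
noncomputable def levelGroup (n : ℕ) : Subgroup G := (T.levelSubgroup n).map T.S.subtype

theorem coe_levelGroup (n : ℕ) : (T.levelGroup n : Set G) = T.level n := by
  ext g
  simp [levelGroup, level, mem_levelSubgroup]

theorem index_levelGroup [Fact p.Prime] (n : ℕ) :
    (T.levelGroup n).index = T.S.index * p ^ (T.d * n) := by
  rw [levelGroup, Subgroup.index_map, Subgroup.ker_subtype, sup_bot_eq, Subgroup.range_subtype,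
    T.index_levelSubgroup, mul_comm]

theorem isOpen_levelGroup (n : ℕ) : IsOpen (T.levelGroup n : Set G) := by
  have h : IsOpen (T.levelSubgroup n : Set T.S) := by
    have : (T.levelSubgroup n : Set T.S) = ⋂ i, (fun x => (T.φ x).1 i) ⁻¹'
        {y | PowerSeries.X ^ (T.N + n) ∣ y - 0} := by
      ext x; simp [mem_levelSubgroup, polydisc]
    rw [this]
    exact isOpen_iInter_of_finite fun i => (isOpen_setOf_X_pow_dvd_sub _ 0).preimage
      ((continuous_apply i).comp (continuous_subtype_val.comp T.φ.continuous))
  exact T.isOpen'.isOpenMap_subtype_val _ h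

theorem levelGroup_antitone : Antitone T.levelGroup := fun _ _ h =>
  Subgroup.map_mono fun _ hx i => (pow_dvd_pow _ (Nat.add_le_add_left h _)).trans (hx i)

theorem iInf_levelGroup : ⨅ n, T.levelGroup n = ⊥ := by
  rw [eq_bot_iff]
  intro g hg
  have h0 : ∀ n, ∃ x ∈ T.levelSubgroup n, (x : G) = g := fun n => Subgroup.mem_iInf.mp hg n
  obtain ⟨x, -, rfl⟩ := h0 0
  have hx : ∀ n, x ∈ T.levelSubgroup n := fun n => by
    obtain ⟨y, hy, hxy⟩ := h0 n
    rwa [← Subtype.ext hxy]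
  have h1 : T.φ x = T.φ 1 := by
    refine Subtype.ext (funext fun i => ?_)
    rw [T.φ_one]
    exact PowerSeries.eq_zero_of_forall_X_pow_dvd fun k =>
      (pow_dvd_pow _ (Nat.le_add_left k T.N)).trans (hx k i)
  rw [T.φ.injective h1]
  simp

/-- The expansion of `φ` at the identity converges on a neighbourhood, on which `φ` loses a bounded
number of powers of `t`. -/
theorem exists_congruenceSubgroup_le_levelGroup [Fact p.Prime] [CompactSpace G] :
    ∃ c, ∀ k, congruenceSubgroup G (k + c) ≤ T.levelGroup k := by
  obtain ⟨c₀, hc₀⟩ := exists_congruenceSubgroup_subset (T.isOpen'.mem_nhds (one_mem T.S))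
  choose N F hF using fun i => T.analytic_φ i 1
  refine ⟨c₀ + T.N + 1 + ∑ i, N i, fun k g hg => ?_⟩
  have hgS : g ∈ T.S := hc₀ (congruenceSubgroup_antitone (by omega) hg)
  refine ⟨⟨g, hgS⟩, fun i => ?_, rfl⟩
  have hN : N i ≤ ∑ i, N i := Finset.single_le_sum (fun _ _ => Nat.zero_le _) (Finset.mem_univ i)
  rw [mem_congruenceSubgroup] at hg
  have hdiv : ∀ jk : ι × ι, ∃ y, (g : GL ι (ZMod p)⟦X⟧).val jk.1 jk.2 -
      (1 : Matrix ι ι (ZMod p)⟦X⟧) jk.1 jk.2 =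
        PowerSeries.X ^ N i * (PowerSeries.X ^ (T.N + k + 1) * y) := by
    intro jk
    obtain ⟨y, hy⟩ := (pow_dvd_pow (PowerSeries.X : (ZMod p)⟦X⟧)
      (show N i + (T.N + k + 1) ≤ _ by omega)).trans (hg jk.1 jk.2)
    exact ⟨y, by rw [hy, pow_add, mul_assoc]⟩
  choose y hy using hdiv
  have hv := hF i ⟨g, hgS⟩ (fun jk => PowerSeries.X ^ (T.N + k + 1) * y jk)
    (fun jk => (dvd_pow_self _ (by omega)).mul_right _)
    (fun jk => by rw [← hy]; simp)
  have hv0 := hF i 1 0 (fun jk => dvd_zero _) (fun jk => by simp)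
  have h := hv.X_pow_dvd_sub hv0 (k := T.N + k) fun jk =>
    (pow_dvd_pow _ (Nat.le_succ _)).mul_right _
  simpa only [T.φ_one, sub_zero] using h

theorem exists_levelGroup_le_congruenceSubgroup :
    ∃ c, ∀ k, T.levelGroup (k + c) ≤ congruenceSubgroup G k := by
  have h1 : (T.φ 1).1 = 0 := funext T.φ_one
  choose N F hF using fun jk : ι × ι => T.analytic_φ_symm jk.1 jk.2 (T.φ 1)
  refine ⟨1 + ∑ i, N i, fun k => ?_⟩
  rintro _ ⟨g, hg, rfl⟩
  rw [mem_congruenceSubgroup]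
  intro i j
  have hN : N (i, j) ≤ ∑ i, N i :=
    Finset.single_le_sum (fun _ _ => Nat.zero_le _) (Finset.mem_univ (i, j))
  have hdiv : ∀ l, ∃ y, (T.φ g).1 l =
      PowerSeries.X ^ N (i, j) * (PowerSeries.X ^ (k + 1) * y) := by
    intro l
    obtain ⟨y, hy⟩ := (pow_dvd_pow (PowerSeries.X : (ZMod p)⟦X⟧)
      (show N (i, j) + (k + 1) ≤ _ by omega)).trans (hg l)
    exact ⟨y, by rw [hy, pow_add, mul_assoc]⟩
  choose y hy using hdiv
  have hv := hF (i, j) (T.φ g) (fun l => PowerSeries.X ^ (k + 1) * y l)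
    (fun jk => (dvd_pow_self _ (by omega)).mul_right _)
    (fun l => by simp only [h1, ← hy]; simp)
  have hv0 := hF (i, j) (T.φ 1) 0 (fun jk => dvd_zero _) (fun l => by simp)
  have h := hv.X_pow_dvd_sub hv0 (k := k) fun l => (pow_dvd_pow _ (Nat.le_succ _)).mul_right _
  simpa using h

end OpenStandardSubgroup

/-! ### Hausdorff dimension of images of groups -/

section HausdorffDimension

open MeasureTheory

/-- An upper bound for the dimension of the image of a group, from its covers by the cosets of a
sequence of subgroups of finite index. -/
theorem dimH_range_le_of_index {H X : Type*} [Group H] [EMetricSpace X] (f : H → X)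
    (K : ℕ → Subgroup H) (hK : ∀ k, (K k).index ≠ 0) (r : ℕ → ℝ≥0∞) (hr : Tendsto r atTop (𝓝 0))
    (hd : ∀ k h h', h⁻¹ * h' ∈ K k → edist (f h) (f h') ≤ r k) (s : NNReal)
    (hs : ∀ᶠ k in atTop, ((K k).index : ℝ≥0∞) * r k ^ (s : ℝ) ≤ 1) :
    dimH (Set.range f) ≤ s := by
  borelize X
  refine dimH_le_of_hausdorffMeasure_ne_top (ne_top_of_le_ne_top ENNReal.one_ne_top ?_)
  have hfin : ∀ k, Finite (H ⧸ K k) := fun k => by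
    have : (K k).FiniteIndex := ⟨hK k⟩; infer_instance
  let _ : ∀ k, Fintype (H ⧸ K k) := fun k => Fintype.ofFinite _
  let t : ∀ k, H ⧸ K k → Set X := fun k q => f '' {h | (QuotientGroup.mk h : H ⧸ K k) = q}
  have ht : ∀ k q, Metric.ediam (t k q) ≤ r k := by
    intro k q
    refine Metric.ediam_le ?_
    rintro _ ⟨h, hh, rfl⟩ _ ⟨h', hh', rfl⟩
    exact hd k h h' (QuotientGroup.eq.mp (hh.trans hh'.symm))
  refine (Measure.hausdorffMeasure_le_liminf_sum (s : ℝ) (Set.range f) r hr t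
    (Eventually.of_forall ht) (Eventually.of_forall fun k => ?_)).trans ?_
  · rintro _ ⟨h, rfl⟩
    exact Set.mem_iUnion.mpr ⟨QuotientGroup.mk h, h, rfl, rfl⟩
  · refine liminf_le_of_frequently_le' (Eventually.frequently (hs.mono fun k hk => ?_))
    refine le_trans ?_ hk
    calc ∑ q, Metric.ediam (t k q) ^ (s : ℝ) ≤ ∑ _q : H ⧸ K k, r k ^ (s : ℝ) :=
          Finset.sum_le_sum fun q _ => ENNReal.rpow_le_rpow (ht k q) s.2
      _ = _ := by
          rw [Finset.sum_const, nsmul_eq_mul, Finset.card_univ, ← Nat.card_eq_fintype_card]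
          rfl

/-- A lower bound for the dimension of the image of a compact group, by the mass distribution
principle for the image of Haar measure. -/
theorem le_dimH_range_of_index {H X : Type*} [Group H] [TopologicalSpace H] [IsTopologicalGroup H]
    [CompactSpace H] [T2Space H] [EMetricSpace X] (f : H → X)
    (hf : ∀ h, ∀ ε > 0, ∀ᶠ h' in 𝓝 h, edist (f h') (f h) < ε)
    (K : ℕ → Subgroup H) (hK : ∀ k, IsOpen (K k : Set H)) (s : NNReal) (ε : ℝ≥0∞)
    (hε : 0 < ε)
    (hs : ∀ x : X, ∀ δ, 0 < δ → δ ≤ ε → ∃ k, ((K k).index : ℝ≥0∞)⁻¹ ≤ δ ^ (s : ℝ) ∧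
      ∀ h h', edist x (f h) ≤ δ → edist x (f h') ≤ δ → h⁻¹ * h' ∈ K k) :
    s ≤ dimH (Set.range f) := by
  borelize H X
  let μ : Measure H := Measure.haar
  have hμ : μ Set.univ ≠ 0 := by
    simpa using (Measure.measure_univ_pos.mpr (NeZero.ne μ)).ne'
  have hμ' : μ Set.univ ≠ ⊤ := measure_ne_top _ _
  let ν : Measure H := (μ Set.univ)⁻¹ • μ
  have hν : ν Set.univ = 1 := by
    simp [ν]
  have hcont : Continuous f := by
    rw [continuous_iff_continuousAt]
    intro h
    rw [ContinuousAt, EMetric.tendsto_nhds]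
    exact hf h
  have hmass : ∀ k, ν (K k) = ((K k).index : ℝ≥0∞)⁻¹ := by
    intro k
    have : (K k).FiniteIndex := by
      have := Subgroup.quotient_finite_of_isOpen _ (hK k)
      exact Subgroup.finiteIndex_of_finite_quotient
    have h := (K k).index_mul_measure (hK k).measurableSet ν
    rw [hν] at h
    exact ENNReal.eq_inv_of_mul_eq_one_left (by rwa [mul_comm] at h)
  have hball : ∀ x : X, ∀ δ, 0 < δ → δ ≤ ε →
      ν.map f (Metric.closedEBall x δ) ≤ δ ^ (s : ℝ) := by
    intro x δ h0 h1
    obtain ⟨k, hk, hk'⟩ := hs x δ h0 h1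
    rw [Measure.map_apply hcont.measurable Metric.isClosed_closedEBall.measurableSet]
    by_cases he : (f ⁻¹' Metric.closedEBall x δ).Nonempty
    · obtain ⟨z, hz⟩ := he
      calc ν (f ⁻¹' Metric.closedEBall x δ) ≤ ν ((fun h => z⁻¹ * h) ⁻¹' (K k : Set H)) := by
            refine measure_mono fun h hh => hk' z h ?_ ?_
            · rw [edist_comm]; exact hz
            · rw [edist_comm]; exact hh
        _ = ν (K k) := measure_preimage_mul ν _ _
        _ ≤ _ := by rw [hmass]; exact hk
    · rw [Set.not_nonempty_iff_eq_empty.mp he]; simp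
  refine le_dimH_of_hausdorffMeasure_ne_zero fun h0 => ?_
  have hle : ν.map f ≤ μH[(s : ℝ)] := by
    refine Measure.le_hausdorffMeasure _ _ ε hε fun A hA => ?_
    rcases A.eq_empty_or_nonempty with rfl | ⟨x, hx⟩
    · simp
    have hsub : ∀ δ, Metric.ediam A ≤ δ → A ⊆ Metric.closedEBall x δ := fun δ hδ y hy =>
      (Metric.edist_le_ediam_of_mem hy hx).trans hδ
    rcases eq_or_ne (Metric.ediam A) 0 with h | h
    · have hlim : Tendsto (fun δ : ℝ≥0∞ => δ ^ (s : ℝ)) (𝓝[>] 0) (𝓝 (0 ^ (s : ℝ))) :=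
        (ENNReal.continuous_rpow_const.tendsto 0).mono_left nhdsWithin_le_nhds
      rw [h]
      refine ge_of_tendsto hlim ?_
      filter_upwards [Ioc_mem_nhdsGT hε] with δ hδ
      exact (measure_mono (hsub δ (h ▸ zero_le))).trans (hball x δ hδ.1 hδ.2)
    · exact (measure_mono (hsub _ le_rfl)).trans (hball x _ (pos_iff_ne_zero.mpr h) hA)
  have h1 : ν.map f (Set.range f) = 1 := by
    have : ν.map f (Set.range f) = ν Set.univ := by
      rw [Measure.map_apply hcont.measurable
        (isCompact_range hcont).isClosed.measurableSet, Set.preimage_range]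
    rw [this, hν]
  have := hle (Set.range f)
  rw [h1, h0] at this
  simp at this

end HausdorffDimension

/-! ### Hausdorff dimension and index growth -/

theorem tendsto_natCast_add_div (b : ℕ) :
    Tendsto (fun j : ℕ => ((j + b : ℕ) : ℝ) / j) atTop (𝓝 1) := by
  have h : Tendsto (fun j : ℕ => (1 : ℝ) + (b : ℝ) / j) atTop (𝓝 (1 + 0)) :=
    tendsto_const_nhds.add (tendsto_const_div_atTop_nhds_zero_nat _)
  rw [add_zero] at h
  refine h.congr' ?_
  filter_upwards [eventually_gt_atTop 0] with j hj
  have : (j : ℝ) ≠ 0 := by positivity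
  push_cast
  field_simp

theorem tendsto_shift_div {a : ℕ → ℝ} {l : ℝ} (h : Tendsto (fun k : ℕ => a k / k) atTop (𝓝 l))
    (c : ℕ) : Tendsto (fun j : ℕ => a (j + c) / j) atTop (𝓝 l) := by
  have h1 := ((tendsto_add_atTop_iff_nat c).mpr h).mul (tendsto_natCast_add_div c)
  rw [mul_one] at h1
  refine h1.congr' ?_
  filter_upwards [eventually_gt_atTop 0] with j hj
  have : (j : ℝ) ≠ 0 := by positivity
  have : ((j + c : ℕ) : ℝ) ≠ 0 := by positivity
  field_simp

section

variable {p : ℕ} [Fact p.Prime] {ι : Type*} [Fintype ι] [DecidableEq ι]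
  {G : Subgroup (GL ι (ZMod p)⟦X⟧)}

theorem isClosed_of_forall_congruenceSubgroup {H : Subgroup G}
    (hH : ∀ x, (∀ k, ∃ h ∈ H, h⁻¹ * x ∈ congruenceSubgroup G k) → x ∈ H) :
    IsClosed (H : Set G) := by
  rw [← isOpen_compl_iff, isOpen_iff_mem_nhds]
  intro x hx
  obtain ⟨k, hk⟩ : ∃ k, ∀ h ∈ H, h⁻¹ * x ∉ congruenceSubgroup G k := by
    by_contra! h
    exact hx (hH x h)
  have hopen : IsOpen ((fun y : G => y⁻¹ * x) ⁻¹' (congruenceSubgroup G k : Set G)) :=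
    (isOpen_congruenceSubgroup k).preimage (continuous_inv.mul continuous_const)
  have hx' : x ∈ (fun y : G => y⁻¹ * x) ⁻¹' (congruenceSubgroup G k : Set G) := by
    rw [Set.mem_preimage, inv_mul_cancel]
    exact one_mem _
  refine mem_of_superset (hopen.mem_nhds hx') fun y hy hyH => hk y hyH hy

theorem OpenStandardSubgroup.hdim_le [CompactSpace G] (T : OpenStandardSubgroup G)
    {H : Subgroup G} (𝓕 : FiltrationSeries G)
    (h𝓕 : ∀ n, 𝓕.toFun n = T.levelGroup n) (a : ℕ → ℕ)
    (ha : ∀ k, (congruenceSubgroup G k).relIndex H = p ^ a k) (η : NNReal)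
    (hη : Tendsto (fun k : ℕ => (a k : ℝ) / k) atTop (𝓝 (η * T.d))) :
    𝓕.hdim (H : Set G) ≤ η := by
  have hp1 : 1 < p := (Fact.out : p.Prime).one_lt
  have hp0 : (p : ℝ≥0∞) ≠ 0 := by exact_mod_cast (by omega : p ≠ 0)
  have hpt : (p : ℝ≥0∞) ≠ ⊤ := ENNReal.natCast_ne_top p
  have hp1' : (1 : ℝ≥0∞) ≤ p := by exact_mod_cast hp1.le
  obtain ⟨c, hc⟩ := T.exists_congruenceSubgroup_le_levelGroup
  have hidx : ∀ n, (𝓕.toFun n).index = T.S.index * p ^ (T.d * n) := fun n => by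
    rw [h𝓕, T.index_levelGroup]
  have hS0 : T.S.index ≠ 0 := fun h => 𝓕.index_ne_zero 0 (by rw [hidx, h, zero_mul])
  have hd : 0 < T.d := by
    by_contra h
    obtain ⟨n, hn⟩ := 𝓕.exists_lt_index T.S.index
    rw [hidx, Nat.eq_zero_of_not_pos h] at hn
    simp at hn
  have hanti : Antitone fun n => (((𝓕.toFun n).index : ℝ≥0∞))⁻¹ := fun m n h =>
    ENNReal.inv_le_inv.mpr (by exact_mod_cast 𝓕.index_mono h)
  have hrange : Set.range (Subtype.val : H → G) = H := Subtype.range_coe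
  have hcast : ∀ n : ℕ, (p : ℝ≥0∞) ^ n = (p : ℝ≥0∞) ^ (n : ℝ) := fun n =>
    (ENNReal.rpow_natCast _ _).symm
  refine le_of_forall_gt_imp_ge_of_dense fun s' hs' => ?_
  rcases eq_or_ne s' ⊤ with rfl | hst
  · exact le_top
  lift s' to NNReal using hst
  have hs : η < s' := by exact_mod_cast hs'
  rw [FiltrationSeries.hdim, ← hrange]
  refine @dimH_range_le_of_index H G _ 𝓕.metric Subtype.val
    (fun j => (congruenceSubgroup G (j + c)).subgroupOf H) (fun j => ?_)
    (fun j => (((𝓕.toFun j).index : ℝ≥0∞))⁻¹) ?_ (fun j h h' hh => ?_) s' ?_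
  · change (congruenceSubgroup G (j + c)).relIndex H ≠ 0
    rw [ha]
    exact pow_ne_zero _ (by omega)
  · refine ENNReal.tendsto_nhds_zero.mpr fun ε hε => ?_
    obtain ⟨n, hn⟩ := 𝓕.exists_index_inv_lt hε.ne'
    filter_upwards [eventually_ge_atTop n] with j hj
    exact (hanti hj).trans hn.le
  · change 𝓕.dist h h' ≤ _
    refine inf_le_right.trans (iInf₂_le j ?_)
    rw [h𝓕]
    refine hc j ?_
    rw [Subgroup.mem_subgroupOf] at hh
    rw [mul_inv_mem_congruenceSubgroup]
    exact inv_mul_mem_congruenceSubgroup.mp hh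
  · have hlim := tendsto_shift_div hη c
    have hlt : (η : ℝ) * T.d < s' * T.d := by
      have : (η : ℝ) < s' := by exact_mod_cast hs
      have : (0 : ℝ) < T.d := by exact_mod_cast hd
      gcongr
    filter_upwards [hlim.eventually_lt_const hlt, eventually_gt_atTop 0] with j hj hj0
    have hj' : (a (j + c) : ℝ) ≤ s' * (T.d * j : ℕ) := by
      rw [div_lt_iff₀ (by exact_mod_cast hj0)] at hj
      push_cast
      linarith
    change ((congruenceSubgroup G (j + c)).relIndex H : ℝ≥0∞) * _ ≤ 1
    rw [ha, hidx]
    have h1 : ((T.S.index * p ^ (T.d * j) : ℕ) : ℝ≥0∞)⁻¹ ≤ (p : ℝ≥0∞) ^ (-(T.d * j : ℕ) : ℝ) := by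
      rw [ENNReal.rpow_neg, ← hcast]
      refine ENNReal.inv_le_inv.mpr ?_
      exact_mod_cast Nat.le_mul_of_pos_left _ (Nat.pos_of_ne_zero hS0)
    calc ((p ^ a (j + c) : ℕ) : ℝ≥0∞) * ((T.S.index * p ^ (T.d * j) : ℕ) : ℝ≥0∞)⁻¹ ^ (s' : ℝ)
        ≤ (p : ℝ≥0∞) ^ (a (j + c) : ℝ) * ((p : ℝ≥0∞) ^ (-(T.d * j : ℕ) : ℝ)) ^ (s' : ℝ) := by
          rw [Nat.cast_pow, hcast]
          exact mul_le_mul_right (ENNReal.rpow_le_rpow h1 s'.2) _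
      _ = (p : ℝ≥0∞) ^ ((a (j + c) : ℝ) + -(T.d * j : ℕ) * s') := by
          rw [← ENNReal.rpow_mul, ← ENNReal.rpow_add _ _ hp0 hpt]
      _ ≤ (p : ℝ≥0∞) ^ (0 : ℝ) := ENNReal.rpow_le_rpow_of_exponent_le hp1' (by linarith)
      _ = 1 := ENNReal.rpow_zero

theorem OpenStandardSubgroup.le_hdim [CompactSpace G] (T : OpenStandardSubgroup G)
    {H : Subgroup G} (hH : IsClosed (H : Set G)) (𝓕 : FiltrationSeries G)
    (h𝓕 : ∀ n, 𝓕.toFun n = T.levelGroup n) (a : ℕ → ℕ)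
    (ha : ∀ k, (congruenceSubgroup G k).relIndex H = p ^ a k) (η : NNReal)
    (hη : Tendsto (fun k : ℕ => (a k : ℝ) / k) atTop (𝓝 (η * T.d))) :
    η ≤ 𝓕.hdim (H : Set G) := by
  have hp1 : 1 < p := (Fact.out : p.Prime).one_lt
  have hp1' : (1 : ℝ≥0∞) ≤ p := by exact_mod_cast hp1.le
  obtain ⟨c', hc'⟩ := T.exists_levelGroup_le_congruenceSubgroup
  have hidx : ∀ n, (𝓕.toFun n).index = T.S.index * p ^ (T.d * n) := fun n => by
    rw [h𝓕, T.index_levelGroup]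
  have hS0 : T.S.index ≠ 0 := fun h => 𝓕.index_ne_zero 0 (by rw [hidx, h, zero_mul])
  have hd : 0 < T.d := by
    by_contra h
    obtain ⟨n, hn⟩ := 𝓕.exists_lt_index T.S.index
    rw [hidx, Nat.eq_zero_of_not_pos h] at hn
    simp at hn
  have hanti : Antitone fun n => (((𝓕.toFun n).index : ℝ≥0∞))⁻¹ := fun m n h =>
    ENNReal.inv_le_inv.mpr (by exact_mod_cast 𝓕.index_mono h)
  have hrange : Set.range (Subtype.val : H → G) = H := Subtype.range_coe
  have hcast : ∀ n : ℕ, (p : ℝ≥0∞) ^ n = (p : ℝ≥0∞) ^ (n : ℝ) := fun n =>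
    (ENNReal.rpow_natCast _ _).symm
  refine le_of_forall_lt_imp_le_of_dense fun s' hs' => ?_
  lift s' to NNReal using (lt_top_of_lt hs').ne
  have hs : s' < η := by exact_mod_cast hs'
  rcases eq_or_lt_of_le (zero_le (a := s')) with rfl | hs0
  · simp
  rw [FiltrationSeries.hdim, ← hrange]
  have : CompactSpace H := isCompact_iff_compactSpace.mp hH.isCompact
  -- `m = j + c'` levels of `𝓕` see at least `j` congruence levels
  obtain ⟨j₀, hj₀⟩ : ∃ j₀, ∀ j ≥ j₀,
      ((p ^ a j : ℕ) : ℝ≥0∞)⁻¹ ≤ (((𝓕.toFun (j + c')).index : ℝ≥0∞))⁻¹ ^ (s' : ℝ) := by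
    obtain ⟨e, he⟩ : ∃ e, T.S.index ≤ p ^ e := ⟨T.S.index, (Nat.lt_pow_self hp1).le⟩
    have h1 : Tendsto (fun j : ℕ => (s' : ℝ) * T.d * (((j + c' : ℕ) : ℝ) / j) +
        s' * ((e : ℝ) / j)) atTop (𝓝 (s' * T.d * 1 + s' * 0)) :=
      ((tendsto_natCast_add_div c').const_mul _).add
        ((tendsto_const_div_atTop_nhds_zero_nat _).const_mul _)
    have hlt : (s' : ℝ) * T.d * 1 + s' * 0 < η * T.d := by
      have : (s' : ℝ) < η := by exact_mod_cast hs
      have : (0 : ℝ) < T.d := by exact_mod_cast hd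
      rw [mul_one, mul_zero, add_zero]
      gcongr
    have h2 := (h1.eventually_lt hη hlt).and (eventually_gt_atTop 0)
    obtain ⟨j₀, hj₀⟩ := eventually_atTop.mp h2
    refine ⟨j₀, fun j hj => ?_⟩
    obtain ⟨h3, h4⟩ := hj₀ j hj
    have h5 : (0 : ℝ) < j := by exact_mod_cast h4
    have h6 : ((e + T.d * (j + c') : ℕ) : ℝ) * s' ≤ a j := by
      rw [lt_div_iff₀ h5] at h3
      have : (↑s' * ↑T.d * (((j + c' : ℕ) : ℝ) / ↑j) + ↑s' * (↑e / ↑j)) * (j : ℝ) =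
          ((e + T.d * (j + c') : ℕ) : ℝ) * s' := by
        push_cast
        field_simp
        ring
      linarith
    rw [ENNReal.inv_rpow, hidx]
    refine ENNReal.inv_le_inv.mpr ?_
    calc ((T.S.index * p ^ (T.d * (j + c')) : ℕ) : ℝ≥0∞) ^ (s' : ℝ)
        ≤ ((p ^ (e + T.d * (j + c')) : ℕ) : ℝ≥0∞) ^ (s' : ℝ) := by
          refine ENNReal.rpow_le_rpow ?_ s'.2
          rw [pow_add]
          exact_mod_cast Nat.mul_le_mul_right _ he
      _ = (p : ℝ≥0∞) ^ (((e + T.d * (j + c') : ℕ) : ℝ) * s') := by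
          rw [Nat.cast_pow, hcast, ← ENNReal.rpow_mul]
      _ ≤ (p : ℝ≥0∞) ^ (a j : ℝ) := ENNReal.rpow_le_rpow_of_exponent_le hp1' h6
      _ = _ := by rw [Nat.cast_pow, hcast]
  refine @le_dimH_range_of_index H G _ _ _ _ _ 𝓕.metric Subtype.val (fun h ε hε => ?_)
    (fun k => (congruenceSubgroup G k).subgroupOf H) (fun k => ?_) s'
    (((𝓕.toFun (j₀ + c' + 1)).index : ℝ≥0∞))⁻¹ (by simp) (fun x δ hδ0 hδ => ?_)
  · obtain ⟨n, hn⟩ := 𝓕.exists_index_inv_lt hε.ne'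
    have hopen : IsOpen ((fun y : H => (y : G) * (h : G)⁻¹) ⁻¹' (𝓕.toFun n : Set G)) :=
      (𝓕.isOpen' n).preimage (continuous_subtype_val.mul continuous_const)
    have hh : h ∈ (fun y : H => (y : G) * (h : G)⁻¹) ⁻¹' (𝓕.toFun n : Set G) := by
      rw [Set.mem_preimage, mul_inv_cancel]
      exact one_mem _
    filter_upwards [hopen.mem_nhds hh] with y hy
    exact lt_of_le_of_lt (inf_le_right.trans (iInf₂_le n hy)) hn
  · exact (isOpen_congruenceSubgroup k).preimage continuous_subtype_val
  -- points at distance at most `δ` lie in the same coset of `S_m`, where `m` is minimal with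
  -- `|G : S_m|⁻¹ ≤ δ`
  · have hex : ∃ m, (((𝓕.toFun m).index : ℝ≥0∞))⁻¹ ≤ δ := by
      obtain ⟨n, hn⟩ := 𝓕.exists_index_inv_lt hδ0.ne'
      exact ⟨n, hn.le⟩
    classical
    obtain ⟨m, hm, hmin⟩ : ∃ m, (((𝓕.toFun m).index : ℝ≥0∞))⁻¹ ≤ δ ∧
        ∀ m' < m, δ < (((𝓕.toFun m').index : ℝ≥0∞))⁻¹ :=
      ⟨Nat.find hex, Nat.find_spec hex, fun m' h => not_le.mp (Nat.find_min hex h)⟩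
    have hm0 : j₀ + c' + 1 ≤ m := by
      by_contra h
      have h1 := hm.trans hδ
      rw [ENNReal.inv_le_inv, hidx, hidx] at h1
      have h2 : T.S.index * p ^ (T.d * (j₀ + c' + 1)) ≤ T.S.index * p ^ (T.d * m) := by
        exact_mod_cast h1
      have h3 := Nat.le_of_mul_le_mul_left h2 (Nat.pos_of_ne_zero hS0)
      have h4 := Nat.le_of_mul_le_mul_left ((Nat.pow_le_pow_iff_right hp1).mp h3) hd
      omega
    have hmem : ∀ y : G, 𝓕.dist x y ≤ δ → x * y⁻¹ ∈ congruenceSubgroup G (m - c') := by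
      intro y hy
      have hlt := hy.trans_lt (hmin (m - 1) (by omega))
      have hle1 : (((𝓕.toFun (m - 1)).index : ℝ≥0∞))⁻¹ ≤ 1 := by
        rw [ENNReal.inv_le_one]
        exact_mod_cast Nat.one_le_iff_ne_zero.mpr (𝓕.index_ne_zero _)
      obtain ⟨n, hn, hn'⟩ := 𝓕.exists_of_dist_lt hlt hle1
      have hmn : m ≤ n := by
        by_contra h
        exact absurd (hanti (show n ≤ m - 1 by omega)) (not_le.mpr hn')
      have h1 := 𝓕.antitone' hmn hn
      rw [h𝓕] at h1
      refine hc' (m - c') ?_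
      rwa [Nat.sub_add_cancel (by omega)]
    refine ⟨m - c', ?_, fun h h' hh hh' => ?_⟩
    · change ((congruenceSubgroup G (m - c')).relIndex H : ℝ≥0∞)⁻¹ ≤ _
      rw [ha]
      refine (hj₀ (m - c') (by omega)).trans (ENNReal.rpow_le_rpow ?_ s'.2)
      rwa [Nat.sub_add_cancel (by omega)]
    · rw [Subgroup.mem_subgroupOf]
      have h1 := mul_mem (inv_mem (hmem h hh)) (hmem h' hh')
      have h2 : (h : G) * (h' : G)⁻¹ ∈ congruenceSubgroup G (m - c') := by
        simpa [mul_assoc] using h1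
      rw [mul_inv_mem_congruenceSubgroup] at h2
      exact inv_mul_mem_congruenceSubgroup.mpr h2

/-- The dimension is determined by the growth of the indices of the congruence subgroups,
because the filtrations by the `S_n` and by congruence subgroups are cofinal up to a bounded
shift. -/
theorem OpenStandardSubgroup.hdim_eq [CompactSpace G] (T : OpenStandardSubgroup G)
    {H : Subgroup G} (hH : IsClosed (H : Set G)) (𝓕 : FiltrationSeries G)
    (h𝓕 : ∀ n, 𝓕.toFun n = T.levelGroup n) (a : ℕ → ℕ)
    (ha : ∀ k, (congruenceSubgroup G k).relIndex H = p ^ a k) (η : NNReal)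
    (hη : Tendsto (fun k : ℕ => (a k : ℝ) / k) atTop (𝓝 (η * T.d))) :
    𝓕.hdim (H : Set G) = η :=
  le_antisymm (T.hdim_le 𝓕 h𝓕 a ha η hη) (T.le_hdim hH 𝓕 h𝓕 a ha η hη)

end

/-! ### Independence of the open standard subgroup -/

section

variable {p : ℕ} [Fact p.Prime] {ι : Type*} [Fintype ι] [DecidableEq ι]
  {G : Subgroup (GL ι (ZMod p)⟦X⟧)}

theorem OpenStandardSubgroup.index_ne_zero [CompactSpace G] (T : OpenStandardSubgroup G) (n : ℕ) :
    (T.levelGroup n).index ≠ 0 := by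
  have := Subgroup.quotient_finite_of_isOpen _ (T.isOpen_levelGroup n)
  exact Subgroup.index_ne_zero_of_finite

/-- Both families `S_k` are cofinal with the congruence subgroups up to a bounded shift, so
`p ^ (d k)` is at most a constant times `p ^ (d' k)`. -/
theorem OpenStandardSubgroup.d_le [CompactSpace G] (T T' : OpenStandardSubgroup G) :
    T.d ≤ T'.d := by
  have hp1 : 1 < p := (Fact.out : p.Prime).one_lt
  obtain ⟨c, hc⟩ := T.exists_congruenceSubgroup_le_levelGroup
  obtain ⟨c', hc'⟩ := T'.exists_levelGroup_le_congruenceSubgroup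
  by_contra! hlt
  have key : ∀ m, p ^ m ≤ T'.S.index * p ^ (T'.d * (c + c')) := by
    intro m
    have h1 : T'.levelGroup (m + c + c') ≤ T.levelGroup m := (hc' (m + c)).trans (hc m)
    have h2 := Nat.le_of_dvd (Nat.pos_of_ne_zero (T'.index_ne_zero _))
      (Subgroup.index_dvd_of_le h1)
    have h3 : 0 < T.S.index := Nat.pos_of_ne_zero fun h =>
      T.index_ne_zero 0 (by rw [T.index_levelGroup, h, zero_mul])
    rw [T.index_levelGroup, T'.index_levelGroup] at h2
    have h4 : p ^ (T.d * m) ≤ T'.S.index * p ^ (T'.d * (c + c')) * p ^ (T'.d * m) := by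
      rw [mul_assoc, ← pow_add, show T'.d * (c + c') + T'.d * m = T'.d * (m + c + c') by ring]
      exact (Nat.le_mul_of_pos_left _ h3).trans h2
    have h5 : p ^ m * p ^ (T'.d * m) ≤ p ^ (T.d * m) := by
      rw [← pow_add]
      refine Nat.pow_le_pow_right (by omega) ?_
      calc m + T'.d * m = (T'.d + 1) * m := by ring
        _ ≤ T.d * m := Nat.mul_le_mul_right _ hlt
    exact Nat.le_of_mul_le_mul_right (h5.trans h4) (pow_pos (by omega) _)
  exact absurd (key (T'.S.index * p ^ (T'.d * (c + c')))) (not_le.mpr (Nat.lt_pow_self hp1))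

theorem OpenStandardSubgroup.d_eq [CompactSpace G] (T T' : OpenStandardSubgroup G) :
    T.d = T'.d :=
  le_antisymm (T.d_le T') (T'.d_le T)

theorem OpenStandardSubgroup.infinite [CompactSpace G] (T : OpenStandardSubgroup G)
    (hd : 0 < T.d) : Infinite G := by
  have hp1 : 1 < p := (Fact.out : p.Prime).one_lt
  by_contra h
  rw [not_infinite_iff_finite] at h
  have h1 := (T.levelGroup (Nat.card G)).index_dvd_card
  have h2 := Nat.le_of_dvd Nat.card_pos h1
  have h3 : 0 < T.S.index := Nat.pos_of_ne_zero fun h =>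
    T.index_ne_zero 0 (by rw [T.index_levelGroup, h, zero_mul])
  rw [T.index_levelGroup] at h2
  have h4 : Nat.card G < p ^ (T.d * Nat.card G) :=
    (Nat.lt_pow_self hp1).trans_le
      (Nat.pow_le_pow_right (by omega) (Nat.le_mul_of_pos_left _ hd))
  have h5 := Nat.le_mul_of_pos_left (p ^ (T.d * Nat.card G)) h3
  omega

/-- The filtration series `(S_n)` of `G`. -/
noncomputable def OpenStandardSubgroup.filtrationSeries [CompactSpace G]
    (T : OpenStandardSubgroup G) (hd : 0 < T.d) : FiltrationSeries G where
  toFun := T.levelGroup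
  infinite := T.infinite hd
  antitone' := T.levelGroup_antitone
  isOpen' := T.isOpen_levelGroup
  index_ne_zero := T.index_ne_zero
  iInf_eq_bot := T.iInf_levelGroup

/-- A subgroup that is closed in the `t`-adic sense and has `p ^ (a k)` elements modulo `t ^ k`,
where `a k ∼ η d k`, has standard Hausdorff dimension `η`. -/
theorem hasStandardHausdorffDim_of_relIndex [CompactSpace G] (T : OpenStandardSubgroup G)
    (hd : 0 < T.d) {H : Subgroup G}
    (hH : ∀ x, (∀ k, ∃ h ∈ H, h⁻¹ * x ∈ congruenceSubgroup G k) → x ∈ H) (a : ℕ → ℕ)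
    (ha : ∀ k, (congruenceSubgroup G k).relIndex H = p ^ a k) (η : NNReal)
    (hη : Tendsto (fun k : ℕ => (a k : ℝ) / k) atTop (𝓝 (η * T.d))) :
    HasStandardHausdorffDim G H η := by
  refine ⟨⟨T⟩, fun T' => ?_⟩
  rw [T.d_eq T'] at hd hη
  exact ⟨T'.filtrationSeries hd, T'.coe_levelGroup,
    T'.hdim_eq (isClosed_of_forall_congruenceSubgroup hH) _ (fun _ => rfl) a ha η hη⟩

end

/-! ### Formal charts of linear groups -/

/-- All entries of `g - 1` lie in the maximal ideal. -/
def Matrix.IsNearOne {ι S : Type*} [DecidableEq ι] [CommRing S] [IsLocalRing S]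
    (g : Matrix ι ι S) : Prop :=
  ∀ i j, (g - 1) i j ∈ IsLocalRing.maximalIdeal S

namespace Matrix.IsNearOne

variable {ι S : Type*} [DecidableEq ι] [CommRing S] [IsLocalRing S] {g g' : Matrix ι ι S}

theorem mul [Fintype ι] (h : g.IsNearOne) (h' : g'.IsNearOne) : (g * g').IsNearOne := by
  intro i j
  have : g * g' - 1 = (g - 1) * g' + (g' - 1) := by rw [Matrix.sub_mul, Matrix.one_mul]; abel
  rw [this, Matrix.add_apply, Matrix.mul_apply]
  exact Ideal.add_mem _ (Ideal.sum_mem _ fun k _ => Ideal.mul_mem_right _ _ (h i k)) (h' i j)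

end Matrix.IsNearOne

theorem Matrix.isUnit_det_of_sub_mem_maximalIdeal {ι S : Type*} [Fintype ι] [DecidableEq ι]
    [CommRing S] [IsLocalRing S] {g g' : Matrix ι ι S} (hg' : IsUnit g'.det)
    (h : ∀ i j, (g - g') i j ∈ IsLocalRing.maximalIdeal S) : IsUnit g.det := by
  have h1 : IsLocalRing.residue S g.det = IsLocalRing.residue S g'.det := by
    rw [RingHom.map_det, RingHom.map_det]
    congr 1
    ext i j
    exact Ideal.Quotient.eq.mpr (h i j)
  refine isUnit_of_map_unit (IsLocalRing.residue S) _ ?_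
  rw [h1]
  exact hg'.map _

theorem Matrix.IsNearOne.isUnit_det {ι S : Type*} [Fintype ι] [DecidableEq ι]
    [CommRing S] [IsLocalRing S] {g : Matrix ι ι S} (h : g.IsNearOne) : IsUnit g.det :=
  Matrix.isUnit_det_of_sub_mem_maximalIdeal (g' := 1) (by simp) h

section

variable {p : ℕ} [Fact p.Prime]

theorem mem_maximalIdeal_iff_X_dvd {x : (ZMod p)⟦X⟧} :
    x ∈ IsLocalRing.maximalIdeal (ZMod p)⟦X⟧ ↔ PowerSeries.X ∣ x := by
  rw [IsLocalRing.mem_maximalIdeal, mem_nonunits_iff, PowerSeries.isUnit_iff_constantCoeff,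
    PowerSeries.X_dvd_iff, isUnit_iff_ne_zero, not_not]

theorem MvPowerSeries.mem_maximalIdeal_iff {σ S : Type*} [CommRing S] [IsLocalRing S]
    {F : MvPowerSeries σ S} : F ∈ IsLocalRing.maximalIdeal (MvPowerSeries σ S) ↔
      MvPowerSeries.constantCoeff F ∈ IsLocalRing.maximalIdeal S := by
  rw [IsLocalRing.mem_maximalIdeal, IsLocalRing.mem_maximalIdeal, mem_nonunits_iff,
    mem_nonunits_iff, MvPowerSeries.isUnit_iff_constantCoeff]

theorem MvPowerSeries.X_mem_maximalIdeal {σ S : Type*} [CommRing S] [IsLocalRing S] (s : σ) :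
    (MvPowerSeries.X s : MvPowerSeries σ S) ∈ IsLocalRing.maximalIdeal (MvPowerSeries σ S) := by
  rw [MvPowerSeries.mem_maximalIdeal_iff, MvPowerSeries.constantCoeff_X]
  exact zero_mem _

/-- A chart of the group scheme of a linear group near the identity, as a functor of local
`𝔽_p[[t]]`-algebras: `toMat` and `coord` are inverse to each other and natural in the algebra.
`mem S` plays the role of the group of points over `S`; it has to be the group `G` itself only for
`S = 𝔽_p[[t]]`, and only near the identity. -/
structure FormalChart {ι : Type} [Fintype ι] [DecidableEq ι]
    (G : Subgroup (GL ι (ZMod p)⟦X⟧)) (d : ℕ) where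
  mem : ∀ (S : Type) [CommRing S] [Algebra (ZMod p)⟦X⟧ S], Set (Matrix ι ι S)
  toMat : ∀ (S : Type) [CommRing S] [Algebra (ZMod p)⟦X⟧ S], (Fin d → S) → Matrix ι ι S
  coord : ∀ (S : Type) [CommRing S] [Algebra (ZMod p)⟦X⟧ S], Matrix ι ι S → Fin d → S
  mul_mem : ∀ {S : Type} [CommRing S] [Algebra (ZMod p)⟦X⟧ S] {g g' : Matrix ι ι S},
    g ∈ mem S → g' ∈ mem S → g * g' ∈ mem S
  toMat_mem : ∀ {S : Type} [CommRing S] [Algebra (ZMod p)⟦X⟧ S] [IsLocalRing S] {w : Fin d → S},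
    (∀ i, w i ∈ IsLocalRing.maximalIdeal S) → toMat S w ∈ mem S
  isNearOne_toMat : ∀ {S : Type} [CommRing S] [Algebra (ZMod p)⟦X⟧ S] [IsLocalRing S]
    {w : Fin d → S}, (∀ i, w i ∈ IsLocalRing.maximalIdeal S) → (toMat S w).IsNearOne
  toMat_zero : ∀ (S : Type) [CommRing S] [Algebra (ZMod p)⟦X⟧ S] [IsLocalRing S], toMat S 0 = 1
  coord_mem : ∀ {S : Type} [CommRing S] [Algebra (ZMod p)⟦X⟧ S] [IsLocalRing S]
    {g : Matrix ι ι S}, g.IsNearOne → ∀ i, coord S g i ∈ IsLocalRing.maximalIdeal S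
  coord_toMat : ∀ {S : Type} [CommRing S] [Algebra (ZMod p)⟦X⟧ S] [IsLocalRing S]
    {w : Fin d → S}, (∀ i, w i ∈ IsLocalRing.maximalIdeal S) → coord S (toMat S w) = w
  toMat_coord : ∀ {S : Type} [CommRing S] [Algebra (ZMod p)⟦X⟧ S] [IsLocalRing S]
    {g : Matrix ι ι S}, g.IsNearOne → g ∈ mem S → toMat S (coord S g) = g
  map_toMat : ∀ {S S' : Type} [CommRing S] [Algebra (ZMod p)⟦X⟧ S] [IsLocalRing S] [CommRing S']
    [Algebra (ZMod p)⟦X⟧ S'] (f : S →ₐ[(ZMod p)⟦X⟧] S') {w : Fin d → S},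
    (∀ i, w i ∈ IsLocalRing.maximalIdeal S) → (toMat S w).map f = toMat S' (fun i => f (w i))
  map_coord : ∀ {S S' : Type} [CommRing S] [Algebra (ZMod p)⟦X⟧ S] [IsLocalRing S] [CommRing S']
    [Algebra (ZMod p)⟦X⟧ S'] (f : S →ₐ[(ZMod p)⟦X⟧] S') {g : Matrix ι ι S}, g.IsNearOne →
    ∀ i, f (coord S g i) = coord S' (g.map f) i
  mem_iff : ∀ {g : GL ι (ZMod p)⟦X⟧}, g.val.IsNearOne → (g.val ∈ mem (ZMod p)⟦X⟧ ↔ g ∈ G)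

namespace FormalChart

variable {ι : Type} [Fintype ι] [DecidableEq ι] {G : Subgroup (GL ι (ZMod p)⟦X⟧)} {d : ℕ}
  (𝒞 : FormalChart G d)

/-- The generic point of the chart, whose coordinates are the variables `X_{a i}` of a power series
ring. -/
noncomputable def genericPoint {σ : Type} (a : Fin d → σ) :
    Matrix ι ι (MvPowerSeries σ (ZMod p)⟦X⟧) :=
  𝒞.toMat (MvPowerSeries σ (ZMod p)⟦X⟧) fun i => MvPowerSeries.X (a i)

/-- The multiplication in the coordinates of the chart: the coordinates of the product of two
generic points with independent coordinates. -/
noncomputable def law (i : Fin d) : MvPowerSeries (Fin d ⊕ Fin d) (ZMod p)⟦X⟧ :=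
  𝒞.coord _ (𝒞.genericPoint Sum.inl * 𝒞.genericPoint Sum.inr) i

theorem isNearOne_genericPoint {σ : Type} (a : Fin d → σ) : (𝒞.genericPoint a).IsNearOne :=
  𝒞.isNearOne_toMat fun _ => MvPowerSeries.X_mem_maximalIdeal _

theorem map_genericPoint {σ S : Type} [CommRing S] [Algebra (ZMod p)⟦X⟧ S] (a : Fin d → σ)
    (f : MvPowerSeries σ (ZMod p)⟦X⟧ →ₐ[(ZMod p)⟦X⟧] S) :
    (𝒞.genericPoint a).map f = 𝒞.toMat S fun i => f (MvPowerSeries.X (a i)) :=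
  𝒞.map_toMat f fun _ => MvPowerSeries.X_mem_maximalIdeal _

theorem map_law {S : Type} [CommRing S] [Algebra (ZMod p)⟦X⟧ S]
    (f : MvPowerSeries (Fin d ⊕ Fin d) (ZMod p)⟦X⟧ →ₐ[(ZMod p)⟦X⟧] S) (i : Fin d) :
    f (𝒞.law i) = 𝒞.coord S (𝒞.toMat S (fun i => f (MvPowerSeries.X (Sum.inl i))) *
      𝒞.toMat S fun i => f (MvPowerSeries.X (Sum.inr i))) i := by
  rw [law, 𝒞.map_coord f ((𝒞.isNearOne_genericPoint _).mul (𝒞.isNearOne_genericPoint _)),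
    Matrix.map_mul, map_genericPoint, map_genericPoint]

theorem coord_one (S : Type) [CommRing S] [Algebra (ZMod p)⟦X⟧ S] [IsLocalRing S] :
    𝒞.coord S 1 = 0 := by
  rw [← 𝒞.toMat_zero, 𝒞.coord_toMat (w := 0) fun _ => zero_mem _]

theorem constantCoeff_law (i : Fin d) : MvPowerSeries.constantCoeff (𝒞.law i) = 0 := by
  let f : MvPowerSeries (Fin d ⊕ Fin d) (ZMod p)⟦X⟧ →ₐ[(ZMod p)⟦X⟧] (ZMod p)⟦X⟧ :=
    { MvPowerSeries.constantCoeff with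
      commutes' := fun r => by simp [MvPowerSeries.algebraMap_apply] }
  have h := 𝒞.map_law f i
  have h0 : ∀ s, f (MvPowerSeries.X s) = 0 := fun s => MvPowerSeries.constantCoeff_X s
  simp only [h0] at h
  change f (𝒞.law i) = 0
  rw [h]
  change 𝒞.coord _ (𝒞.toMat _ 0 * 𝒞.toMat _ 0) i = 0
  rw [𝒞.toMat_zero, one_mul, 𝒞.coord_one]
  rfl

theorem subst_law {τ : Type} {a b : Fin d → MvPowerSeries τ (ZMod p)⟦X⟧}
    (ha : ∀ i, MvPowerSeries.constantCoeff (a i) = 0)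
    (hb : ∀ i, MvPowerSeries.constantCoeff (b i) = 0) (i : Fin d) :
    (𝒞.law i).subst (Sum.elim a b) = 𝒞.coord _ (𝒞.toMat _ a * 𝒞.toMat _ b) i := by
  have h : MvPowerSeries.HasSubst (Sum.elim a b) :=
    MvPowerSeries.hasSubst_of_constantCoeff_zero (by rintro (i | i) <;> simp [ha, hb])
  have h1 := 𝒞.map_law (MvPowerSeries.substAlgHom h) i
  simp only [MvPowerSeries.substAlgHom_X, Sum.elim_inl, Sum.elim_inr] at h1
  rw [← h1, MvPowerSeries.substAlgHom_apply]

theorem toMat_law_subst {τ : Type} {a b : Fin d → MvPowerSeries τ (ZMod p)⟦X⟧}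
    (ha : ∀ i, MvPowerSeries.constantCoeff (a i) = 0)
    (hb : ∀ i, MvPowerSeries.constantCoeff (b i) = 0) :
    𝒞.toMat _ (fun i => (𝒞.law i).subst (Sum.elim a b)) = 𝒞.toMat _ a * 𝒞.toMat _ b := by
  have hmem : ∀ {c : Fin d → MvPowerSeries τ (ZMod p)⟦X⟧},
      (∀ i, MvPowerSeries.constantCoeff (c i) = 0) →
      ∀ i, c i ∈ IsLocalRing.maximalIdeal (MvPowerSeries τ (ZMod p)⟦X⟧) := fun hc i => by
    rw [MvPowerSeries.mem_maximalIdeal_iff, hc]; exact zero_mem _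
  rw [← 𝒞.toMat_coord ((𝒞.isNearOne_toMat (hmem ha)).mul (𝒞.isNearOne_toMat (hmem hb)))
    (𝒞.mul_mem (𝒞.toMat_mem (hmem ha)) (𝒞.toMat_mem (hmem hb)))]
  congr 1
  funext i
  exact 𝒞.subst_law ha hb i

theorem constantCoeff_law_subst {τ : Type} {a b : Fin d → MvPowerSeries τ (ZMod p)⟦X⟧}
    (ha : ∀ i, MvPowerSeries.constantCoeff (a i) = 0)
    (hb : ∀ i, MvPowerSeries.constantCoeff (b i) = 0) (i : Fin d) :
    MvPowerSeries.constantCoeff ((𝒞.law i).subst (Sum.elim a b)) = 0 := by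
  have h : ∀ s, MvPowerSeries.constantCoeff (Sum.elim a b s) = 0 := by
    rintro (i | i) <;> simp [ha, hb]
  exact MvPowerSeries.constantCoeff_subst_eq_zero
    (MvPowerSeries.hasSubst_of_constantCoeff_zero h) h (𝒞.constantCoeff_law i)

theorem law_assoc {τ : Type} {a b c : Fin d → MvPowerSeries τ (ZMod p)⟦X⟧}
    (ha : ∀ i, MvPowerSeries.constantCoeff (a i) = 0)
    (hb : ∀ i, MvPowerSeries.constantCoeff (b i) = 0)
    (hc : ∀ i, MvPowerSeries.constantCoeff (c i) = 0) (i : Fin d) :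
    (𝒞.law i).subst (Sum.elim (fun j => (𝒞.law j).subst (Sum.elim a b)) c) =
      (𝒞.law i).subst (Sum.elim a fun j => (𝒞.law j).subst (Sum.elim b c)) := by
  rw [𝒞.subst_law (𝒞.constantCoeff_law_subst ha hb) hc, 𝒞.toMat_law_subst ha hb,
    𝒞.subst_law ha (𝒞.constantCoeff_law_subst hb hc), 𝒞.toMat_law_subst hb hc, mul_assoc]

theorem law_subst_zero_right {τ : Type} {a : Fin d → MvPowerSeries τ (ZMod p)⟦X⟧}
    (ha : ∀ i, MvPowerSeries.constantCoeff (a i) = 0) (i : Fin d) :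
    (𝒞.law i).subst (Sum.elim a 0) = a i := by
  have hmem : ∀ i, a i ∈ IsLocalRing.maximalIdeal (MvPowerSeries τ (ZMod p)⟦X⟧) := fun i => by
    rw [MvPowerSeries.mem_maximalIdeal_iff, ha]; exact zero_mem _
  rw [𝒞.subst_law ha (b := 0) fun i => map_zero _, 𝒞.toMat_zero, mul_one, 𝒞.coord_toMat hmem]

theorem law_subst_zero_left {τ : Type} {a : Fin d → MvPowerSeries τ (ZMod p)⟦X⟧}
    (ha : ∀ i, MvPowerSeries.constantCoeff (a i) = 0) (i : Fin d) :
    (𝒞.law i).subst (Sum.elim 0 a) = a i := by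
  have hmem : ∀ i, a i ∈ IsLocalRing.maximalIdeal (MvPowerSeries τ (ZMod p)⟦X⟧) := fun i => by
    rw [MvPowerSeries.mem_maximalIdeal_iff, ha]; exact zero_mem _
  rw [𝒞.subst_law (a := 0) (fun i => map_zero _) ha, 𝒞.toMat_zero, one_mul, 𝒞.coord_toMat hmem]

/-- The formal group law of a chart. -/
noncomputable def formalGroupLaw : FormalGroupLaw (ZMod p)⟦X⟧ d where
  F := 𝒞.law
  right_zero := 𝒞.law_subst_zero_right MvPowerSeries.constantCoeff_X
  left_zero := 𝒞.law_subst_zero_left MvPowerSeries.constantCoeff_X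
  assoc := 𝒞.law_assoc (a := fun k => MvPowerSeries.X (Sum.inl k))
    (b := fun k => MvPowerSeries.X (Sum.inr (Sum.inl k)))
    (c := fun k => MvPowerSeries.X (Sum.inr (Sum.inr k)))
    (fun _ => MvPowerSeries.constantCoeff_X _) (fun _ => MvPowerSeries.constantCoeff_X _)
    (fun _ => MvPowerSeries.constantCoeff_X _)

theorem isNearOne_of_mem {g : G} (hg : g ∈ congruenceSubgroup G 1) :
    (g : GL ι (ZMod p)⟦X⟧).val.IsNearOne := fun i j => by
  rw [mem_maximalIdeal_iff_X_dvd]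
  simpa using mem_congruenceSubgroup.mp hg i j

/-- The chart as a bijection of `{g ∈ G : g ≡ 1 mod t}` with the polydisc `𝔪 ^ d`. -/
noncomputable def equivPolydisc : congruenceSubgroup G 1 ≃ polydisc p 1 d where
  toFun g := ⟨𝒞.coord _ ((g : G) : GL ι (ZMod p)⟦X⟧).val, fun i => by
    rw [pow_one, ← mem_maximalIdeal_iff_X_dvd]
    exact 𝒞.coord_mem (isNearOne_of_mem g.2) i⟩
  invFun w :=
    have hw : ∀ i, w.1 i ∈ IsLocalRing.maximalIdeal (ZMod p)⟦X⟧ := fun i => by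
      rw [mem_maximalIdeal_iff_X_dvd]; simpa using w.2 i
    have h1 := 𝒞.isNearOne_toMat hw
    have h2 : (Matrix.nonsingInvUnit _ h1.isUnit_det).val.IsNearOne := h1
    ⟨⟨Matrix.nonsingInvUnit _ h1.isUnit_det, (𝒞.mem_iff h2).mp (𝒞.toMat_mem hw)⟩, by
      rw [mem_congruenceSubgroup]
      intro i j
      rw [pow_one, ← mem_maximalIdeal_iff_X_dvd]
      exact h1 i j⟩
  left_inv g := Subtype.ext (Subtype.ext (Units.ext
    (𝒞.toMat_coord (isNearOne_of_mem g.2) ((𝒞.mem_iff (isNearOne_of_mem g.2)).mpr g.1.2))))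
  right_inv w := Subtype.ext (𝒞.coord_toMat fun i => by
      rw [mem_maximalIdeal_iff_X_dvd]; simpa using w.2 i)

/-- The coordinates modulo `t ^ k` are those of the matrix modulo `t ^ k`, by naturality for the
residue map. -/
theorem X_pow_dvd_coord_sub {g g' : congruenceSubgroup G 1} {k : ℕ}
    (h : (g : G) * (g' : G)⁻¹ ∈ congruenceSubgroup G k) (i : Fin d) :
    PowerSeries.X ^ k ∣ (𝒞.equivPolydisc g).1 i - (𝒞.equivPolydisc g').1 i := by
  rw [← Ideal.mem_span_singleton, ← Ideal.Quotient.eq]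
  let f := Ideal.Quotient.mkₐ (ZMod p)⟦X⟧ (Ideal.span {(PowerSeries.X ^ k : (ZMod p)⟦X⟧)})
  change f _ = f _
  refine (𝒞.map_coord f (isNearOne_of_mem g.2) i).trans
    (Eq.trans ?_ (𝒞.map_coord f (isNearOne_of_mem g'.2) i).symm)
  congr 1
  ext i j
  refine Ideal.Quotient.eq.mpr ?_
  rw [Ideal.mem_span_singleton]
  exact mul_inv_mem_congruenceSubgroup.mp h i j

theorem continuous_equivPolydisc : Continuous 𝒞.equivPolydisc := by
  refine continuous_induced_rng.mpr (continuous_pi fun i => continuous_iff_continuousAt.mpr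
    fun g s hs => ?_)
  obtain ⟨k, hk⟩ := mem_nhds_iff_exists_X_pow_dvd.mp hs
  have hcont : Continuous fun g' : congruenceSubgroup G 1 => (g' : G) * (g : G)⁻¹ :=
    continuous_subtype_val.mul continuous_const
  have hnhds := ((isOpen_congruenceSubgroup k).preimage hcont).mem_nhds (x := g) (by
    rw [Set.mem_preimage, mul_inv_cancel]
    exact one_mem _)
  rw [mem_map]
  filter_upwards [hnhds] with g' hg'
  exact hk _ (𝒞.X_pow_dvd_coord_sub hg' i)

/-- A continuous bijection from a compact space is a homeomorphism, so the chart makes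
`{g ∈ G : g ≡ 1 mod t}` an open standard subgroup. -/
noncomputable def openStandardSubgroup [CompactSpace G] : OpenStandardSubgroup G where
  S := congruenceSubgroup G 1
  isOpen' := isOpen_congruenceSubgroup 1
  N := 1
  one_le_N := le_rfl
  d := d
  φ := have h : IsClosed (congruenceSubgroup G 1 : Set G) :=
      Subgroup.isClosed_of_isOpen _ (isOpen_congruenceSubgroup 1)
    have : CompactSpace (congruenceSubgroup G 1) := isCompact_iff_compactSpace.mp h.isCompact
    Continuous.homeoOfEquivCompactToT2 (f := 𝒞.equivPolydisc) 𝒞.continuous_equivPolydisc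
  analytic_φ i a := by
    let g : Matrix ι ι (MvPowerSeries (ι × ι) (ZMod p)⟦X⟧) := Matrix.of fun j k =>
      algebraMap _ _ (((a : G) : GL ι (ZMod p)⟦X⟧).val j k) + MvPowerSeries.X (j, k)
    have hg : g.IsNearOne := by
      intro j k
      rw [MvPowerSeries.mem_maximalIdeal_iff]
      have := isNearOne_of_mem a.2 j k
      simpa [g, MvPowerSeries.algebraMap_apply, Matrix.one_apply, apply_ite] using this
    -- the expansion at `a` is the coordinate of the generic matrix near `a`
    refine ⟨0, 𝒞.coord _ g i, fun b x hx hb => ?_⟩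
    obtain ⟨f, hf, hfX⟩ := exists_algHom_hasValueAt hx
    have h1 : g.map f = ((b : G) : GL ι (ZMod p)⟦X⟧).val := by
      ext1 j k
      have := hb (j, k)
      simp only [pow_zero, one_mul] at this
      rw [this]
      change f (algebraMap _ _ _ + MvPowerSeries.X (j, k)) = _
      rw [map_add, AlgHom.commutes, hfX]
      rfl
    have h2 := hf (𝒞.coord _ g i)
    rw [𝒞.map_coord f hg, h1] at h2
    exact h2
  analytic_φ_symm j k a := by
    let w : Fin d → MvPowerSeries (Fin d) (ZMod p)⟦X⟧ := fun i =>
      algebraMap _ _ (a.1 i) + MvPowerSeries.X i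
    have hw : ∀ i, w i ∈ IsLocalRing.maximalIdeal (MvPowerSeries (Fin d) (ZMod p)⟦X⟧) := by
      intro i
      rw [MvPowerSeries.mem_maximalIdeal_iff, mem_maximalIdeal_iff_X_dvd]
      simpa [w, MvPowerSeries.algebraMap_apply] using a.2 i
    refine ⟨0, 𝒞.toMat _ w j k, fun b x hx hb => ?_⟩
    obtain ⟨f, hf, hfX⟩ := exists_algHom_hasValueAt hx
    have h1 : (fun i => f (w i)) = b.1 := by
      funext i
      have := hb i
      simp only [pow_zero, one_mul] at this
      rw [this, map_add, AlgHom.commutes, hfX]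
      rfl
    have h2 := hf (𝒞.toMat _ w j k)
    have h3 : f (𝒞.toMat _ w j k) = 𝒞.toMat _ b.1 j k := by
      rw [← h1, ← 𝒞.map_toMat f hw, Matrix.map_apply]
    rw [h3] at h2
    exact h2
  φ_one i := by
    change 𝒞.coord _ (1 : Matrix ι ι (ZMod p)⟦X⟧) i = 0
    rw [𝒞.coord_one]; rfl
  law := 𝒞.formalGroupLaw
  φ_mul x y i := by
    have hz : ∀ s, PowerSeries.X ∣ Sum.elim (𝒞.equivPolydisc x).1 (𝒞.equivPolydisc y).1 s := by
      rintro (s | s)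
      · simpa using (𝒞.equivPolydisc x).2 s
      · simpa using (𝒞.equivPolydisc y).2 s
    obtain ⟨f, hf, hfX⟩ := exists_algHom_hasValueAt hz
    have h := hf (𝒞.law i)
    rw [𝒞.map_law f] at h
    simp only [hfX, Sum.elim_inl, Sum.elim_inr] at h
    have hx : ∀ x : congruenceSubgroup G 1, 𝒞.toMat _ (𝒞.equivPolydisc x).1 =
        ((x : G) : GL ι (ZMod p)⟦X⟧).val := fun x =>
      𝒞.toMat_coord (isNearOne_of_mem x.2) ((𝒞.mem_iff (isNearOne_of_mem x.2)).mpr x.1.2)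
    rw [hx x, hx y] at h
    exact h

end FormalChart

end

/-! ### Cayley charts of isometry groups -/

namespace Matrix

variable {ι S S' : Type*} [Fintype ι] [DecidableEq ι] [CommRing S] [CommRing S']

theorem map_inv_of_isUnit_det (f : S →+* S') {A : Matrix ι ι S} (h : IsUnit A.det) :
    A⁻¹.map f = (A.map f)⁻¹ := by
  symm
  apply Matrix.inv_eq_right_inv
  rw [← Matrix.map_mul, Matrix.mul_nonsing_inv A h]
  exact Matrix.map_one f (map_zero f) (map_one f)

/-- The isometry `M⁻¹ (M - J) = 1 - M⁻¹ J` attached to a bilinear form `M` with `M ± Mᵀ = J`: it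
even preserves `M`, because it is `∓ M⁻¹ Mᵀ`. -/
theorem isometry_of_add_transpose {J M : Matrix ι ι S} {ε : ℤ} (hε : ε * ε = 1)
    (hM : M + ε • Mᵀ = J) (hdet : IsUnit M.det) :
    (M⁻¹ * (M - J))ᵀ * J * (M⁻¹ * (M - J)) = J := by
  have h1 : M - J = -(ε • Mᵀ) := by rw [← hM]; abel
  have h2 : M * M⁻¹ = 1 := Matrix.mul_nonsing_inv M hdet
  have h3 : M⁻¹ᵀ * Mᵀ = 1 := by rw [← Matrix.transpose_mul, h2, Matrix.transpose_one]
  have h4 : M⁻¹ᵀ * J * M⁻¹ = M⁻¹ᵀ + ε • M⁻¹ := by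
    rw [← hM, Matrix.mul_add, Matrix.add_mul, Matrix.mul_assoc, h2, Matrix.mul_one,
      Matrix.mul_smul, h3, Matrix.smul_mul, Matrix.one_mul]
  calc (M⁻¹ * (M - J))ᵀ * J * (M⁻¹ * (M - J))
      = (ε * ε) • (M * (M⁻¹ᵀ * J * M⁻¹) * Mᵀ) := by
        rw [h1]
        simp only [Matrix.transpose_mul, Matrix.transpose_neg, Matrix.transpose_smul,
          Matrix.transpose_transpose, Matrix.mul_neg, Matrix.neg_mul, smul_neg, neg_neg, Matrix.mul_smul,
          Matrix.smul_mul, smul_smul, Matrix.mul_assoc]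
    _ = J := by
        rw [h4, hε, one_smul, Matrix.mul_add, Matrix.add_mul, Matrix.mul_assoc, h3,
          Matrix.mul_smul, h2, Matrix.smul_mul, Matrix.mul_one, Matrix.one_mul, hM]

/-- Conversely, an isometry `g` of `J` without the eigenvalue `1` has the form `1 - M⁻¹ J` for
`M = J (1 - g)⁻¹`, with `M ± Mᵀ = J`. -/
theorem add_transpose_of_isometry {J g : Matrix ι ι S} {ε : ℤ} (hε : ε * ε = 1)
    (hJ : Jᵀ = ε • J) (hg : gᵀ * J * g = J) (hdet : IsUnit (1 - g).det) :
    J * (1 - g)⁻¹ + ε • (J * (1 - g)⁻¹)ᵀ = J := by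
  set D := (1 - g)⁻¹
  have h1 : (1 - g) * D = 1 := Matrix.mul_nonsing_inv _ hdet
  have h2 : Dᵀ * (1 - g)ᵀ = 1 := by rw [← Matrix.transpose_mul, h1, Matrix.transpose_one]
  have h3 : (1 - g)ᵀ * J + J * (1 - g) = (1 - g)ᵀ * J * (1 - g) := by
    simp only [Matrix.transpose_sub, Matrix.transpose_one, Matrix.sub_mul, Matrix.mul_sub,
      Matrix.one_mul, Matrix.mul_one, hg]
    abel
  have h4 : ε • (J * D)ᵀ = Dᵀ * J := by
    rw [Matrix.transpose_mul, hJ, Matrix.mul_smul, smul_smul, hε, one_smul]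
  have h5 : Dᵀ * ((1 - g)ᵀ * J + J * (1 - g)) * D = Dᵀ * J + J * D := by
    rw [Matrix.mul_add, Matrix.add_mul, ← Matrix.mul_assoc, h2, Matrix.one_mul, Matrix.mul_assoc,
      Matrix.mul_assoc, h1, Matrix.mul_one, add_comm]
  have h6 : Dᵀ * ((1 - g)ᵀ * J * (1 - g)) * D = J := by
    rw [Matrix.mul_assoc, Matrix.mul_assoc, Matrix.mul_assoc, h1, Matrix.mul_one,
      ← Matrix.mul_assoc, h2, Matrix.one_mul]
  rw [h4, add_comm, ← h5, h3, h6]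

end Matrix

/-- The residue field of a local algebra, as an algebra. -/
noncomputable abbrev residueAlgHom (A S : Type*) [CommRing A] [CommRing S] [Algebra A S]
    [IsLocalRing S] : S →ₐ[A] S ⧸ IsLocalRing.maximalIdeal S :=
  Ideal.Quotient.mkₐ A (IsLocalRing.maximalIdeal S)

theorem Matrix.isNearOne_iff_map (A : Type*) {ι S : Type*} [DecidableEq ι] [CommRing A] [CommRing S]
    [Algebra A S] [IsLocalRing S] {g : Matrix ι ι S} :
    g.IsNearOne ↔ g.map (residueAlgHom A S) = 1 := by
  rw [← Matrix.map_one (residueAlgHom A S) (map_zero _) (map_one _), ← Matrix.ext_iff]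
  exact forall₂_congr fun i j => Ideal.Quotient.eq.symm

/-- The data of a Cayley type chart of the isometry group of `J`, where `Jᵀ = ε J` with `ε = ±1`: a
bilinear form `M₀` with `M₀ + ε M₀ᵀ = J`, and a set `C` of positions, numbered by `e`, at which the
entries of a matrix `W` with `W + ε Wᵀ = 0` can be prescribed and determine `W`. -/
structure CayleyDatum (p : ℕ) (ι : Type) [Fintype ι] [DecidableEq ι] (d : ℕ) where
  ε : ℤ
  J : Matrix ι ι (ZMod p)⟦X⟧
  M₀ : Matrix ι ι (ZMod p)⟦X⟧
  C : Set (ι × ι)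
  e : Fin d ≃ C
  ε_mul_ε : ε * ε = 1
  transpose_J : Jᵀ = ε • J
  M₀_add : M₀ + ε • M₀ᵀ = J
  isUnit_det_J : IsUnit J.det
  isUnit_det_M₀ : IsUnit M₀.det
  eq_of_mem : ∀ {j k}, (j, k) ∈ C → (k, j) ∈ C → j = k ∧ ε = -1
  mem_or : ∀ j k, (j, k) ∈ C ∨ (k, j) ∈ C ∨ (j = k ∧ ε = 1 ∧ IsUnit (2 : (ZMod p)⟦X⟧))

namespace CayleyDatum

variable {p : ℕ} {ι : Type} [Fintype ι] [DecidableEq ι] {d : ℕ}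
  (D : CayleyDatum p ι d)

section functor

variable (S : Type) [CommRing S]

open scoped Classical in
/-- The matrix `W` with `W + ε Wᵀ = 0` and prescribed entries at the positions in `C`. -/
noncomputable def tangent (w : Fin d → S) : Matrix ι ι S := Matrix.of fun j k =>
  if h : (j, k) ∈ D.C then w (D.e.symm ⟨(j, k), h⟩)
  else if h : (k, j) ∈ D.C then -(D.ε • w (D.e.symm ⟨(k, j), h⟩)) else 0

theorem tangent_add (w : Fin d → S) : D.tangent S w + D.ε • (D.tangent S w)ᵀ = 0 := by
  have hε := D.ε_mul_ε
  ext j k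
  simp only [tangent, Matrix.add_apply, Matrix.smul_apply, Matrix.transpose_apply, Matrix.of_apply,
    Matrix.zero_apply]
  by_cases h1 : (j, k) ∈ D.C <;> by_cases h2 : (k, j) ∈ D.C
  · obtain ⟨rfl, h⟩ := D.eq_of_mem h1 h2
    simp [h1, h]
  · simp only [h1, h2, dif_pos, dif_neg, not_false_iff, smul_neg, smul_smul, hε, one_smul,
      add_neg_cancel]
  · simp [h1, h2]
  · simp [h1, h2]

theorem tangent_zero : D.tangent S 0 = 0 := by
  ext j k
  simp [tangent]

theorem tangent_apply_e (w : Fin d → S) (i : Fin d) :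
    D.tangent S w (D.e i).1.1 (D.e i).1.2 = w i := by
  simp [tangent]

variable [Algebra (ZMod p)⟦X⟧ S]

/-- The form `J` over an algebra. -/
noncomputable def JOver : Matrix ι ι S := D.J.map (algebraMap _ S)

/-- The base point `M₀` over an algebra. -/
noncomputable def M₀Over : Matrix ι ι S := D.M₀.map (algebraMap _ S)

/-- The isometry `g₀ = 1 - M₀⁻¹ J`. -/
noncomputable def basePoint : Matrix ι ι S := (D.M₀Over S)⁻¹ * (D.M₀Over S - D.JOver S)

/-- The chart `w ↦ (1 - (M₀ + W)⁻¹ J) g₀⁻¹`. -/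
noncomputable def toMat (w : Fin d → S) : Matrix ι ι S :=
  (D.M₀Over S + D.tangent S w)⁻¹ * (D.M₀Over S + D.tangent S w - D.JOver S) * (D.basePoint S)⁻¹

/-- The coordinates `W = J (1 - g g₀)⁻¹ - M₀` of an isometry `g`. -/
noncomputable def coord (g : Matrix ι ι S) (i : Fin d) : S :=
  (D.JOver S * (1 - g * D.basePoint S)⁻¹ - D.M₀Over S) (D.e i).1.1 (D.e i).1.2

theorem isUnit_det_JOver : IsUnit (D.JOver S).det := by
  have := D.isUnit_det_J.map (algebraMap _ S)
  rwa [RingHom.map_det] at this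

theorem isUnit_det_M₀Over : IsUnit (D.M₀Over S).det := by
  have := D.isUnit_det_M₀.map (algebraMap _ S)
  rwa [RingHom.map_det] at this

theorem transpose_JOver : (D.JOver S)ᵀ = D.ε • D.JOver S := by
  rw [JOver, ← Matrix.transpose_map, D.transpose_J]
  ext i j
  simp only [Matrix.map_apply, Matrix.smul_apply, map_zsmul]

theorem M₀Over_add : D.M₀Over S + D.ε • (D.M₀Over S)ᵀ = D.JOver S := by
  rw [JOver, ← D.M₀_add]
  ext i j
  simp only [M₀Over, Matrix.map_apply, Matrix.add_apply, Matrix.smul_apply,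
    Matrix.transpose_apply, map_add, map_zsmul]

theorem tangent_eq {W : Matrix ι ι S} (hW : W + D.ε • Wᵀ = 0) :
    D.tangent S (fun i => W (D.e i).1.1 (D.e i).1.2) = W := by
  ext j k
  have h := congrFun₂ hW j k
  simp only [Matrix.add_apply, Matrix.smul_apply, Matrix.transpose_apply, Matrix.zero_apply] at h
  simp only [tangent, Matrix.of_apply, Equiv.apply_symm_apply]
  split_ifs with h1 h2
  · rfl
  · exact (eq_neg_of_add_eq_zero_left h).symm
  · rcases D.mem_or j k with h3 | h3 | ⟨rfl, h3, h4⟩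
    · exact absurd h3 h1
    · exact absurd h3 h2
    · rw [h3, one_smul, ← two_mul] at h
      have h5 := h4.map (algebraMap _ S)
      rw [map_ofNat] at h5
      exact (h5.mul_right_eq_zero.mp h).symm

theorem isUnit_det_basePoint : IsUnit (D.basePoint S).det := by
  have h1 : D.M₀Over S - D.JOver S = (-(D.ε : S)) • (D.M₀Over S)ᵀ := by
    rw [← D.M₀Over_add, neg_smul, Int.cast_smul_eq_zsmul]; abel
  have h2 : IsUnit (-(D.ε : S)) := by
    have : (-(D.ε : S)) * (-(D.ε : S)) = 1 := by
      rw [neg_mul_neg, ← Int.cast_mul, D.ε_mul_ε, Int.cast_one]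
    exact IsUnit.of_mul_eq_one _ this
  rw [basePoint, Matrix.det_mul, h1, Matrix.det_smul, Matrix.det_transpose]
  exact ((Matrix.isUnit_nonsing_inv_det_iff).mpr (D.isUnit_det_M₀Over S)).mul
    ((h2.pow _).mul (D.isUnit_det_M₀Over S))

theorem one_sub_basePoint : 1 - D.basePoint S = (D.M₀Over S)⁻¹ * D.JOver S := by
  rw [basePoint, Matrix.mul_sub, Matrix.nonsing_inv_mul _ (D.isUnit_det_M₀Over S)]
  abel

theorem isUnit_det_one_sub_basePoint : IsUnit (1 - D.basePoint S).det := by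
  rw [one_sub_basePoint, Matrix.det_mul]
  exact ((Matrix.isUnit_nonsing_inv_det_iff).mpr (D.isUnit_det_M₀Over S)).mul
    (D.isUnit_det_JOver S)

theorem toMat_zero : D.toMat S 0 = 1 := by
  rw [toMat, tangent_zero, add_zero]
  exact Matrix.mul_nonsing_inv _ (D.isUnit_det_basePoint S)

theorem basePoint_isometry : (D.basePoint S)ᵀ * D.JOver S * D.basePoint S = D.JOver S :=
  Matrix.isometry_of_add_transpose D.ε_mul_ε (D.M₀Over_add S) (D.isUnit_det_M₀Over S)

theorem M₀Over_add_tangent (w : Fin d → S) :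
    D.M₀Over S + D.tangent S w + D.ε • (D.M₀Over S + D.tangent S w)ᵀ = D.JOver S := by
  rw [Matrix.transpose_add, smul_add, add_add_add_comm, D.M₀Over_add, D.tangent_add, add_zero]

variable {S}

theorem toMat_isometry {w : Fin d → S} (h : IsUnit (D.M₀Over S + D.tangent S w).det) :
    (D.toMat S w)ᵀ * D.JOver S * D.toMat S w = D.JOver S := by
  have h1 := Matrix.isometry_of_add_transpose D.ε_mul_ε (D.M₀Over_add_tangent S w) h
  have h2 := D.basePoint_isometry S
  have h3 := Matrix.mul_nonsing_inv _ (D.isUnit_det_basePoint S)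
  have h4 : (D.basePoint S)⁻¹ᵀ * (D.basePoint S)ᵀ = 1 := by
    rw [← Matrix.transpose_mul, h3, Matrix.transpose_one]
  rw [toMat]
  set g := (D.M₀Over S + D.tangent S w)⁻¹ * (D.M₀Over S + D.tangent S w - D.JOver S)
  set b := D.basePoint S
  calc (g * b⁻¹)ᵀ * D.JOver S * (g * b⁻¹) = b⁻¹ᵀ * (gᵀ * D.JOver S * g) * b⁻¹ := by
        simp only [Matrix.transpose_mul, Matrix.mul_assoc]
    _ = b⁻¹ᵀ * (bᵀ * D.JOver S * b) * b⁻¹ := by rw [h1, h2]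
    _ = (b⁻¹ᵀ * bᵀ) * D.JOver S * (b * b⁻¹) := by simp only [Matrix.mul_assoc]
    _ = D.JOver S := by rw [h3, h4, Matrix.one_mul, Matrix.mul_one]

theorem coord_toMat {w : Fin d → S} (h : IsUnit (D.M₀Over S + D.tangent S w).det) :
    D.coord S (D.toMat S w) = w := by
  funext i
  have h1 : 1 - D.toMat S w * D.basePoint S = (D.M₀Over S + D.tangent S w)⁻¹ * D.JOver S := by
    rw [toMat, Matrix.mul_assoc, Matrix.nonsing_inv_mul _ (D.isUnit_det_basePoint S),
      Matrix.mul_one, Matrix.mul_sub, Matrix.nonsing_inv_mul _ h]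
    abel
  rw [coord, h1, Matrix.mul_inv_rev, ← Matrix.mul_assoc,
    Matrix.mul_nonsing_inv _ (D.isUnit_det_JOver S), Matrix.one_mul,
    Matrix.nonsing_inv_nonsing_inv _ h, add_sub_cancel_left, D.tangent_apply_e]

theorem toMat_coord {g : Matrix ι ι S} (hg : gᵀ * D.JOver S * g = D.JOver S)
    (h : IsUnit (1 - g * D.basePoint S).det) : D.toMat S (D.coord S g) = g := by
  have h1 : (g * D.basePoint S)ᵀ * D.JOver S * (g * D.basePoint S) = D.JOver S := by
    calc (g * D.basePoint S)ᵀ * D.JOver S * (g * D.basePoint S)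
        = (D.basePoint S)ᵀ * (gᵀ * D.JOver S * g) * D.basePoint S := by
          simp only [Matrix.transpose_mul, Matrix.mul_assoc]
      _ = D.JOver S := by rw [hg, D.basePoint_isometry]
  have h2 := Matrix.add_transpose_of_isometry D.ε_mul_ε (D.transpose_JOver S) h1 h
  have h3 : D.tangent S (D.coord S g) =
      D.JOver S * (1 - g * D.basePoint S)⁻¹ - D.M₀Over S := by
    refine D.tangent_eq S ?_
    rw [Matrix.transpose_sub, smul_sub, sub_add_sub_comm, h2, D.M₀Over_add, sub_self]
  rw [toMat, h3, add_sub_cancel, Matrix.mul_inv_rev, Matrix.nonsing_inv_nonsing_inv _ h,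
    Matrix.mul_sub]
  have h4 : (1 - g * D.basePoint S) * (D.JOver S)⁻¹ * (D.JOver S * (1 - g * D.basePoint S)⁻¹) =
      1 := by
    rw [Matrix.mul_assoc, ← Matrix.mul_assoc (D.JOver S)⁻¹,
      Matrix.nonsing_inv_mul _ (D.isUnit_det_JOver S), Matrix.one_mul, Matrix.mul_nonsing_inv _ h]
  rw [h4, Matrix.mul_assoc (1 - _), Matrix.nonsing_inv_mul _ (D.isUnit_det_JOver S), Matrix.mul_one,
    sub_sub_cancel, Matrix.mul_assoc, Matrix.mul_nonsing_inv _ (D.isUnit_det_basePoint S),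
    Matrix.mul_one]

variable {S' : Type} [CommRing S'] [Algebra (ZMod p)⟦X⟧ S'] (f : S →ₐ[(ZMod p)⟦X⟧] S')

theorem map_JOver : (D.JOver S).map f = D.JOver S' := by
  ext i j
  simp [JOver]

theorem map_M₀Over : (D.M₀Over S).map f = D.M₀Over S' := by
  ext i j
  simp [M₀Over]

theorem map_tangent (w : Fin d → S) :
    (D.tangent S w).map f = D.tangent S' fun i => f (w i) := by
  ext j k
  simp only [tangent, Matrix.map_apply, Matrix.of_apply]
  split_ifs <;> simp

theorem map_inv {A : Matrix ι ι S} (h : IsUnit A.det) : A⁻¹.map f = (A.map f)⁻¹ :=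
  Matrix.map_inv_of_isUnit_det (f : S →+* S') h

theorem map_basePoint : (D.basePoint S).map f = D.basePoint S' := by
  rw [basePoint, Matrix.map_mul, map_inv f (D.isUnit_det_M₀Over S),
    Matrix.map_sub f (map_sub f), D.map_JOver, D.map_M₀Over, basePoint]

theorem map_toMat {w : Fin d → S} (h : IsUnit (D.M₀Over S + D.tangent S w).det) :
    (D.toMat S w).map f = D.toMat S' fun i => f (w i) := by
  rw [toMat, Matrix.map_mul, Matrix.map_mul, map_inv f h, map_inv f (D.isUnit_det_basePoint S),
    Matrix.map_sub f (map_sub f), Matrix.map_add f (map_add f), D.map_JOver, D.map_M₀Over,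
    D.map_tangent, D.map_basePoint, toMat]

theorem map_coord {g : Matrix ι ι S} (h : IsUnit (1 - g * D.basePoint S).det) (i : Fin d) :
    f (D.coord S g i) = D.coord S' (g.map f) i := by
  rw [coord, ← Matrix.map_apply (f := f), Matrix.map_sub f (map_sub f), Matrix.map_mul,
    map_inv f h, Matrix.map_sub f (map_sub f), Matrix.map_mul, D.map_JOver, D.map_M₀Over,
    D.map_basePoint, Matrix.map_one f (map_zero f) (map_one f), coord]

section local_ring

variable [IsLocalRing S]

theorem isUnit_det_add_tangent {w : Fin d → S} (hw : ∀ i, w i ∈ IsLocalRing.maximalIdeal S) :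
    IsUnit (D.M₀Over S + D.tangent S w).det := by
  refine Matrix.isUnit_det_of_sub_mem_maximalIdeal (D.isUnit_det_M₀Over S) fun j k => ?_
  rw [add_sub_cancel_left]
  simp only [tangent, Matrix.of_apply]
  split_ifs
  · exact hw _
  · exact neg_mem (zsmul_mem (hw _) _)
  · exact zero_mem _

theorem isUnit_det_one_sub_mul {g : Matrix ι ι S} (hg : g.IsNearOne) :
    IsUnit (1 - g * D.basePoint S).det := by
  refine Matrix.isUnit_det_of_sub_mem_maximalIdeal (D.isUnit_det_one_sub_basePoint S)
    fun j k => ?_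
  have : 1 - g * D.basePoint S - (1 - D.basePoint S) = -((g - 1) * D.basePoint S) := by
    rw [Matrix.sub_mul, Matrix.one_mul]; abel
  rw [this, Matrix.neg_apply, Matrix.mul_apply]
  exact neg_mem (Ideal.sum_mem _ fun i _ => Ideal.mul_mem_right _ _ (hg j i))

theorem isNearOne_toMat {w : Fin d → S} (hw : ∀ i, w i ∈ IsLocalRing.maximalIdeal S) :
    (D.toMat S w).IsNearOne := by
  rw [Matrix.isNearOne_iff_map (ZMod p)⟦X⟧, D.map_toMat _ (D.isUnit_det_add_tangent hw), ← D.toMat_zero]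
  congr 1
  funext i
  exact Ideal.Quotient.eq_zero_iff_mem.mpr (hw i)

theorem coord_mem {g : Matrix ι ι S} (hg : g.IsNearOne) (i : Fin d) :
    D.coord S g i ∈ IsLocalRing.maximalIdeal S := by
  rw [← Ideal.Quotient.eq_zero_iff_mem]
  change residueAlgHom (ZMod p)⟦X⟧ S _ = 0
  rw [D.map_coord _ (D.isUnit_det_one_sub_mul hg), (Matrix.isNearOne_iff_map (ZMod p)⟦X⟧).mp hg, ← D.toMat_zero,
    D.coord_toMat]
  · rfl
  · rw [tangent_zero, add_zero]
    exact D.isUnit_det_M₀Over _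

end local_ring

end functor

/-- The Cayley type chart of an isometry group. -/
noncomputable def formalChart [Fact p.Prime] : FormalChart (isometryGroup D.J) d where
  mem S _ _ := {g | gᵀ * D.JOver S * g = D.JOver S}
  toMat S _ _ := D.toMat S
  coord S _ _ := D.coord S
  mul_mem {S _ _ g g'} h h' := by
    simp only [Set.mem_ofPred_eq] at h h' ⊢
    calc (g * g')ᵀ * D.JOver S * (g * g') = g'ᵀ * (gᵀ * D.JOver S * g) * g' := by
          simp only [Matrix.transpose_mul, Matrix.mul_assoc]
      _ = D.JOver S := by rw [h, h']
  toMat_mem hw := D.toMat_isometry (D.isUnit_det_add_tangent hw)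
  isNearOne_toMat hw := D.isNearOne_toMat hw
  toMat_zero S _ _ _ := D.toMat_zero S
  coord_mem hg := D.coord_mem hg
  coord_toMat hw := D.coord_toMat (D.isUnit_det_add_tangent hw)
  toMat_coord hg hg' := D.toMat_coord hg' (D.isUnit_det_one_sub_mul hg)
  map_toMat f _ hw := D.map_toMat f (D.isUnit_det_add_tangent hw)
  map_coord f _ hg := D.map_coord f (D.isUnit_det_one_sub_mul hg)
  mem_iff {g} _ := by
    have : D.JOver (ZMod p)⟦X⟧ = D.J := by ext i j; simp [JOver]
    rw [this]
    rfl

end CayleyDatum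

/-! ### Adding a fixed basis vector -/

namespace Matrix

/-- The block matrix with blocks `g` and `1`, where `r` splits off one index. -/
def addFixedIndex {ι ι' : Type*} [Fintype ι] [DecidableEq ι] [Fintype ι'] [DecidableEq ι']
    (r : ι ≃ ι' ⊕ Unit) (S : Type*) [CommRing S] : Matrix ι' ι' S →* Matrix ι ι S where
  toFun g := (Matrix.fromBlocks g 0 0 1).submatrix r r
  map_one' := by rw [Matrix.fromBlocks_one, Matrix.submatrix_one_equiv]
  map_mul' g g' := by
    rw [Matrix.submatrix_mul_equiv, Matrix.fromBlocks_multiply]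
    simp

variable {ι ι' : Type*} [Fintype ι] [DecidableEq ι] [Fintype ι'] [DecidableEq ι']
  (r : ι ≃ ι' ⊕ Unit) {S : Type*} [CommRing S]

theorem addFixedIndex_apply (g : Matrix ι' ι' S) (i j : ι) :
    addFixedIndex r S g i j = Matrix.fromBlocks g 0 0 1 (r i) (r j) := rfl

theorem submatrix_addFixedIndex (g : Matrix ι' ι' S) :
    (addFixedIndex r S g).submatrix (r.symm ∘ Sum.inl) (r.symm ∘ Sum.inl) = g := by
  ext i j
  simp [addFixedIndex_apply]

theorem map_addFixedIndex {S' : Type*} [CommRing S'] (f : S →+* S') (g : Matrix ι' ι' S) :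
    (addFixedIndex r S g).map f = addFixedIndex r S' (g.map f) := by
  ext i j
  rw [Matrix.map_apply, addFixedIndex_apply, addFixedIndex_apply]
  rcases r i with i | i <;> rcases r j with j | j <;> simp

theorem forall_addFixedIndex_sub_one (P : S → Prop) (h0 : P 0) (g : Matrix ι' ι' S) :
    (∀ i j, P (addFixedIndex r S g i j - (1 : Matrix ι ι S) i j)) ↔
      ∀ i j, P (g i j - (1 : Matrix ι' ι' S) i j) := by
  have h1 : ∀ i j, addFixedIndex r S g i j - (1 : Matrix ι ι S) i j =
      Matrix.fromBlocks (g - 1) 0 0 (0 : Matrix Unit Unit S) (r i) (r j) := by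
    intro i j
    have : (1 : Matrix ι ι S) i j = Matrix.fromBlocks 1 0 0 (1 : Matrix Unit Unit S) (r i) (r j) := by
      rw [Matrix.fromBlocks_one, Matrix.one_apply, Matrix.one_apply]
      simp
    rw [this, addFixedIndex_apply]
    rcases r i with i | i <;> rcases r j with j | j <;> simp
  simp only [h1]
  constructor
  · intro h i j
    simpa using h (r.symm (Sum.inl i)) (r.symm (Sum.inl j))
  · intro h i j
    rcases r i with i | i <;> rcases r j with j | j <;> simp [h0]
    exact h i j

end Matrix

section

variable {p : ℕ} {ι ι' : Type} [Fintype ι] [DecidableEq ι] [Fintype ι'] [DecidableEq ι']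
  (r : ι ≃ ι' ⊕ Unit) {G : Subgroup (GL ι' (ZMod p)⟦X⟧)} {d : ℕ}

/-- A chart of `G` is also one of the group of block matrices with blocks `g ∈ G` and `1`. -/
noncomputable def FormalChart.addFixedIndex [Fact p.Prime] (𝒞 : FormalChart G d) :
    FormalChart (G.map (Units.map (Matrix.addFixedIndex r (ZMod p)⟦X⟧))) d where
  mem S _ _ := Matrix.addFixedIndex r S '' 𝒞.mem S
  toMat S _ _ w := Matrix.addFixedIndex r S (𝒞.toMat S w)
  coord S _ _ g := 𝒞.coord S (g.submatrix (r.symm ∘ Sum.inl) (r.symm ∘ Sum.inl))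
  mul_mem := by
    rintro S _ _ _ _ ⟨g, hg, rfl⟩ ⟨g', hg', rfl⟩
    exact ⟨g * g', 𝒞.mul_mem hg hg', map_mul _ _ _⟩
  toMat_mem hw := ⟨_, 𝒞.toMat_mem hw, rfl⟩
  isNearOne_toMat {S _ _ _ w} hw := (Matrix.forall_addFixedIndex_sub_one r
    (· ∈ IsLocalRing.maximalIdeal S) (zero_mem _) _).mpr (𝒞.isNearOne_toMat hw)
  toMat_zero S _ _ _ := by rw [𝒞.toMat_zero, map_one]
  coord_mem {S _ _ _ g} hg := 𝒞.coord_mem fun i j => by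
    simpa [Matrix.one_apply] using hg (r.symm (Sum.inl i)) (r.symm (Sum.inl j))
  coord_toMat hw := by rw [Matrix.submatrix_addFixedIndex, 𝒞.coord_toMat hw]
  toMat_coord := by
    rintro S _ _ _ _ hg ⟨g, hg', rfl⟩
    have := (Matrix.forall_addFixedIndex_sub_one r
      (· ∈ IsLocalRing.maximalIdeal S) (zero_mem _) _).mp hg
    rw [Matrix.submatrix_addFixedIndex, 𝒞.toMat_coord this hg']
  map_toMat {S S' _ _ _ _ _} f w hw := by
    rw [← 𝒞.map_toMat f hw]
    exact Matrix.map_addFixedIndex r (f : S →+* S') _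
  map_coord {S S' _ _ _ _ _} f g hg i := by
    rw [𝒞.map_coord f fun i j => by
      simpa [Matrix.one_apply] using hg (r.symm (Sum.inl i)) (r.symm (Sum.inl j))]
    rfl
  mem_iff {g} hg := by
    constructor
    · rintro ⟨g', hg', h⟩
      rw [← h] at hg
      have h1 : g'.IsNearOne := (Matrix.forall_addFixedIndex_sub_one r
        (· ∈ IsLocalRing.maximalIdeal (ZMod p)⟦X⟧) (zero_mem _) _).mp hg
      have h2 : (Matrix.nonsingInvUnit g' h1.isUnit_det).val.IsNearOne := h1
      exact ⟨Matrix.nonsingInvUnit g' h1.isUnit_det, (𝒞.mem_iff h2).mp hg', Units.ext h⟩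
    · rintro ⟨g', hg', rfl⟩
      have h1 : g'.val.IsNearOne := (Matrix.forall_addFixedIndex_sub_one r
        (· ∈ IsLocalRing.maximalIdeal (ZMod p)⟦X⟧) (zero_mem _) _).mp hg
      exact ⟨g'.val, (𝒞.mem_iff h1).mpr hg', rfl⟩

/-- A subgroup that is closed in the `t`-adic sense and has `p ^ (a k)` elements modulo `t ^ k`. -/
structure HasIndexGrowth {ι : Type} [Fintype ι] [DecidableEq ι] {G : Subgroup (GL ι (ZMod p)⟦X⟧)}
    (H : Subgroup G) (a : ℕ → ℕ) : Prop where
  closed : ∀ x, (∀ k, ∃ h ∈ H, h⁻¹ * x ∈ congruenceSubgroup G k) → x ∈ H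
  relIndex : ∀ k, (congruenceSubgroup G k).relIndex H = p ^ a k

theorem HasIndexGrowth.addFixedIndex {H : Subgroup G} {a : ℕ → ℕ} (h : HasIndexGrowth H a) :
    HasIndexGrowth (H.map ((Units.map (Matrix.addFixedIndex r (ZMod p)⟦X⟧)).subgroupMap G)) a := by
  set Ψ := (Units.map (Matrix.addFixedIndex r (ZMod p)⟦X⟧)).subgroupMap G
  have hΓ : ∀ k, congruenceSubgroup G k = (congruenceSubgroup _ k).comap Ψ := by
    intro k
    ext g
    rw [Subgroup.mem_comap, mem_congruenceSubgroup, mem_congruenceSubgroup]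
    exact (Matrix.forall_addFixedIndex_sub_one r (PowerSeries.X ^ k ∣ ·) (dvd_zero _) _).symm
  refine ⟨fun x hx => ?_, fun k => ?_⟩
  · obtain ⟨x, rfl⟩ := MonoidHom.subgroupMap_surjective _ _ x
    refine ⟨x, h.closed x fun k => ?_, rfl⟩
    obtain ⟨_, ⟨y, hy, rfl⟩, hk⟩ := hx k
    refine ⟨y, hy, ?_⟩
    rw [hΓ, Subgroup.mem_comap, map_mul, map_inv]
    exact hk
  · rw [← Subgroup.relIndex_comap, ← hΓ, h.relIndex]

theorem isClosed_isometryGroup {ι : Type*} [Fintype ι] [DecidableEq ι]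
    (B : Matrix ι ι (ZMod p)⟦X⟧) : IsClosed (isometryGroup B : Set (GL ι (ZMod p)⟦X⟧)) := by
  have hc : Continuous fun g : GL ι (ZMod p)⟦X⟧ => g.valᵀ * B * g.val :=
    (Units.continuous_val.matrix_transpose.matrix_mul continuous_const).matrix_mul
      Units.continuous_val
  exact isClosed_eq hc continuous_const

variable [Fact p.Prime]

theorem mem_standardHausdorffSpectrum (hG : IsClosed (G : Set (GL ι' (ZMod p)⟦X⟧)))
    (𝒞 : FormalChart G d) (hd : 0 < d) {H : Subgroup G} {a : ℕ → ℕ} (hH : HasIndexGrowth H a)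
    {η : ℝ} (hη0 : 0 ≤ η) (hη : Tendsto (fun k : ℕ => (a k : ℝ) / k) atTop (𝓝 (η * d))) :
    η ∈ standardHausdorffSpectrum G := by
  have := compactSpace_of_isClosed hG
  refine ⟨hη0, H, isClosed_of_forall_congruenceSubgroup hH.closed, ?_⟩
  refine hasStandardHausdorffDim_of_relIndex 𝒞.openStandardSubgroup hd hH.closed a hH.relIndex
    η.toNNReal ?_
  rw [Real.coe_toNNReal _ hη0]
  exact hη

end

/-! ### Sets of exponents of given density, and closed subgroups of one-units -/

section Density

/-- The closure of a set of natural numbers under multiplication by `p`. -/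
def powMultiples (p : ℕ) (M : Set ℕ) : Set ℕ := {k | ∃ m ∈ M, ∃ j, k = m * p ^ j}

theorem mem_powMultiples_of_not_dvd {p : ℕ} {M : Set ℕ} {k : ℕ} (hk : ¬ p ∣ k) :
    k ∈ powMultiples p M ↔ k ∈ M := by
  constructor
  · rintro ⟨m, hm, j, rfl⟩
    cases j with
    | zero => simpa using hm
    | succ j => exact absurd ((dvd_pow_self p (Nat.succ_ne_zero j)).mul_left m) hk
  · exact fun h => ⟨k, h, 0, by simp⟩

theorem mul_mem_powMultiples {p : ℕ} (hp : 0 < p) {M : Set ℕ} (hM : ∀ m ∈ M, ¬ p ∣ m) {k : ℕ} :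
    p * k ∈ powMultiples p M ↔ k ∈ powMultiples p M := by
  constructor
  · rintro ⟨m, hm, j, h⟩
    cases j with
    | zero => exact absurd ⟨k, by simpa using h.symm⟩ (hM m hm)
    | succ j =>
      refine ⟨m, hm, j, Nat.eq_of_mul_eq_mul_left hp ?_⟩
      rw [h, pow_succ]; ring
  · rintro ⟨m, hm, j, rfl⟩
    exact ⟨m, hm, j + 1, by rw [pow_succ]; ring⟩

open scoped Classical in
/-- For every density `θ` there is a set of integers prime to `p` whose closure under
multiplication by `p` has density `θ`: distribute a proportion `θ` evenly among the integers
prime to `p`. -/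
theorem exists_powMultiples_density {p : ℕ} (hp : 1 < p) {θ : ℝ} (h0 : 0 ≤ θ) (h1 : θ ≤ 1) :
    ∃ M : Set ℕ, (∀ m ∈ M, ¬ p ∣ m) ∧ Tendsto (fun x : ℕ =>
      (((Finset.range x).filter fun j => j + 1 ∈ powMultiples p M).card : ℝ) / x)
        atTop (𝓝 θ) := by
  -- `f x` is the number of elements of `M` up to `x`
  let f : ℕ → ℕ := fun x => ⌊θ * ((x - x / p : ℕ) : ℝ)⌋₊
  let M : Set ℕ := {m | f m ≠ f (m - 1)}
  have hstep : ∀ x, (x + 1 - (x + 1) / p : ℕ) = (x - x / p) + if p ∣ x + 1 then 0 else 1 := by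
    intro x
    have h2 : x / p ≤ x := Nat.div_le_self _ _
    rw [Nat.succ_div]
    split_ifs <;> omega
  have hM : ∀ m ∈ M, ¬ p ∣ m := by
    intro m hm hd
    rcases Nat.eq_zero_or_pos m with rfl | hpos
    · exact hm rfl
    · obtain ⟨x, rfl⟩ := Nat.exists_eq_add_of_le' hpos
      refine hm ?_
      simp only [f, Nat.add_sub_cancel]
      rw [hstep, if_pos hd, add_zero]
  have hf : ∀ x, f (x + 1) = f x + if x + 1 ∈ M then 1 else 0 := by
    intro x
    have hle : f (x + 1) ≤ f x + 1 := by
      simp only [f]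
      rw [← Nat.floor_add_one (by positivity)]
      refine Nat.floor_le_floor ?_
      rw [hstep]
      split_ifs <;> push_cast <;> nlinarith
    have hge : f x ≤ f (x + 1) := by
      refine Nat.floor_le_floor (mul_le_mul_of_nonneg_left ?_ h0)
      rw [hstep]
      exact_mod_cast Nat.le_add_right _ _
    by_cases h : x + 1 ∈ M
    · have h' : f (x + 1) ≠ f x := h
      rw [if_pos h]; omega
    · have h' : ¬ (f (x + 1) ≠ f x) := h
      rw [if_neg h]; omega
  let c : ℕ → ℕ := fun x => ((Finset.range x).filter fun j => j + 1 ∈ powMultiples p M).card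
  have hc : ∀ x, c (x + 1) = c x + if x + 1 ∈ powMultiples p M then 1 else 0 := by
    intro x
    simp only [c, Finset.range_add_one, Finset.filter_insert]
    split_ifs with h
    · rw [Finset.card_insert_of_notMem (by simp)]
    · rfl
  have hc0 : c 0 = 0 := rfl
  have hrec : ∀ x, c x = f x + c (x / p) := by
    intro x
    induction x with
    | zero => simp [hc0, f]
    | succ x ih =>
      rw [hc, ih, hf, Nat.succ_div]
      by_cases hd : p ∣ x + 1
      · have hnM : x + 1 ∉ M := fun h => hM _ h hd
        have h3 : x + 1 = p * (x / p + 1) := by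
          have := Nat.mul_div_cancel' hd
          rw [Nat.succ_div, if_pos hd] at this
          exact this.symm
        have h4 : x + 1 ∈ powMultiples p M ↔ x / p + 1 ∈ powMultiples p M := by
          conv_lhs => rw [h3]
          exact mul_mem_powMultiples (by omega) hM
        rw [if_pos hd, if_neg hnM, hc (x / p)]
        simp only [h4]
        omega
      · rw [if_neg hd, add_zero]
        simp only [mem_powMultiples_of_not_dvd hd]
        omega
  have hfle : ∀ x, (f x : ℝ) ≤ θ * ((x - x / p : ℕ) : ℝ) := fun x => Nat.floor_le (by positivity)
  have hflt : ∀ x, θ * ((x - x / p : ℕ) : ℝ) < f x + 1 := fun x => Nat.lt_floor_add_one _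
  have hsplit : ∀ x : ℕ, θ * ((x - x / p : ℕ) : ℝ) = θ * x - θ * ((x / p : ℕ) : ℝ) := by
    intro x
    rw [Nat.cast_sub (Nat.div_le_self _ _)]; ring
  have hup : ∀ x : ℕ, (c x : ℝ) ≤ θ * x := by
    intro x
    induction x using Nat.strong_induction_on with
    | _ x ih =>
      rcases Nat.eq_zero_or_pos x with rfl | hpos
      · simp [hc0]
      · have := ih (x / p) (Nat.div_lt_self hpos hp)
        have h2 := hfle x
        rw [hsplit] at h2
        rw [hrec]; push_cast; linarith
  have hlo : ∀ x : ℕ, θ * x - (Nat.log p x + 1) ≤ (c x : ℝ) := by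
    intro x
    induction x using Nat.strong_induction_on with
    | _ x ih =>
      have h2 := hflt x
      rw [hsplit] at h2
      rcases lt_or_ge x p with hx | hx
      · rw [Nat.div_eq_of_lt hx] at h2
        have : c x = f x := by rw [hrec, Nat.div_eq_of_lt hx, hc0, add_zero]
        rw [this]
        have : (0 : ℝ) ≤ Nat.log p x := by positivity
        push_cast at h2
        linarith
      · have h3 := ih (x / p) (Nat.div_lt_self (by omega) hp)
        have h4 : 1 ≤ Nat.log p x := Nat.log_pos hp hx
        rw [Nat.log_div_base, Nat.cast_sub h4] at h3
        rw [hrec]; push_cast at h3 ⊢; linarith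
  have hlog : Tendsto (fun x : ℕ => ((Nat.log p x : ℝ) + 1) / x) atTop (𝓝 0) := by
    have h2 : Tendsto (fun x : ℕ => (Real.log x / Real.log p + 1) / (x : ℝ)) atTop (𝓝 0) := by
      have h3 : Tendsto (fun x : ℝ => Real.log x / x) atTop (𝓝 0) :=
        Real.isLittleO_log_id_atTop.tendsto_div_nhds_zero
      have h4 := ((h3.comp tendsto_natCast_atTop_atTop).div_const (Real.log p)).add
        (tendsto_const_div_atTop_nhds_zero_nat (1 : ℝ))
      simp only [zero_div, add_zero] at h4
      refine h4.congr fun x => ?_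
      simp only [Function.comp]
      ring
    refine squeeze_zero (fun x => by positivity) (fun x => ?_) h2
    have := Real.natLog_le_logb x p
    rw [Real.logb] at this
    gcongr
  refine ⟨M, hM, ?_⟩
  change Tendsto (fun x : ℕ => (c x : ℝ) / x) atTop (𝓝 θ)
  have hlow : Tendsto (fun x : ℕ => θ - ((Nat.log p x : ℝ) + 1) / x) atTop (𝓝 (θ - 0)) :=
    tendsto_const_nhds.sub hlog
  rw [sub_zero] at hlow
  refine tendsto_of_tendsto_of_tendsto_of_le_of_le' hlow tendsto_const_nhds ?_ ?_
  · filter_upwards [eventually_gt_atTop 0] with x hx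
    have hx' : (0 : ℝ) < x := by exact_mod_cast hx
    rw [le_div_iff₀ hx', sub_mul, div_mul_cancel₀ _ hx'.ne']
    exact hlo x
  · filter_upwards [eventually_gt_atTop 0] with x hx
    have hx' : (0 : ℝ) < x := by exact_mod_cast hx
    rw [div_le_iff₀ hx']
    exact hup x

end Density

instance PowerSeries.charP (A : Type*) [CommRing A] (p : ℕ) [CharP A p] : CharP A⟦X⟧ p :=
  charP_of_injective_ringHom (f := PowerSeries.C) PowerSeries.C_injective p

section OneUnits

variable {p : ℕ} {M : Set ℕ}

/-- The product of the powers `(1 + t ^ m) ^ (e m)`. -/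
noncomputable def oneUnitProd (p : ℕ) (e : ℕ →₀ ℕ) : (ZMod p)⟦X⟧ :=
  e.prod fun m a => (1 + PowerSeries.X ^ m) ^ a

/-- The `t`-adic closure of the monoid generated by the `1 + t ^ m` with `m ∈ M`. -/
def IsOneUnitLimit (M : Set ℕ) (u : (ZMod p)⟦X⟧) : Prop :=
  ∀ k, ∃ e : ℕ →₀ ℕ, (∀ m ∈ e.support, m ∈ M) ∧ PowerSeries.X ^ k ∣ u - oneUnitProd p e

theorem oneUnitProd_add (e e' : ℕ →₀ ℕ) :
    oneUnitProd p (e + e') = oneUnitProd p e * oneUnitProd p e' :=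
  Finsupp.prod_add_index' (fun _ => pow_zero _) fun _ _ _ => pow_add _ _ _

theorem oneUnitProd_zero : oneUnitProd p 0 = 1 := Finsupp.prod_zero_index

theorem oneUnitProd_single (m a : ℕ) :
    oneUnitProd p (Finsupp.single m a) = (1 + PowerSeries.X ^ m) ^ a :=
  Finsupp.prod_single_index (pow_zero _)

namespace IsOneUnitLimit

theorem one : IsOneUnitLimit M (1 : (ZMod p)⟦X⟧) := fun k =>
  ⟨0, by simp, by rw [oneUnitProd_zero, sub_self]; exact dvd_zero _⟩

theorem mul {u v : (ZMod p)⟦X⟧} (hu : IsOneUnitLimit M u) (hv : IsOneUnitLimit M v) :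
    IsOneUnitLimit M (u * v) := by
  intro k
  obtain ⟨e, he, h⟩ := hu k
  obtain ⟨e', he', h'⟩ := hv k
  refine ⟨e + e', fun m hm => ?_, ?_⟩
  · rcases Finset.mem_union.mp (Finsupp.support_add hm) with h | h
    · exact he m h
    · exact he' m h
  · rw [oneUnitProd_add, show u * v - oneUnitProd p e * oneUnitProd p e' =
      (u - oneUnitProd p e) * v + oneUnitProd p e * (v - oneUnitProd p e') by ring]
    exact dvd_add (h.mul_right _) (h'.mul_left _)

theorem of_forall {u : (ZMod p)⟦X⟧}
    (h : ∀ k, ∃ v, IsOneUnitLimit M v ∧ PowerSeries.X ^ k ∣ u - v) : IsOneUnitLimit M u := by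
  intro k
  obtain ⟨v, hv, h1⟩ := h k
  obtain ⟨e, he, h2⟩ := hv k
  exact ⟨e, he, by simpa using dvd_add h1 h2⟩

variable [Fact p.Prime]

theorem one_add_X_pow {k : ℕ} (hk : k ∈ powMultiples p M) :
    IsOneUnitLimit M (1 + PowerSeries.X ^ k : (ZMod p)⟦X⟧) := by
  obtain ⟨m, hm, j, rfl⟩ := hk
  refine fun k => ⟨Finsupp.single m (p ^ j), fun m' hm' => ?_, ?_⟩
  · rw [Finsupp.mem_support_single] at hm'
    rwa [hm'.1]
  · rw [oneUnitProd_single, add_pow_char_pow, one_pow, ← pow_mul, sub_self]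
    exact dvd_zero _

end IsOneUnitLimit

theorem X_pow_dvd_one_add_pow [Fact p.Prime] {m a : ℕ} (hm : ¬ p ∣ m) (ha : a ≠ 0) :
    ∃ j, ∃ c : ZMod p, c ≠ 0 ∧ PowerSeries.X ^ (m * p ^ j + 1) ∣
      ((1 + PowerSeries.X ^ m) ^ a - 1 - PowerSeries.C c * PowerSeries.X ^ (m * p ^ j) :
        (ZMod p)⟦X⟧) := by
  have hp := (Fact.out : p.Prime)
  obtain ⟨j, b, hb, rfl⟩ := Nat.exists_eq_pow_mul_and_not_dvd ha p hp.ne_one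
  refine ⟨j, (b : ZMod p), fun h => hb ((ZMod.natCast_eq_zero_iff _ _).mp h), ?_⟩
  rw [pow_mul, add_pow_char_pow, one_pow, ← pow_mul]
  have h1 := sq_dvd_add_pow_sub_sub (PowerSeries.X ^ (m * p ^ j) : (ZMod p)⟦X⟧) 1 b
  have hpos : 0 < m * p ^ j := Nat.mul_pos (Nat.pos_of_ne_zero fun h => hm (by simp [h]))
    (pow_pos hp.pos _)
  rw [← pow_mul] at h1
  refine (pow_dvd_pow _ (by omega)).trans (h1.trans (dvd_of_eq ?_))
  simp only [one_pow, map_natCast]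
  ring

theorem mul_pow_injective [hp : Fact p.Prime] {m m' j j' : ℕ} (hm : ¬ p ∣ m) (hm' : ¬ p ∣ m')
    (h : m * p ^ j = m' * p ^ j') : m = m' := by
  wlog hj : j ≤ j' generalizing m m' j j'
  · exact (this hm' hm h.symm (by omega)).symm
  obtain ⟨i, rfl⟩ := Nat.exists_eq_add_of_le hj
  have h1 : m = m' * p ^ i := by
    refine Nat.eq_of_mul_eq_mul_right (pow_pos hp.out.pos j) ?_
    rw [h, pow_add]; ring
  cases i with
  | zero => simpa using h1
  | succ i => exact absurd (h1 ▸ (dvd_pow_self p (Nat.succ_ne_zero i)).mul_left m') hm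

theorem X_pow_dvd_mul_sub {k l : ℕ} (hkl : k < l) {c c' : ZMod p}
    {u v : (ZMod p)⟦X⟧}
    (hu : PowerSeries.X ^ (k + 1) ∣ u - 1 - PowerSeries.C c * PowerSeries.X ^ k)
    (hv : PowerSeries.X ^ (l + 1) ∣ v - 1 - PowerSeries.C c' * PowerSeries.X ^ l) :
    PowerSeries.X ^ (k + 1) ∣ u * v - 1 - PowerSeries.C c * PowerSeries.X ^ k := by
  have h1 : PowerSeries.X ^ (k + 1) ∣ v - 1 := by
    have := dvd_add ((pow_dvd_pow _ (by omega : k + 1 ≤ l + 1)).trans hv)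
      ((pow_dvd_pow (PowerSeries.X : (ZMod p)⟦X⟧) (by omega : k + 1 ≤ l)).mul_left
        (PowerSeries.C c'))
    simpa using this
  have h2 := dvd_add (h1.mul_left u) hu
  rwa [show u * (v - 1) + (u - 1 - PowerSeries.C c * PowerSeries.X ^ k) =
    u * v - 1 - PowerSeries.C c * PowerSeries.X ^ k by ring] at h2

/-- The factors `(1 + t ^ m) ^ (e m)` of a product are congruent to `1` modulo powers of `t` with
different exponents `m p ^ j`, so the smallest of these exponents is that of the product. -/
theorem X_pow_dvd_oneUnitProd [Fact p.Prime] (hM : ∀ m ∈ M, ¬ p ∣ m) (e : ℕ →₀ ℕ)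
    (he : ∀ m ∈ e.support, m ∈ M) : e = 0 ∨ ∃ m ∈ e.support, ∃ j, ∃ c : ZMod p, c ≠ 0 ∧
      PowerSeries.X ^ (m * p ^ j + 1) ∣
        oneUnitProd p e - 1 - PowerSeries.C c * PowerSeries.X ^ (m * p ^ j) := by
  have hp := (Fact.out : p.Prime)
  induction e using Finsupp.induction with
  | zero => exact Or.inl rfl
  | single_add m a f hmf ha ih =>
    right
    have hdisj : Disjoint (Finsupp.single m a).support f.support := by
      rw [Finsupp.support_single _ ha, Finset.disjoint_singleton_left]
      exact hmf
    have hsupp : (Finsupp.single m a + f).support = {m} ∪ f.support := by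
      rw [Finsupp.support_add_eq hdisj, Finsupp.support_single _ ha]
    have hmM : m ∈ M := he m (by rw [hsupp]; simp)
    obtain ⟨j, c, hc, h1⟩ := X_pow_dvd_one_add_pow (hM m hmM) ha
    rw [← oneUnitProd_single] at h1
    rcases ih fun m' hm' => he m' (by rw [hsupp]; simp [hm']) with rfl | ⟨m', hm', j', c', hc', h2⟩
    · refine ⟨m, by simp [ha], j, c, hc, ?_⟩
      rwa [add_zero]
    · have hm'M : m' ∈ M := he m' (by rw [hsupp]; simp [hm'])
      have hne : m * p ^ j ≠ m' * p ^ j' := fun h => by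
        rw [mul_pow_injective (hM m hmM) (hM m' hm'M) h] at hmf
        exact hmf hm'
      rw [oneUnitProd_add]
      rcases lt_or_gt_of_ne hne with hlt | hlt
      · exact ⟨m, by rw [hsupp]; simp, j, c, hc, X_pow_dvd_mul_sub hlt h1 h2⟩
      · refine ⟨m', by rw [hsupp]; simp [hm'], j', c', hc', ?_⟩
        rw [mul_comm (oneUnitProd p _)]
        exact X_pow_dvd_mul_sub hlt h2 h1

/-- The leading exponents of the elements of the closure all lie in `⋃ j, M p ^ j`. -/
theorem IsOneUnitLimit.mem_powMultiples [Fact p.Prime] (hM : ∀ m ∈ M, ¬ p ∣ m) {u : (ZMod p)⟦X⟧}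
    (hu : IsOneUnitLimit M u) {k : ℕ} (h1 : PowerSeries.X ^ k ∣ u - 1)
    (h2 : PowerSeries.coeff k (u - 1) ≠ 0) : k ∈ powMultiples p M := by
  obtain ⟨e, he, h⟩ := hu (k + 1)
  set b := oneUnitProd p e
  have hcoeff : ∀ i ≤ k, PowerSeries.coeff i (b - 1) = PowerSeries.coeff i (u - 1) := by
    intro i hi
    have := PowerSeries.X_pow_dvd_iff.mp h i (by omega)
    rw [map_sub, sub_eq_zero] at this
    rw [map_sub, map_sub, this]
  rcases X_pow_dvd_oneUnitProd hM e he with rfl | ⟨m, hm, j, c, hc, h3⟩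
  · rw [← hcoeff k le_rfl] at h2
    simp [b, oneUnitProd_zero] at h2
  · refine ⟨m, he m hm, j, ?_⟩
    have h4 : ∀ i ≤ m * p ^ j, PowerSeries.coeff i (b - 1) = if i = m * p ^ j then c else 0 := by
      intro i hi
      have := PowerSeries.X_pow_dvd_iff.mp h3 i (by omega)
      rw [map_sub, sub_eq_zero] at this
      rw [this, PowerSeries.coeff_C_mul, PowerSeries.coeff_X_pow]
      simp
    rcases lt_trichotomy k (m * p ^ j) with hlt | heq | hgt
    · refine absurd ?_ h2
      rw [← hcoeff k le_rfl, h4 k hlt.le, if_neg hlt.ne]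
    · exact heq
    · refine absurd ?_ hc
      have := h4 _ le_rfl
      rw [if_pos rfl, hcoeff _ hgt.le, PowerSeries.X_pow_dvd_iff.mp h1 _ hgt] at this
      exact this.symm

end OneUnits

/-! ### Leading coefficients of elements of congruence subgroups -/

section Graded

variable {p : ℕ} {ι : Type*} [Fintype ι] [DecidableEq ι] {G : Subgroup (GL ι (ZMod p)⟦X⟧)}

theorem congruenceSubgroup_zero : congruenceSubgroup G 0 = ⊤ := by
  rw [eq_top_iff]
  intro g _
  rw [mem_congruenceSubgroup]
  simp

/-- A `t`-adically closed submonoid of a compact group is a subgroup: modulo `t ^ k` the inverse of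
`g` is a power of `g`. -/
theorem inv_mem_of_closed [Fact p.Prime] [CompactSpace G] (P : Submonoid G)
    (hP : ∀ x, (∀ k, ∃ h ∈ P, h⁻¹ * x ∈ congruenceSubgroup G k) → x ∈ P) {g : G} (hg : g ∈ P) :
    g⁻¹ ∈ P := by
  refine hP _ fun k => ⟨g ^ ((congruenceSubgroup G k).index - 1), pow_mem hg _, ?_⟩
  have hfin := Subgroup.quotient_finite_of_isOpen _ (isOpen_congruenceSubgroup (G := G) k)
  have h0 : (congruenceSubgroup G k).index ≠ 0 := Subgroup.index_ne_zero_of_finite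
  rw [← mul_inv_rev, inv_mem_iff, ← pow_succ', Nat.sub_add_cancel (Nat.pos_of_ne_zero h0)]
  exact Subgroup.pow_index_mem _ _

theorem coeff_mul_of_X_pow_dvd {A : Type*} [Semiring A] {x y : A⟦X⟧} {j : ℕ} (hj : 0 < j)
    (hx : PowerSeries.X ^ j ∣ x) (hy : PowerSeries.X ^ j ∣ y) : PowerSeries.coeff j (x * y) = 0 := by
  rw [PowerSeries.coeff_mul]
  refine Finset.sum_eq_zero fun ⟨a, b⟩ hab => ?_
  replace hab : a + b = j := Finset.HasAntidiagonal.mem_antidiagonal.mp hab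
  rcases lt_or_ge a j with h | h
  · rw [PowerSeries.X_pow_dvd_iff.mp hx a h, zero_mul]
  · rcases Nat.eq_zero_or_pos a with rfl | ha
    · rw [PowerSeries.X_pow_dvd_iff.mp hx 0 hj, zero_mul]
    have hb : b < j := by omega
    rw [PowerSeries.X_pow_dvd_iff.mp hy b hb, mul_zero]

/-- The leading coefficients of the elements of the `j`-th congruence subgroup, at a set of
positions. -/
noncomputable def leadingCoeffHom {j : ℕ} (hj : 0 < j) (H : Subgroup G) (Λ : Finset (ι × ι)) :
    (congruenceSubgroup G j ⊓ H : Subgroup G) →* Multiplicative (Λ → ZMod p) where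
  toFun g := Multiplicative.ofAdd fun q => PowerSeries.coeff j
    ((g : GL ι (ZMod p)⟦X⟧).val q.1.1 q.1.2 - (1 : Matrix ι ι (ZMod p)⟦X⟧) q.1.1 q.1.2)
  map_one' := by
    rw [← ofAdd_zero]
    congr 1
    funext q
    simp
  map_mul' g g' := by
    rw [← ofAdd_add]
    congr 1
    funext q
    have h : ((g : GL ι (ZMod p)⟦X⟧) * (g' : GL ι (ZMod p)⟦X⟧)).val - 1 =
        ((g : GL ι (ZMod p)⟦X⟧).val - 1) + ((g' : GL ι (ZMod p)⟦X⟧).val - 1) +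
        ((g : GL ι (ZMod p)⟦X⟧).val - 1) * ((g' : GL ι (ZMod p)⟦X⟧).val - 1) := by
      rw [Units.val_mul]; noncomm_ring
    have h' := congrFun₂ h q.1.1 q.1.2
    simp only [Matrix.sub_apply, Matrix.add_apply] at h'
    rw [Pi.add_apply]
    change PowerSeries.coeff j (((g : GL ι (ZMod p)⟦X⟧) * (g' : GL ι (ZMod p)⟦X⟧)).val q.1.1 q.1.2
      - (1 : Matrix ι ι (ZMod p)⟦X⟧) q.1.1 q.1.2) = _
    rw [h', map_add, map_add, Matrix.mul_apply, map_sum, Finset.sum_eq_zero, add_zero]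
    intro k _
    exact coeff_mul_of_X_pow_dvd hj (mem_congruenceSubgroup.mp g.2.1 _ _)
      (mem_congruenceSubgroup.mp g'.2.1 _ _)

theorem mem_congruenceSubgroup_succ {j : ℕ} {g : G} (hg : g ∈ congruenceSubgroup G j) :
    g ∈ congruenceSubgroup G (j + 1) ↔ ∀ a b, PowerSeries.coeff j
      ((g : GL ι (ZMod p)⟦X⟧).val a b - (1 : Matrix ι ι (ZMod p)⟦X⟧) a b) = 0 := by
  rw [mem_congruenceSubgroup] at hg ⊢
  refine forall₂_congr fun a b => ?_
  have := PowerSeries.X_pow_dvd_iff.mp (hg a b)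
  rw [PowerSeries.X_pow_dvd_iff]
  constructor
  · exact fun h => h j (Nat.lt_succ_self j)
  · intro h m hm
    rcases Nat.lt_succ_iff_lt_or_eq.mp hm with h1 | rfl
    · exact this m h1
    · exact h

/-- If the leading coefficients at the positions in `Λ` are arbitrary and determine the others, then
the step has index `p ^ |Λ|`. -/
theorem relIndex_congruenceSubgroup_succ [Fact p.Prime] {j : ℕ} (hj : 0 < j) (H : Subgroup G)
    (Λ : Finset (ι × ι))
    (hker : ∀ g ∈ congruenceSubgroup G j, g ∈ H → (∀ q ∈ Λ, PowerSeries.coeff j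
      ((g : GL ι (ZMod p)⟦X⟧).val q.1 q.2 - (1 : Matrix ι ι (ZMod p)⟦X⟧) q.1 q.2) = 0) →
      ∀ a b, PowerSeries.coeff j
        ((g : GL ι (ZMod p)⟦X⟧).val a b - (1 : Matrix ι ι (ZMod p)⟦X⟧) a b) = 0)
    (hsurj : ∀ q ∈ Λ, ∃ g ∈ congruenceSubgroup G j, g ∈ H ∧ ∀ q' ∈ Λ, PowerSeries.coeff j
      ((g : GL ι (ZMod p)⟦X⟧).val q'.1 q'.2 - (1 : Matrix ι ι (ZMod p)⟦X⟧) q'.1 q'.2) =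
        if q' = q then 1 else 0) :
    (congruenceSubgroup G (j + 1)).relIndex (congruenceSubgroup G j ⊓ H) = p ^ Λ.card := by
  have h1 : (congruenceSubgroup G (j + 1)).subgroupOf (congruenceSubgroup G j ⊓ H) =
      (leadingCoeffHom hj H Λ).ker := by
    ext g
    rw [Subgroup.mem_subgroupOf, mem_congruenceSubgroup_succ g.2.1, MonoidHom.mem_ker]
    constructor
    · intro h
      rw [← ofAdd_zero]
      exact congrArg Multiplicative.ofAdd (funext fun q => h _ _)
    · intro h
      exact hker g g.2.1 g.2.2 fun q hq => congrFun (congrArg Multiplicative.toAdd h) ⟨q, hq⟩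
  have h2 : (leadingCoeffHom hj H Λ).range = ⊤ := by
    have key : ∀ q : Λ, ∀ c : ZMod p,
        Multiplicative.ofAdd (Pi.single q c) ∈ (leadingCoeffHom hj H Λ).range := by
      intro q c
      obtain ⟨g, hg, hgH, hgq⟩ := hsurj q q.2
      refine ⟨⟨g, hg, hgH⟩ ^ c.val, ?_⟩
      rw [map_pow]
      have : leadingCoeffHom hj H Λ ⟨g, hg, hgH⟩ = Multiplicative.ofAdd (Pi.single q 1) := by
        refine congrArg Multiplicative.ofAdd (funext fun q' => ?_)
        rw [hgq q' q'.2, Pi.single_apply]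
        simp only [Subtype.ext_iff]
      rw [this, ← ofAdd_nsmul]
      congr 1
      rw [← Pi.single_smul]
      simp
    rw [eq_top_iff]
    intro v _
    have : v = ∏ q, Multiplicative.ofAdd (Pi.single q (v.toAdd q)) := by
      rw [← ofAdd_sum, Finset.univ_sum_single]
      rfl
    rw [this]
    exact prod_mem fun q _ => key q _
  rw [Subgroup.relIndex, h1, Subgroup.index_ker, h2, Nat.card_congr Subgroup.topEquiv.toEquiv,
    Nat.card_congr Multiplicative.toAdd, Nat.card_eq_fintype_card, Fintype.card_fun, ZMod.card,
    Fintype.card_coe]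

theorem relIndex_congruenceSubgroup_of_step {H : Subgroup G} (hH : H ≤ congruenceSubgroup G 1)
    (b : ℕ → ℕ) (hb : ∀ j, 0 < j →
      (congruenceSubgroup G (j + 1)).relIndex (congruenceSubgroup G j ⊓ H) = p ^ b j) (k : ℕ) :
    (congruenceSubgroup G k).relIndex H = p ^ ∑ j ∈ Finset.Ico 1 k, b j := by
  induction k with
  | zero => simp [congruenceSubgroup_zero]
  | succ k ih =>
    rcases Nat.eq_zero_or_pos k with rfl | hk
    · simpa using hH
    · have h1 := Subgroup.relIndex_inf_mul_relIndex (congruenceSubgroup G (k + 1))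
        (congruenceSubgroup G k) H
      rw [inf_eq_left.mpr (congruenceSubgroup_antitone (Nat.le_succ k)), hb k hk, ih, ← pow_add]
        at h1
      rw [← h1, Finset.sum_Ico_succ_top hk, add_comm]

end Graded

/-! ### Antidiagonal forms and subgroups of triangular isometries -/

/-- An antidiagonal shape of a form on `ι`: the entry `s i = ±1` of the form stands at `(i, σ i)`,
and the rows are ordered by a height that `σ` reverses. The form is symmetric for `ε = 1`,
alternating for `ε = -1`. -/
structure AntidiagonalForm (ι : Type) where
  h : ι → ℤ
  σ : ι → ι
  s : ι → ℤ
  ε : ℤ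
  h_injective : Function.Injective h
  h_σ : ∀ i, h (σ i) = -h i
  s_mul_s : ∀ i, s i * s i = 1
  s_σ : ∀ i, s (σ i) = ε * s i
  ε_eq : ε = 1 ∨ ε = -1

namespace AntidiagonalForm

variable {ι : Type} (F : AntidiagonalForm ι)

@[simp] theorem σ_σ (i : ι) : F.σ (F.σ i) = i :=
  F.h_injective (by rw [F.h_σ, F.h_σ, neg_neg])

theorem σ_injective : Function.Injective F.σ := fun i j hij => by
  rw [← F.σ_σ i, hij, F.σ_σ]

theorem ε_mul_ε : F.ε * F.ε = 1 := by
  rcases F.ε_eq with h | h <;> rw [h] <;> norm_num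

theorem s_mul_s_σ (i : ι) : F.s i * F.s (F.σ i) = F.ε := by
  rw [F.s_σ, mul_left_comm, F.s_mul_s, mul_one]

/-- A fixed point of `σ` would carry a nonzero diagonal entry of an alternating form. -/
theorem h_ne_zero (hε : F.ε = -1) (i : ι) : F.h i ≠ 0 := by
  intro h0
  have h1 : F.σ i = i := F.h_injective (by rw [F.h_σ, h0, neg_zero])
  have h2 := F.s_mul_s_σ i
  rw [h1, F.s_mul_s, hε] at h2
  norm_num at h2

/-- The positions, on or above the diagonal, at which the leading coefficients of an isometry that
is congruent to `1` can be prescribed. -/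
def live : Set (ι × ι) :=
  {q | F.h q.1 ≤ F.h q.2 ∧ (F.h q.1 + F.h q.2 < 0 ∨ (F.h q.1 + F.h q.2 = 0 ∧ F.ε = -1))}

/-- The order of the positions: by the distance from the diagonal, then along the parallels to the
diagonal. -/
def key (q : ι × ι) : ℤ ×ₗ ℤ := toLex (F.h q.2 - F.h q.1, F.h q.1 + F.h q.2)

theorem key_lt {q q' : ι × ι} : F.key q < F.key q' ↔ F.h q.2 - F.h q.1 < F.h q'.2 - F.h q'.1 ∨
    (F.h q.2 - F.h q.1 = F.h q'.2 - F.h q'.1 ∧ F.h q.1 + F.h q.2 < F.h q'.1 + F.h q'.2) :=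
  Prod.Lex.toLex_lt_toLex

theorem key_injective : Function.Injective F.key := by
  intro q q' hq
  have h1 := congrArg (fun z => (ofLex z).1) hq
  have h2 := congrArg (fun z => (ofLex z).2) hq
  simp only [key, ofLex_toLex] at h1 h2
  exact Prod.ext (F.h_injective (by omega)) (F.h_injective (by omega))

theorem live_swap {i j : ι} (hq : (i, j) ∈ F.live) (hq' : (F.σ j, F.σ i) ∈ F.live) :
    j = F.σ i ∧ F.ε = -1 := by
  simp only [live, Set.mem_ofPred_eq, F.h_σ] at hq hq'
  refine ⟨F.h_injective ?_, ?_⟩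
  · rw [F.h_σ]; omega
  · omega

theorem not_key_swap_lt {i j : ι} (hq : (i, j) ∈ F.live) :
    ¬ F.key (F.σ j, F.σ i) < F.key (i, j) := by
  simp only [live, Set.mem_ofPred_eq] at hq
  rw [key_lt]
  simp only [F.h_σ]
  omega

section ring

variable (R : Type*) [CommRing R]

/-- The matrix of the form. -/
def form [DecidableEq ι] : Matrix ι ι R := Matrix.of fun i j => if j = F.σ i then (F.s i : R) else 0

variable {R}

theorem s_mul_s_cast (i : ι) : (F.s i : R) * F.s i = 1 := by
  rw [← Int.cast_mul, F.s_mul_s, Int.cast_one]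

variable [DecidableEq ι]

theorem transpose_form : (F.form R)ᵀ = F.ε • F.form R := by
  ext a b
  simp only [Matrix.transpose_apply, Matrix.smul_apply, form, Matrix.of_apply]
  by_cases hab : b = F.σ a
  · subst hab
    rw [if_pos (F.σ_σ a).symm, if_pos rfl, F.s_σ, zsmul_eq_mul, Int.cast_mul]
  · rw [if_neg hab, if_neg fun h => hab (by rw [h, F.σ_σ]), smul_zero]

variable [Fintype ι]

theorem form_mul_apply (A : Matrix ι ι R) (a b : ι) :
    (F.form R * A) a b = F.s a * A (F.σ a) b := by
  rw [Matrix.mul_apply, Finset.sum_eq_single (F.σ a)]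
  · simp [form]
  · intro c _ hc
    simp [form, hc]
  · simp

theorem mul_form_apply (A : Matrix ι ι R) (a b : ι) :
    (A * F.form R) a b = A a (F.σ b) * F.s (F.σ b) := by
  rw [Matrix.mul_apply, Finset.sum_eq_single (F.σ b)]
  · simp [form]
  · intro c _ hc
    have : b ≠ F.σ c := fun h => hc (by rw [h, F.σ_σ])
    simp [form, this]
  · simp

theorem isUnit_det_form : IsUnit (F.form R).det := by
  refine Matrix.isUnit_det_of_right_inverse (B := F.ε • F.form R) ?_
  ext a b
  rw [form_mul_apply, Matrix.smul_apply, form, Matrix.of_apply, F.σ_σ, Matrix.one_apply]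
  by_cases hab : a = b
  · subst hab
    rw [if_pos rfl, if_pos rfl, zsmul_eq_mul, ← Int.cast_mul, ← Int.cast_mul, F.s_σ,
      show F.s a * (F.ε * (F.ε * F.s a)) = (F.ε * F.ε) * (F.s a * F.s a) by ring, F.ε_mul_ε,
      F.s_mul_s]
    simp
  · rw [if_neg (Ne.symm hab), if_neg hab]
    simp

theorem exists_isometry {A : Matrix ι ι R} (hA : Aᵀ * F.form R * A = F.form R) :
    ∃ g : isometryGroup (F.form R), (g : GL ι R).val = A := by
  have h : IsUnit A.det := by
    have := congrArg Matrix.det hA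
    rw [Matrix.det_mul] at this
    exact isUnit_of_mul_isUnit_right (this ▸ F.isUnit_det_form)
  exact ⟨⟨A.nonsingInvUnit h, hA⟩, rfl⟩

/-- The linear relation between the entries of an element of the Lie algebra, up to the quadratic
term of the group equation. -/
theorem isometry_relation (g : isometryGroup (F.form R)) (a b : ι) :
    F.s (F.σ b) * ((g : GL ι R).val - 1) (F.σ b) a + F.s a * ((g : GL ι R).val - 1) (F.σ a) b +
      (((g : GL ι R).val - 1)ᵀ * (F.form R * ((g : GL ι R).val - 1)) : Matrix ι ι R) a b = 0 := by
  have hg : (g : GL ι R).valᵀ * F.form R * (g : GL ι R).val = F.form R := g.2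
  set A := (g : GL ι R).val
  have h1 : (A - 1)ᵀ * F.form R + F.form R * (A - 1) + (A - 1)ᵀ * (F.form R * (A - 1)) = 0 := by
    rw [Matrix.transpose_sub, Matrix.transpose_one]
    have : (Aᵀ - 1) * F.form R + F.form R * (A - 1) + (Aᵀ - 1) * (F.form R * (A - 1)) =
      Aᵀ * F.form R * A - F.form R := by noncomm_ring
    rw [this, hg, sub_self]
  have h2 := congrFun₂ h1 a b
  rw [Matrix.add_apply, Matrix.add_apply, mul_form_apply, form_mul_apply, Matrix.transpose_apply,
    Matrix.zero_apply] at h2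
  rw [← h2]
  ring

variable {F}

/-- Let two matrices vanish at all positions before `q₀`, which lies on or above the diagonal. A
nonzero term `E i c * E' c j` of their product moves away from the diagonal twice, each time at
least as far as `q₀`, so it contributes at a position up to `q₀` only if all three indices agree. -/
theorem mul_apply_of_key_le {q₀ : ι × ι} (h0 : F.h q₀.1 ≤ F.h q₀.2) {E E' : Matrix ι ι R}
    (hE : ∀ q, F.key q < F.key q₀ → E q.1 q.2 = 0) (hE' : ∀ q, F.key q < F.key q₀ → E' q.1 q.2 = 0)
    {q : ι × ι} (hq : F.key q ≤ F.key q₀) :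
    (E * E') q.1 q.2 = if q.1 = q.2 then E q.1 q.2 * E' q.1 q.2 else 0 := by
  obtain ⟨i, j⟩ := q
  simp only at hq ⊢
  rw [← not_lt, key_lt] at hq
  simp only at hq
  have hz : ∀ c, ¬ (c = i ∧ i = j) → E i c * E' c j = 0 := by
    intro c hc
    by_contra hne
    have h1 : ¬ F.key (i, c) < F.key q₀ := fun h => hne (by rw [hE (i, c) h, zero_mul])
    have h2 : ¬ F.key (c, j) < F.key q₀ := fun h => hne (by rw [hE' (c, j) h, mul_zero])
    rw [key_lt] at h1 h2
    simp only at h1 h2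
    exact hc ⟨F.h_injective (by omega), F.h_injective (by omega)⟩
  rw [Matrix.mul_apply]
  split_ifs with hij
  · subst hij
    exact Finset.sum_eq_single i (fun c _ hc => hz c fun h => hc h.1) (by simp)
  · exact Finset.sum_eq_zero fun c _ => hz c fun h => hij h.2

end ring

section group

variable [DecidableEq ι] (p : ℕ) (M : Set ℕ) (q₀ : ι × ι)

/-- The condition on the entry at the position `q₀`: at a diagonal position the entry is a limit of
products of the `1 + t ^ m` with `m ∈ M`; elsewhere it is a series in the `t ^ k` with
`k ∈ ⋃ j, M p ^ j`. -/
def EntryCondition (x : (ZMod p)⟦X⟧) : Prop :=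
  if q₀.1 = q₀.2 then IsOneUnitLimit M x
  else ∀ k, k ∉ powMultiples p M → PowerSeries.coeff k x = 0

variable {p M q₀}

theorem entryCondition_one :
    EntryCondition p M q₀ ((1 : Matrix ι ι (ZMod p)⟦X⟧) q₀.1 q₀.2) := by
  rw [EntryCondition]
  split_ifs with h
  · rw [h, Matrix.one_apply_eq]
    exact .one
  · simp [Matrix.one_apply_ne h]

theorem EntryCondition.of_forall {x : (ZMod p)⟦X⟧}
    (hx : ∀ k, ∃ y, EntryCondition p M q₀ y ∧ PowerSeries.X ^ k ∣ x - y) :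
    EntryCondition p M q₀ x := by
  unfold EntryCondition at hx ⊢
  split_ifs at hx ⊢ with h
  · exact .of_forall hx
  · intro k hk
    obtain ⟨y, hy, hxy⟩ := hx (k + 1)
    have := PowerSeries.X_pow_dvd_iff.mp hxy k (Nat.lt_succ_self k)
    rwa [map_sub, hy k hk, sub_zero] at this

/-- The leading exponents of the entries satisfying the condition lie in `⋃ j, M p ^ j`. -/
theorem EntryCondition.coeff_eq_zero [Fact p.Prime] (hM : ∀ m ∈ M, ¬ p ∣ m) {x : (ZMod p)⟦X⟧}
    (hx : EntryCondition p M q₀ x) {k : ℕ} (hk : k ∉ powMultiples p M)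
    (h1 : PowerSeries.X ^ k ∣ x - (1 : Matrix ι ι (ZMod p)⟦X⟧) q₀.1 q₀.2) :
    PowerSeries.coeff k (x - (1 : Matrix ι ι (ZMod p)⟦X⟧) q₀.1 q₀.2) = 0 := by
  unfold EntryCondition at hx
  split_ifs at hx with h
  · rw [h, Matrix.one_apply_eq] at h1 ⊢
    by_contra h2
    exact hk (hx.mem_powMultiples hM h1 h2)
  · rw [Matrix.one_apply_ne h, sub_zero]
    exact hx k hk

variable (p M q₀) [Fintype ι]

/-- The isometries congruent to `1` modulo `t` whose entries at the positions before `q₀` are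
trivial, and whose entry at `q₀` is restricted. -/
def stepSubmonoid (h0 : F.h q₀.1 ≤ F.h q₀.2) :
    Submonoid (isometryGroup (F.form (ZMod p)⟦X⟧)) where
  carrier := {g | g ∈ congruenceSubgroup _ 1 ∧
    (∀ q, F.key q < F.key q₀ →
      ((g : GL ι (ZMod p)⟦X⟧).val - 1 : Matrix ι ι (ZMod p)⟦X⟧) q.1 q.2 = 0) ∧
    EntryCondition p M q₀ ((g : GL ι (ZMod p)⟦X⟧).val q₀.1 q₀.2)}
  one_mem' := ⟨one_mem _, fun q _ => by simp, entryCondition_one⟩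
  mul_mem' {g g'} hg hg' := by
    obtain ⟨h1, h2, h3⟩ := hg
    obtain ⟨h1', h2', h3'⟩ := hg'
    have h : ((g * g' : isometryGroup (F.form (ZMod p)⟦X⟧)) : GL ι (ZMod p)⟦X⟧).val - 1 =
        ((g : GL ι (ZMod p)⟦X⟧).val - 1) + ((g' : GL ι (ZMod p)⟦X⟧).val - 1) +
        ((g : GL ι (ZMod p)⟦X⟧).val - 1) * ((g' : GL ι (ZMod p)⟦X⟧).val - 1) := by
      rw [Subgroup.coe_mul, Units.val_mul]; noncomm_ring
    refine ⟨mul_mem h1 h1', fun q hq => ?_, ?_⟩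
    · rw [h, Matrix.add_apply, Matrix.add_apply, mul_apply_of_key_le h0 h2 h2' hq.le, h2 q hq,
        h2' q hq]
      simp
    · have h4 := congrFun₂ h q₀.1 q₀.2
      rw [Matrix.add_apply, Matrix.add_apply, mul_apply_of_key_le h0 h2 h2' le_rfl] at h4
      unfold EntryCondition at h3 h3' ⊢
      simp only [Matrix.sub_apply] at h4
      split_ifs at h3 h3' h4 ⊢ with hq
      · rw [hq, Matrix.one_apply_eq] at h4
        rw [hq] at h3 h3' ⊢
        rw [show ((g * g' : isometryGroup (F.form (ZMod p)⟦X⟧)) : GL ι (ZMod p)⟦X⟧).val q₀.2 q₀.2 =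
          (g : GL ι (ZMod p)⟦X⟧).val q₀.2 q₀.2 * (g' : GL ι (ZMod p)⟦X⟧).val q₀.2 q₀.2 by
            linear_combination h4]
        exact h3.mul h3'
      · rw [Matrix.one_apply_ne hq, sub_zero, sub_zero, sub_zero, add_zero] at h4
        intro k hk
        rw [h4, map_add, h3 k hk, h3' k hk, add_zero]

variable {p M q₀}

theorem mem_stepSubmonoid_of_closed {h0 : F.h q₀.1 ≤ F.h q₀.2}
    (x : isometryGroup (F.form (ZMod p)⟦X⟧))
    (hx : ∀ k, ∃ h ∈ F.stepSubmonoid p M q₀ h0, h⁻¹ * x ∈ congruenceSubgroup _ k) :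
    x ∈ F.stepSubmonoid p M q₀ h0 := by
  refine ⟨?_, fun q hq => ?_, .of_forall fun k => ?_⟩
  · obtain ⟨g, hg, h⟩ := hx 1
    simpa using mul_mem hg.1 h
  · refine PowerSeries.eq_zero_of_forall_X_pow_dvd fun k => ?_
    obtain ⟨g, hg, h⟩ := hx k
    rw [inv_mul_mem_congruenceSubgroup] at h
    have h1 := hg.2.1 q hq
    rw [Matrix.sub_apply, sub_eq_zero] at h1
    rw [Matrix.sub_apply, ← h1, dvd_sub_comm]
    exact h _ _
  · obtain ⟨g, hg, h⟩ := hx k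
    rw [inv_mul_mem_congruenceSubgroup] at h
    exact ⟨_, hg.2.2, (dvd_sub_comm).mp (h _ _)⟩

variable (p M q₀) [Fact p.Prime]

theorem compactSpace_isometryGroup : CompactSpace (isometryGroup (F.form (ZMod p)⟦X⟧)) :=
  compactSpace_of_isClosed (isClosed_isometryGroup _)

/-- The subgroup of the isometries congruent to `1` modulo `t` whose entries at the positions
before `q₀` are trivial, and whose entry at `q₀` is restricted. -/
def stepSubgroup (h0 : F.h q₀.1 ≤ F.h q₀.2) : Subgroup (isometryGroup (F.form (ZMod p)⟦X⟧)) where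
  __ := F.stepSubmonoid p M q₀ h0
  inv_mem' {_} hg := by
    have := F.compactSpace_isometryGroup p
    exact inv_mem_of_closed _ F.mem_stepSubmonoid_of_closed hg

theorem stepSubgroup_le (h0 : F.h q₀.1 ≤ F.h q₀.2) :
    F.stepSubgroup p M q₀ h0 ≤ congruenceSubgroup _ 1 := fun _ hg => hg.1

end group

end AntidiagonalForm

/-! ### Index growth of the subgroups -/

/-- A truncated exponential of an element `N` of the Lie algebra with `N ^ 3 = 0`: the coefficient
`c` is `1 / 2`, or arbitrary if `N ^ 2 = 0`. -/
theorem Matrix.isometry_one_add {ι R : Type*} [Fintype ι] [DecidableEq ι] [CommRing R]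
    {J N : Matrix ι ι R} {c : R} (h1 : Nᵀ * J = -(J * N)) (h3 : N * N * N = 0)
    (hc : (2 * c - 1) • (N * N) = 0) :
    (1 + N + c • (N * N))ᵀ * J * (1 + N + c • (N * N)) = J := by
  have h2 : (N * N)ᵀ * J = J * (N * N) := by
    rw [Matrix.transpose_mul, Matrix.mul_assoc, h1, Matrix.mul_neg, ← Matrix.mul_assoc, h1,
      Matrix.neg_mul, neg_neg, Matrix.mul_assoc]
  have h4 : (1 + N + c • (N * N))ᵀ * J = J * (1 - N + c • (N * N)) := by
    rw [Matrix.transpose_add, Matrix.transpose_add, Matrix.transpose_one, Matrix.transpose_smul,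
      Matrix.add_mul, Matrix.add_mul, h1, Matrix.smul_mul, h2, Matrix.mul_add, Matrix.mul_sub,
      Matrix.mul_smul, Matrix.one_mul, Matrix.mul_one, sub_eq_add_neg]
  have h5 : (1 - N + c • (N * N)) * (1 + N + c • (N * N)) =
      1 + (2 * c - 1) • (N * N) + (c * c) • (N * N * N * N) := by
    simp only [Matrix.add_mul, Matrix.mul_add, Matrix.sub_mul, Matrix.smul_mul, Matrix.mul_smul,
      Matrix.one_mul, Matrix.mul_one, ← Matrix.mul_assoc]
    module
  rw [h4, Matrix.mul_assoc, h5, hc, h3, Matrix.zero_mul, smul_zero, add_zero, add_zero,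
    Matrix.mul_one]

namespace AntidiagonalForm

variable {ι : Type} (F : AntidiagonalForm ι)

theorem σ_ne_self_of_live {i j : ι} (hij : i ≠ j) (hq : (i, j) ∈ F.live) : F.σ i ≠ i := by
  intro h
  have h1 := F.h_σ i
  rw [h] at h1
  simp only [live, Set.mem_ofPred_eq] at hq
  exact hij (F.h_injective (by omega))

/-- Counting from the last live position, every number of successors occurs. -/
theorem exists_live_ncard_eq [Finite ι] {t : ℕ} (ht : t < F.live.ncard) :
    ∃ q₀ ∈ F.live, (F.live ∩ {q | F.key q₀ < F.key q}).ncard = t := by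
  classical
  have := Fintype.ofFinite ι
  let s : Finset (ℤ ×ₗ ℤ) := F.live.toFinset.image F.key
  have hs : s.card = F.live.ncard := by
    rw [Finset.card_image_of_injective _ F.key_injective, Set.ncard_eq_toFinset_card']
  obtain ⟨t', ht'⟩ : ∃ t', t' + t + 1 = F.live.ncard := ⟨F.live.ncard - t - 1, by omega⟩
  let e := s.orderIsoOfFin hs
  let i₀ : Fin F.live.ncard := ⟨t', by omega⟩
  obtain ⟨q₀, hq₀, hkey⟩ := Finset.mem_image.mp (e i₀).2
  refine ⟨q₀, Set.mem_toFinset.mp hq₀, ?_⟩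
  have h1 : F.key '' (F.live ∩ {q | F.key q₀ < F.key q}) =
      (fun i => (e i : ℤ ×ₗ ℤ)) '' (Set.Ioi i₀) := by
    ext z
    constructor
    · rintro ⟨q, ⟨hq, hlt⟩, rfl⟩
      have hmem : F.key q ∈ s := Finset.mem_image_of_mem _ (Set.mem_toFinset.mpr hq)
      refine ⟨e.symm ⟨_, hmem⟩, ?_, by simp⟩
      rw [Set.mem_Ioi, OrderIso.lt_symm_apply, ← Subtype.coe_lt_coe, ← hkey]
      exact hlt
    · rintro ⟨i, hi, rfl⟩
      obtain ⟨q, hq, hqi⟩ := Finset.mem_image.mp (e i).2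
      refine ⟨q, ⟨Set.mem_toFinset.mp hq, ?_⟩, hqi⟩
      rw [Set.mem_ofPred_eq, hqi, hkey, Subtype.coe_lt_coe]
      exact e.strictMono hi
  have hinj : Function.Injective fun i => (e i : ℤ ×ₗ ℤ) := Subtype.val_injective.comp e.injective
  rw [← Set.ncard_image_of_injective _ F.key_injective, h1, Set.ncard_image_of_injective _ hinj,
    ← Finset.coe_Ioi, Set.ncard_coe_finset, Fin.card_Ioi]
  simp only [i₀]
  omega

variable [DecidableEq ι]

section root

variable {R : Type*} [CommRing R]

/-- The element of the Lie algebra with entry `x` at the position `(i, j)`, and the entry that this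
enforces at the position `(σ j, σ i)`; the two positions coincide if `j = σ i`. -/
def rootElement (i j : ι) (x : R) : Matrix ι ι R := Matrix.of fun a b =>
  if a = i ∧ b = j then x
  else if a = F.σ j ∧ b = F.σ i then -((F.s i * F.s j : ℤ) * x) else 0

variable {F}

theorem rootElement_eq_zero {i j : ι} {x : R} {a b : ι} (h1 : ¬ (a = i ∧ b = j))
    (h2 : ¬ (a = F.σ j ∧ b = F.σ i)) : F.rootElement i j x a b = 0 := by
  simp [rootElement, h1, h2]

theorem rootElement_self (i j : ι) (x : R) : F.rootElement i j x i j = x := by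
  simp [rootElement]

/-- The only product of two entries that does not vanish belongs to the path `i → j = σ j → σ i`. -/
theorem rootElement_mul_eq_zero {i j : ι} (hij : i ≠ j) (hq : (i, j) ∈ F.live) (x : R) {a c b : ι}
    (h : ¬ (a = i ∧ c = j ∧ j = F.σ j ∧ b = F.σ i)) :
    F.rootElement i j x a c * F.rootElement i j x c b = 0 := by
  have h1 := F.σ_ne_self_of_live hij hq
  have h2 : F.σ i ≠ F.σ j := fun h => hij (F.σ_injective h)
  by_contra hne
  have e1 : (a = i ∧ c = j) ∨ (a = F.σ j ∧ c = F.σ i) := by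
    by_contra h'
    rw [not_or] at h'
    exact hne (by rw [rootElement_eq_zero h'.1 h'.2, zero_mul])
  have e2 : (c = i ∧ b = j) ∨ (c = F.σ j ∧ b = F.σ i) := by
    by_contra h'
    rw [not_or] at h'
    exact hne (by rw [rootElement_eq_zero h'.1 h'.2, mul_zero])
  grind

theorem rootElement_eq_zero_of_key_lt {q₀ : ι × ι} {i j : ι} (hq : (i, j) ∈ F.live)
    (h0 : ¬ F.key (i, j) < F.key q₀) (x : R) {q : ι × ι} (hlt : F.key q < F.key q₀) :
    F.rootElement i j x q.1 q.2 = 0 := by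
  refine rootElement_eq_zero ?_ ?_
  · rintro ⟨h1, h2⟩
    exact h0 (by rwa [← h1, ← h2])
  · rintro ⟨h1, h2⟩
    refine F.not_key_swap_lt hq (lt_of_lt_of_le ?_ (not_lt.mp h0))
    rwa [← h1, ← h2]

theorem rootElement_eq_zero_of_live {i j : ι} (hq : (i, j) ∈ F.live) (x : R) {q : ι × ι}
    (hq' : q ∈ F.live) (hne : q ≠ (i, j)) : F.rootElement i j x q.1 q.2 = 0 := by
  have h1 : ¬ (q.1 = i ∧ q.2 = j) := fun h => hne (Prod.ext h.1 h.2)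
  refine rootElement_eq_zero h1 ?_
  rintro ⟨h2, h3⟩
  have h4 := F.live_swap hq (by rwa [← h2, ← h3])
  exact h1 ⟨by rw [h2, h4.1, F.σ_σ], by rw [h3, h4.1]⟩

variable [Fintype ι]

theorem rootElement_transpose_mul {i j : ι} (hq : j = F.σ i → F.ε = -1) (x : R) :
    (F.rootElement i j x)ᵀ * F.form R = -(F.form R * F.rootElement i j x) := by
  ext a b
  rw [Matrix.neg_apply, mul_form_apply, form_mul_apply, Matrix.transpose_apply]
  have e1 : F.σ b = i ↔ b = F.σ i := ⟨fun h => by rw [← h, F.σ_σ], fun h => by rw [h, F.σ_σ]⟩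
  have e2 : F.σ a = i ↔ a = F.σ i := ⟨fun h => by rw [← h, F.σ_σ], fun h => by rw [h, F.σ_σ]⟩
  have e3 : F.σ b = F.σ j ↔ b = j := F.σ_injective.eq_iff
  have e4 : F.σ a = F.σ j ↔ a = j := F.σ_injective.eq_iff
  simp only [rootElement, Matrix.of_apply, e1, e2, e3, e4]
  have hs := F.s_mul_s_cast (R := R)
  have hε := congrArg (Int.cast : ℤ → R) F.ε_mul_ε
  push_cast at hε
  by_cases hji : j = F.σ i
  · subst hji
    have := hq rfl
    by_cases ha : a = F.σ i <;> by_cases hb : b = F.σ i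
    · subst ha hb
      simp only [F.σ_σ, and_self, if_true]
      rw [F.s_σ, this]; push_cast; ring
    · simp [hb]
    · simp [ha]
    · simp [ha, hb]
  · by_cases ha : a = F.σ i
    · have ha' : a ≠ j := fun h => hji (by rw [← h, ha])
      by_cases hb : b = j
      · subst hb ha
        simp only [hji, ha', if_false, if_true, and_self]
        rw [F.s_σ, F.s_σ]; push_cast
        linear_combination -(F.s i : R) * F.ε * x * hs b
      · simp [ha', hb]
    · by_cases ha' : a = j
      · by_cases hb : b = F.σ i
        · subst hb ha'
          simp only [ha, F.σ_σ, false_and, if_false, if_true, and_self]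
          push_cast
          linear_combination -(F.s i : R) * x * hs a
        · simp [ha, hb]
      · simp [ha, ha']

theorem rootElement_cube {i j : ι} (hij : i ≠ j) (hq : (i, j) ∈ F.live) (x : R) :
    F.rootElement i j x * F.rootElement i j x * F.rootElement i j x = 0 := by
  have h1 := F.σ_ne_self_of_live hij hq
  ext a b
  rw [Matrix.mul_apply]
  refine Finset.sum_eq_zero fun c _ => ?_
  rw [Matrix.mul_apply, Finset.sum_mul]
  refine Finset.sum_eq_zero fun d _ => ?_
  by_cases h : a = i ∧ d = j ∧ j = F.σ j ∧ c = F.σ i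
  · rw [mul_assoc, rootElement_mul_eq_zero hij hq x, mul_zero]
    exact fun h' => hij (h'.1.symm.trans h.2.1)
  · rw [rootElement_mul_eq_zero hij hq x h, zero_mul]

theorem exists_smul_rootElement_sq (h2 : F.ε = 1 → IsUnit (2 : R)) {i j : ι} (hij : i ≠ j)
    (hq : (i, j) ∈ F.live) : ∃ c : R, ∀ x : R,
      (2 * c - 1) • (F.rootElement i j x * F.rootElement i j x) = 0 := by
  rcases F.ε_eq with h | h
  · obtain ⟨c, hc⟩ := (h2 h).exists_right_inv
    exact ⟨c, fun x => by rw [hc, sub_self, zero_smul]⟩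
  · refine ⟨0, fun x => ?_⟩
    have : F.rootElement i j x * F.rootElement i j x = 0 := by
      ext a b
      rw [Matrix.mul_apply]
      refine Finset.sum_eq_zero fun c _ => rootElement_mul_eq_zero hij hq x ?_
      rintro ⟨-, -, h1, -⟩
      have := F.h_σ j
      rw [← h1] at this
      exact F.h_ne_zero h j (by omega)
    rw [this, smul_zero]

end root

section growth

variable {p : ℕ} {M : Set ℕ} {q₀ : ι × ι} {F} [Fintype ι]

open scoped Classical in
variable (F) in
/-- The positions at which the leading coefficient in degree `k` of an element of the subgroup is
arbitrary. -/
noncomputable def stepPositions (M : Set ℕ) (p : ℕ) (q₀ : ι × ι) (k : ℕ) : Finset (ι × ι) :=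
  Finset.univ.filter fun q =>
    q ∈ F.live ∧ (F.key q₀ < F.key q ∨ q = q₀ ∧ k ∈ powMultiples p M)

theorem mem_stepPositions {k : ℕ} {q : ι × ι} : q ∈ F.stepPositions M p q₀ k ↔
    q ∈ F.live ∧ (F.key q₀ < F.key q ∨ q = q₀ ∧ k ∈ powMultiples p M) := by
  simp [stepPositions]

open scoped Classical in
theorem card_stepPositions (h0 : q₀ ∈ F.live) {k : ℕ} : (F.stepPositions M p q₀ k).card =
    (F.live ∩ {q | F.key q₀ < F.key q}).ncard + if k ∈ powMultiples p M then 1 else 0 := by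
  rw [Set.ncard_eq_toFinset_card']
  split_ifs with hk
  · rw [← Finset.card_insert_of_notMem (a := q₀) (by simp)]
    congr 1
    ext q
    simp only [mem_stepPositions, hk, and_true, Finset.mem_insert, Set.mem_toFinset, Set.mem_inter_iff,
      Set.mem_ofPred_eq]
    constructor
    · rintro ⟨h1, h2 | h2⟩
      · exact Or.inr ⟨h1, h2⟩
      · exact Or.inl h2
    · rintro (rfl | ⟨h1, h2⟩)
      · exact ⟨h0, Or.inr rfl⟩
      · exact ⟨h1, Or.inl h2⟩
  · rw [add_zero]
    congr 1
    ext q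
    simp [mem_stepPositions, hk]

variable [Fact p.Prime]

/-- The coefficient of `g - 1` in degree `k` at the position `q`. -/
noncomputable def entryCoeff (k : ℕ) (g : isometryGroup (F.form (ZMod p)⟦X⟧)) (q : ι × ι) : ZMod p :=
  PowerSeries.coeff k
    ((g : GL ι (ZMod p)⟦X⟧).val q.1 q.2 - (1 : Matrix ι ι (ZMod p)⟦X⟧) q.1 q.2)

/-- Elements with a single nontrivial leading coefficient at a live position off the diagonal. -/
theorem exists_offDiag_mem (h2 : F.ε = 1 → IsUnit (2 : (ZMod p)⟦X⟧)) (h0 : q₀ ∈ F.live) {k : ℕ}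
    (hk : 0 < k) {i j : ι} (hij : i ≠ j) (hq : (i, j) ∈ F.live)
    (hkey : F.key q₀ < F.key (i, j) ∨ (i, j) = q₀ ∧ k ∈ powMultiples p M) :
    ∃ g ∈ congruenceSubgroup _ k, g ∈ F.stepSubgroup p M q₀ h0.1 ∧
      ∀ q' ∈ F.live, entryCoeff k g q' = if q' = (i, j) then 1 else 0 := by
  set x : (ZMod p)⟦X⟧ := PowerSeries.X ^ k
  obtain ⟨c, hc⟩ := exists_smul_rootElement_sq h2 hij hq
  set N := F.rootElement i j x
  have hle : ¬ F.key (i, j) < F.key q₀ := by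
    rcases hkey with h | ⟨h, -⟩
    · exact h.not_gt
    · rw [h]; exact lt_irrefl _
  obtain ⟨g, hg⟩ := F.exists_isometry (Matrix.isometry_one_add
    (rootElement_transpose_mul (fun hji => (F.live_swap hq (by rwa [hji, F.σ_σ, ← hji])).2) x)
    (rootElement_cube hij hq x) (hc x))
  have hg' : ∀ a b, (g : GL ι (ZMod p)⟦X⟧).val a b - (1 : Matrix ι ι (ZMod p)⟦X⟧) a b =
      N a b + c * (N * N) a b := by
    intro a b
    rw [hg, Matrix.add_apply, Matrix.add_apply, Matrix.smul_apply, smul_eq_mul]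
    ring
  have hN : ∀ a b, PowerSeries.X ^ k ∣ N a b := by
    intro a b
    simp only [N, rootElement, Matrix.of_apply]
    split_ifs
    · exact dvd_rfl
    · exact (dvd_mul_left _ _).neg_right
    · exact dvd_zero _
  have hN2 : ∀ a b, PowerSeries.coeff k (c * (N * N) a b) = 0 := by
    intro a b
    rw [Matrix.mul_apply, Finset.mul_sum, map_sum]
    refine Finset.sum_eq_zero fun d _ => ?_
    rw [← mul_assoc]
    exact coeff_mul_of_X_pow_dvd hk ((hN a d).mul_left c) (hN d b)
  have hNlt : ∀ q, F.key q < F.key q₀ → N q.1 q.2 = 0 := fun q hlt =>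
    rootElement_eq_zero_of_key_lt hq hle x hlt
  have hNii : ∀ a, N a a = 0 := by
    intro a
    refine rootElement_eq_zero ?_ ?_
    · rintro ⟨rfl, rfl⟩; exact hij rfl
    · rintro ⟨h1, h2⟩
      exact hij (F.σ_injective (h2.symm.trans h1))
  have hNle : ∀ q, F.key q ≤ F.key q₀ → (N * N) q.1 q.2 = 0 := by
    intro q hle
    rw [mul_apply_of_key_le h0.1 hNlt hNlt hle]
    split_ifs with h
    · rw [h, hNii, zero_mul]
    · rfl
  have hmem : g ∈ congruenceSubgroup _ k := by
    rw [mem_congruenceSubgroup]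
    intro a b
    rw [hg']
    refine dvd_add (hN a b) ((Finset.dvd_sum fun d _ => ?_).mul_left c)
    exact (hN a d).mul_right _
  refine ⟨g, hmem, ⟨congruenceSubgroup_antitone hk hmem, fun q hlt => ?_, ?_⟩, fun q' hq' => ?_⟩
  · rw [Matrix.sub_apply, hg', hNlt q hlt, hNle q hlt.le, mul_zero, add_zero]
  · have h3 := hg' q₀.1 q₀.2
    rw [hNle q₀ le_rfl, mul_zero, add_zero, sub_eq_iff_eq_add] at h3
    rw [h3]
    by_cases h4 : q₀ = (i, j)
    · have h5 : k ∈ powMultiples p M := by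
        rcases hkey with h | ⟨-, h⟩
        · rw [h4] at h; exact absurd h (lt_irrefl _)
        · exact h
      rw [h4, EntryCondition, if_neg hij]
      intro l hl
      have h6 : l ≠ k := fun h => hl (h ▸ h5)
      rw [Matrix.one_apply_ne hij, add_zero]
      simp only [N, rootElement_self, x]
      rw [PowerSeries.coeff_X_pow, if_neg h6]
    · simp only [N]
      rw [rootElement_eq_zero_of_live hq x h0 h4, zero_add]
      exact entryCondition_one
  · rw [entryCoeff, hg', map_add, hN2, add_zero]
    split_ifs with h
    · rw [h]
      simp [N, rootElement_self, x]
    · simp only [N]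
      rw [rootElement_eq_zero_of_live hq x hq' h, map_zero]

/-- Elements with a single nontrivial leading coefficient at a live position on the diagonal: the
entry `1 + t ^ k` at `i` and its inverse at `σ i`. -/
theorem exists_diag_mem (h0 : q₀ ∈ F.live) {k : ℕ} (hk : 0 < k) {i : ι} (hq : (i, i) ∈ F.live)
    (hkey : F.key q₀ < F.key (i, i) ∨ (i, i) = q₀ ∧ k ∈ powMultiples p M) :
    ∃ g ∈ congruenceSubgroup _ k, g ∈ F.stepSubgroup p M q₀ h0.1 ∧
      ∀ q' ∈ F.live, entryCoeff k g q' = if q' = (i, i) then 1 else 0 := by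
  have hσ : F.σ i ≠ i := by
    intro h
    have h1 := F.live_swap hq (by rwa [h])
    have h2 := F.h_σ i
    rw [h] at h2
    exact F.h_ne_zero h1.2 i (by omega)
  have hu : IsUnit (1 + PowerSeries.X ^ k : (ZMod p)⟦X⟧) := by
    rw [PowerSeries.isUnit_iff_constantCoeff]
    simp [hk.ne']
  obtain ⟨v, hv⟩ := hu.exists_right_inv
  set D : ι → (ZMod p)⟦X⟧ := fun a =>
    if a = i then 1 + PowerSeries.X ^ k else if a = F.σ i then v else 1
  have hDi : D i = 1 + PowerSeries.X ^ k := if_pos rfl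
  have hDσ : D (F.σ i) = v := by simp [D, hσ]
  have hD1 : ∀ a, a ≠ i → a ≠ F.σ i → D a = 1 := fun a h h' => by
    simp only [D]; rw [if_neg h, if_neg h']
  have hDD : ∀ a, D a * D (F.σ a) = 1 := by
    intro a
    by_cases h : a = i
    · rw [h, hDi, hDσ, hv]
    · by_cases h' : a = F.σ i
      · rw [h', F.σ_σ, hDi, hDσ, mul_comm, hv]
      · rw [hD1 a h h', hD1 _ (fun e => h' (by rw [← e, F.σ_σ]))
          (fun e => h (F.σ_injective e)), one_mul]
  obtain ⟨g, hg⟩ := F.exists_isometry (A := Matrix.diagonal D) (by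
    ext a b
    rw [Matrix.diagonal_transpose, Matrix.mul_diagonal, Matrix.diagonal_mul, form, Matrix.of_apply]
    split_ifs with h
    · rw [h, mul_right_comm, hDD, one_mul]
    · rw [mul_zero, zero_mul])
  have hD : ∀ a, PowerSeries.X ^ k ∣ D a - 1 := by
    intro a
    simp only [D]
    split_ifs
    · rw [add_sub_cancel_left]
    · exact ⟨-v, by linear_combination hv⟩
    · rw [sub_self]; exact dvd_zero _
  have hg' : ∀ a b, (g : GL ι (ZMod p)⟦X⟧).val a b - (1 : Matrix ι ι (ZMod p)⟦X⟧) a b =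
      if a = b then D a - 1 else 0 := by
    intro a b
    rw [hg, Matrix.diagonal_apply, Matrix.one_apply]
    split_ifs <;> simp
  -- the second nontrivial entry stands at a position that is not live
  have hlive : ∀ q ∈ F.live, q ≠ (i, i) →
      (g : GL ι (ZMod p)⟦X⟧).val q.1 q.2 - (1 : Matrix ι ι (ZMod p)⟦X⟧) q.1 q.2 = 0 := by
    rintro ⟨a, b⟩ hq' hne
    rw [hg']
    split_ifs with hab
    · simp only at hab
      subst hab
      rw [hD1 a (fun h => hne (by rw [h])), sub_self]
      rintro rfl
      exact hne (by rw [← (F.live_swap hq hq').1])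
    · rfl
  have hmem : g ∈ congruenceSubgroup _ k := by
    rw [mem_congruenceSubgroup]
    intro a b
    rw [hg']
    split_ifs
    · exact hD a
    · exact dvd_zero _
  refine ⟨g, hmem, ⟨congruenceSubgroup_antitone hk hmem, fun q hlt => ?_, ?_⟩, fun q' hq' => ?_⟩
  · have hle : ¬ F.key (i, i) < F.key q₀ := by
      rcases hkey with h | ⟨h, -⟩
      · exact h.not_gt
      · rw [h]; exact lt_irrefl _
    obtain ⟨a, b⟩ := q
    rw [Matrix.sub_apply, hg']
    split_ifs with hab
    · simp only at hab
      subst hab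
      rw [hD1 a, sub_self]
      · rintro rfl
        exact hle hlt
      · rintro rfl
        exact F.not_key_swap_lt hq (hlt.trans_le (not_lt.mp hle))
    · rfl
  · by_cases h4 : q₀ = (i, i)
    · have h5 : k ∈ powMultiples p M := by
        rcases hkey with h | ⟨-, h⟩
        · rw [h4] at h; exact absurd h (lt_irrefl _)
        · exact h
      rw [h4, EntryCondition, if_pos rfl, hg, Matrix.diagonal_apply_eq, hDi]
      exact .one_add_X_pow h5
    · rw [sub_eq_zero.mp (hlive q₀ h0 h4)]
      exact entryCondition_one
  · rw [entryCoeff]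
    split_ifs with h
    · rw [h, hg', if_pos rfl, hDi]
      simp
    · rw [hlive q' hq' h, map_zero]

/-- Leading coefficients satisfy the linear equations of the Lie algebra. -/
theorem entryCoeff_relation {k : ℕ} (hk : 0 < k) {g : isometryGroup (F.form (ZMod p)⟦X⟧)}
    (hg : g ∈ congruenceSubgroup _ k) (a b : ι) :
    F.s (F.σ b) * entryCoeff k g (F.σ b, a) + F.s a * entryCoeff k g (F.σ a, b) = 0 := by
  have h := congrArg (PowerSeries.coeff k) (F.isometry_relation g a b)
  rw [mem_congruenceSubgroup] at hg
  have h1 : PowerSeries.coeff k ((((g : GL ι (ZMod p)⟦X⟧).val - 1)ᵀ *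
      (F.form (ZMod p)⟦X⟧ * ((g : GL ι (ZMod p)⟦X⟧).val - 1)) : Matrix ι ι (ZMod p)⟦X⟧) a b) =
      0 := by
    rw [Matrix.mul_apply, map_sum]
    refine Finset.sum_eq_zero fun c _ => ?_
    rw [form_mul_apply]
    exact coeff_mul_of_X_pow_dvd hk (hg c a) ((hg _ b).mul_left _)
  rw [map_add, map_add, h1, add_zero, map_zero] at h
  have h2 : ∀ (n : ℤ) (x : (ZMod p)⟦X⟧), PowerSeries.coeff k ((n : (ZMod p)⟦X⟧) * x) =
      (n : ZMod p) * PowerSeries.coeff k x := by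
    intro n x
    rw [← zsmul_eq_mul, map_zsmul, zsmul_eq_mul]
  rwa [h2, h2] at h

/-- The leading coefficients in degree `k` at the positions of `stepPositions` are arbitrary and
determine the others: at the remaining live positions they vanish, and the relation between the
positions `(i, j)` and `(σ j, σ i)` settles those that are not live. -/
theorem relIndex_step (h2 : F.ε = 1 → IsUnit (2 : (ZMod p)⟦X⟧)) (hM : ∀ m ∈ M, ¬ p ∣ m)
    (h0 : q₀ ∈ F.live) {k : ℕ} (hk : 0 < k) :
    (congruenceSubgroup _ (k + 1)).relIndex
      (congruenceSubgroup _ k ⊓ F.stepSubgroup p M q₀ h0.1) =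
        p ^ (F.stepPositions M p q₀ k).card := by
  refine relIndex_congruenceSubgroup_succ hk _ _ ?_ ?_
  · intro g hg hgH hz a b
    have hgk := mem_congruenceSubgroup.mp hg
    have hlow : ∀ q, F.key q < F.key q₀ → entryCoeff k g q = 0 := by
      intro q hq
      have := hgH.2.1 q hq
      rw [entryCoeff, ← Matrix.sub_apply, this, map_zero]
    have hlive : ∀ q ∈ F.live, entryCoeff k g q = 0 := by
      intro q hq
      by_cases h : q ∈ F.stepPositions M p q₀ k
      · exact hz q h
      · rcases lt_trichotomy (F.key q) (F.key q₀) with h1 | h1 | h1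
        · exact hlow q h1
        · have h3 := F.key_injective h1
          subst h3
          refine hgH.2.2.coeff_eq_zero hM (fun h4 => h ?_) (hgk _ _)
          exact mem_stepPositions.mpr ⟨hq, Or.inr ⟨rfl, h4⟩⟩
        · exact absurd (mem_stepPositions.mpr ⟨hq, Or.inl h1⟩) h
    change entryCoeff k g (a, b) = 0
    by_cases hab : F.h b < F.h a
    · refine hlow _ (F.key_lt.mpr (Or.inl ?_))
      have := h0.1
      simp only
      omega
    by_cases hl : (a, b) ∈ F.live
    · exact hlive _ hl
    have hrel := entryCoeff_relation hk hg (F.σ a) b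
    rw [F.σ_σ] at hrel
    have hs : ∀ i, (F.s i : ZMod p) * F.s i = 1 := fun i => F.s_mul_s_cast i
    have hsne : (F.s (F.σ a) : ZMod p) ≠ 0 := left_ne_zero_of_mul_eq_one (hs _)
    by_cases hsum : F.h a + F.h b = 0
    · have hb : b = F.σ a := F.h_injective (by rw [F.h_σ]; omega)
      have hε : F.ε = 1 := by
        rcases F.ε_eq with h | h
        · exact h
        · exact absurd ⟨not_lt.mp hab, Or.inr ⟨hsum, h⟩⟩ hl
      subst hb
      rw [F.σ_σ, F.s_σ, hε, one_mul, ← two_mul] at hrel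
      have h2' : (2 : ZMod p) ≠ 0 := by
        have := (h2 hε).map (PowerSeries.constantCoeff (R := ZMod p))
        rw [map_ofNat] at this
        exact this.ne_zero
      rw [F.s_σ, hε, one_mul] at hsne
      exact (mul_eq_zero.mp ((mul_eq_zero.mp hrel).resolve_left h2')).resolve_left hsne
    · have hswap : (F.σ b, F.σ a) ∈ F.live := by
        simp only [live, Set.mem_ofPred_eq, F.h_σ, not_and, not_or, not_lt] at hl hab ⊢
        have := (hl hab).1
        exact ⟨by omega, Or.inl (by omega)⟩
      rw [hlive _ hswap, mul_zero, zero_add] at hrel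
      exact (mul_eq_zero.mp hrel).resolve_left hsne
  · rintro ⟨i, j⟩ hq
    obtain ⟨hl, hkey⟩ := mem_stepPositions.mp hq
    by_cases hij : i = j
    · subst hij
      obtain ⟨g, h1, h3, h4⟩ := exists_diag_mem h0 hk hl hkey
      exact ⟨g, h1, h3, fun q' hq' => h4 q' (mem_stepPositions.mp hq').1⟩
    · obtain ⟨g, h1, h3, h4⟩ := exists_offDiag_mem h2 h0 hk hij hl hkey
      exact ⟨g, h1, h3, fun q' hq' => h4 q' (mem_stepPositions.mp hq').1⟩

end growth

section spectrum

variable [Fintype ι]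

/-- The isometry group of an antidiagonal form has subgroups of every growth rate up to the number
of live positions. -/
theorem exists_hasIndexGrowth {p : ℕ} [Fact p.Prime] (h2 : F.ε = 1 → IsUnit (2 : (ZMod p)⟦X⟧))
    {t : ℕ} (ht : t < F.live.ncard) {θ : ℝ} (h0 : 0 ≤ θ) (h1 : θ ≤ 1) :
    ∃ (H : Subgroup (isometryGroup (F.form (ZMod p)⟦X⟧))) (a : ℕ → ℕ), HasIndexGrowth H a ∧
      Tendsto (fun k : ℕ => (a k : ℝ) / k) atTop (𝓝 (t + θ)) := by
  classical
  obtain ⟨q₀, hq₀, hcard⟩ := F.exists_live_ncard_eq ht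
  obtain ⟨M, hM, hlim⟩ := exists_powMultiples_density (Fact.out : p.Prime).one_lt h0 h1
  refine ⟨F.stepSubgroup p M q₀ hq₀.1, _, ⟨F.mem_stepSubmonoid_of_closed (h0 := hq₀.1),
    relIndex_congruenceSubgroup_of_step (F.stepSubgroup_le p M q₀ hq₀.1) _ fun j hj =>
      relIndex_step h2 hM hq₀ hj⟩, ?_⟩
  rw [← tendsto_add_atTop_iff_nat 1]
  have h3 : ∀ x : ℕ, ((∑ j ∈ Finset.Ico 1 (x + 1), (F.stepPositions M p q₀ j).card : ℕ) : ℝ) =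
      t * x + ((Finset.range x).filter fun j => j + 1 ∈ powMultiples p M).card := by
    intro x
    simp only [card_stepPositions hq₀, hcard]
    rw [Finset.sum_add_distrib, Finset.sum_Ico_eq_sum_range, Finset.sum_Ico_eq_sum_range,
      Finset.card_filter]
    simp [add_comm 1, mul_comm]
  have h4 : Tendsto (fun x : ℕ => (x : ℝ) / (x + 1 : ℕ)) atTop (𝓝 1) := by
    have := (tendsto_natCast_add_div 1).inv₀ one_ne_zero
    rw [inv_one] at this
    exact this.congr fun x => inv_div _ _
  have h5 := (hlim.const_add (t : ℝ)).mul h4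
  rw [mul_one] at h5
  refine h5.congr' ?_
  filter_upwards [eventually_gt_atTop 0] with x hx
  rw [h3]
  have : (x : ℝ) ≠ 0 := by positivity
  field_simp

end spectrum

end AntidiagonalForm

/-! ### Charts, dimensions, and characteristic two -/

namespace AntidiagonalForm

variable {ι : Type} (F : AntidiagonalForm ι)

/-- The positions at which a matrix `W` with `W + ε Wᵀ = 0` can be prescribed: those strictly above
the diagonal, and for `ε = -1`, where `W` is symmetric, also the diagonal ones. -/
def coords : Set (ι × ι) := {q | F.h q.1 < F.h q.2 ∨ (F.h q.1 = F.h q.2 ∧ F.ε = -1)}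

section chart

variable [DecidableEq ι] {R : Type*} [CommRing R]

/-- The part of an alternating form in the rows of negative height. -/
def upperHalf (R : Type*) [CommRing R] : Matrix ι ι R :=
  Matrix.of fun i j => if F.h i < 0 then F.form R i j else 0

variable {F}

theorem upperHalf_sub_transpose (hε : F.ε = -1) :
    F.upperHalf R - (F.upperHalf R)ᵀ = F.form R := by
  ext i j
  have hT := congrFun₂ (F.transpose_form (R := R)) i j
  rw [hε, neg_smul, one_smul, Matrix.transpose_apply, Matrix.neg_apply] at hT
  simp only [upperHalf, Matrix.sub_apply, Matrix.transpose_apply, Matrix.of_apply, hT]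
  have hi := F.h_ne_zero hε i
  by_cases hij : j = F.σ i
  · have hj : F.h j = -F.h i := by rw [hij, F.h_σ]
    rcases lt_or_gt_of_ne hi with h | h
    · rw [if_pos h, if_neg (by omega), sub_zero]
    · rw [if_neg (by omega), if_pos (by omega), zero_sub, neg_neg]
  · have : F.form R i j = 0 := by simp [form, hij]
    simp [this]

variable [Fintype ι]

theorem upperHalf_mul_self : F.upperHalf R * F.upperHalf R = 0 := by
  ext i j
  rw [Matrix.mul_apply]
  refine Finset.sum_eq_zero fun c _ => ?_
  simp only [upperHalf, form, Matrix.of_apply]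
  split_ifs with h1 h2 h3
  · rw [h2, F.h_σ] at h3
    omega
  all_goals simp

/-- The base point of a Cayley chart: half the form in the symmetric case; in the alternating case
`1 + U` with `U` half of the entries of the form, where `U ^ 2 = 0`. -/
theorem exists_add_transpose (h2 : F.ε = 1 → IsUnit (2 : R)) :
    ∃ M : Matrix ι ι R, M + F.ε • Mᵀ = F.form R ∧ IsUnit M.det := by
  rcases F.ε_eq with h | h
  · obtain ⟨c, hc⟩ := (h2 h).exists_right_inv
    refine ⟨c • F.form R, ?_, ?_⟩
    · rw [Matrix.transpose_smul, F.transpose_form, h, one_smul, one_smul, ← add_smul, ← two_mul,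
        hc, one_smul]
    · rw [Matrix.det_smul]
      exact ((IsUnit.of_mul_eq_one_right _ hc).pow _).mul F.isUnit_det_form
  · refine ⟨1 + F.upperHalf R, ?_, ?_⟩
    · rw [← upperHalf_sub_transpose h, h, Matrix.transpose_add, Matrix.transpose_one, neg_smul,
        one_smul]
      abel
    · refine Matrix.isUnit_det_of_right_inverse (B := 1 - F.upperHalf R) ?_
      rw [Matrix.add_mul, Matrix.mul_sub, Matrix.mul_sub, upperHalf_mul_self]
      simp

variable (F)

/-- The Cayley type chart of the isometry group of an antidiagonal form. -/
noncomputable def cayleyDatum (p : ℕ) (h2 : F.ε = 1 → IsUnit (2 : (ZMod p)⟦X⟧)) :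
    CayleyDatum p ι F.coords.ncard where
  ε := F.ε
  J := F.form _
  M₀ := (exists_add_transpose h2).choose
  C := F.coords
  e := (Finite.equivFin F.coords).symm
  ε_mul_ε := F.ε_mul_ε
  transpose_J := F.transpose_form
  M₀_add := (exists_add_transpose h2).choose_spec.1
  isUnit_det_J := F.isUnit_det_form
  isUnit_det_M₀ := (exists_add_transpose h2).choose_spec.2
  eq_of_mem {j k} h h' := by
    simp only [coords, Set.mem_ofPred_eq] at h h'
    exact ⟨F.h_injective (by omega), by omega⟩
  mem_or j k := by
    simp only [coords, Set.mem_ofPred_eq]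
    rcases lt_trichotomy (F.h j) (F.h k) with h | h | h
    · exact Or.inl (Or.inl h)
    · rcases F.ε_eq with hε | hε
      · exact Or.inr (Or.inr ⟨F.h_injective h, hε, h2 hε⟩)
      · exact Or.inl (Or.inr ⟨h, hε⟩)
    · exact Or.inr (Or.inl (Or.inl h))

end chart

section count

variable [Fintype ι]

open Finset in
theorem card_filter_h_eq : #{q : ι × ι | F.h q.1 = F.h q.2} = Fintype.card ι := by
  rw [← card_univ]
  exact (card_bij' (fun i _ => (i, i)) (fun q _ => q.1) (by simp) (by simp) (by simp)
    (by simp only [mem_filter, mem_univ, true_and]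
        exact fun q hq => Prod.ext rfl (F.h_injective hq))).symm

open Finset in
theorem two_mul_card_filter_h_lt :
    2 * #{q : ι × ι | F.h q.1 < F.h q.2} + Fintype.card ι = Fintype.card ι ^ 2 := by
  classical
  have hlt : #{q : ι × ι | F.h q.1 < F.h q.2} = #{q : ι × ι | F.h q.2 < F.h q.1} :=
    card_bij' (fun q _ => q.swap) (fun q _ => q.swap) (by simp) (by simp) (by simp) (by simp)
  have htot : #{q : ι × ι | F.h q.1 < F.h q.2} + (#{q : ι × ι | F.h q.1 = F.h q.2} +
      #{q : ι × ι | F.h q.2 < F.h q.1}) = Fintype.card ι ^ 2 := by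
    rw [sq, ← Fintype.card_prod, ← card_univ, ← card_union_of_disjoint, ← card_union_of_disjoint]
    · congr 1
      ext q
      simp only [mem_union, mem_filter, mem_univ, true_and, iff_true]
      omega
    · simp only [disjoint_left, mem_union, mem_filter, mem_univ, true_and]
      omega
    · simp only [disjoint_left, mem_filter, mem_univ, true_and]
      omega
  rw [F.card_filter_h_eq] at htot
  omega

open Finset in
theorem two_mul_ncard_coords :
    2 * (F.coords.ncard : ℤ) = (Fintype.card ι : ℤ) ^ 2 - F.ε * Fintype.card ι := by
  classical
  have hc : F.coords.ncard = #{q : ι × ι | F.h q.1 < F.h q.2} +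
      if F.ε = -1 then #{q : ι × ι | F.h q.1 = F.h q.2} else 0 := by
    rw [Set.ncard_eq_toFinset_card']
    split_ifs with h
    · rw [← card_union_of_disjoint]
      · congr 1
        ext q
        rw [Set.mem_toFinset]
        simp [coords, h]
      · simp only [disjoint_left, mem_filter, mem_univ, true_and]
        omega
    · rw [add_zero]
      congr 1
      ext q
      rw [Set.mem_toFinset]
      simp [coords, h]
  have htot := F.two_mul_card_filter_h_lt
  rw [hc, F.card_filter_h_eq]
  zify at htot
  rcases F.ε_eq with h | h
  · rw [if_neg (by omega), h]
    push_cast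
    linarith
  · rw [if_pos h, h]
    push_cast
    linarith

open Finset in
/-- The involution `(i, j) ↦ (σ j, σ i)` exchanges the positions of negative and of positive height
sum, so about half of the positions on or above the diagonal are live. Here `z` is the number of
fixed points of `σ`. -/
theorem four_mul_ncard_live : ∃ z : ℤ, 0 ≤ z ∧ z ≤ 1 ∧ (F.ε = -1 → z = 0) ∧
    4 * (F.live.ncard : ℤ) = (Fintype.card ι : ℤ) ^ 2 + (1 - F.ε) * Fintype.card ι - z := by
  classical
  have hpm : #{q : ι × ι | F.h q.1 ≤ F.h q.2 ∧ F.h q.1 + F.h q.2 < 0} =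
      #{q : ι × ι | F.h q.1 ≤ F.h q.2 ∧ 0 < F.h q.1 + F.h q.2} := by
    refine card_bij' (fun q _ => (F.σ q.2, F.σ q.1)) (fun q _ => (F.σ q.2, F.σ q.1)) ?_ ?_
      (by simp) (by simp)
    all_goals
      simp only [mem_filter, mem_univ, true_and, F.h_σ]
      intro q hq
      omega
  have hup : #{q : ι × ι | F.h q.1 ≤ F.h q.2 ∧ F.h q.1 + F.h q.2 < 0} +
      (#{q : ι × ι | F.h q.1 ≤ F.h q.2 ∧ F.h q.1 + F.h q.2 = 0} +
        #{q : ι × ι | F.h q.1 ≤ F.h q.2 ∧ 0 < F.h q.1 + F.h q.2}) =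
      #{q : ι × ι | F.h q.1 < F.h q.2} + #{q : ι × ι | F.h q.1 = F.h q.2} := by
    rw [← card_union_of_disjoint, ← card_union_of_disjoint, ← card_union_of_disjoint]
    · congr 1
      ext q
      simp only [mem_union, mem_filter, mem_univ, true_and]
      omega
    all_goals
      simp only [disjoint_left, mem_union, mem_filter, mem_univ, true_and]
      omega
  have hz : #{q : ι × ι | F.h q.1 ≤ F.h q.2 ∧ F.h q.1 + F.h q.2 = 0} =
      #{i | F.h i < 0} + #{i | F.h i = 0} := by
    rw [← card_union_of_disjoint]
    · refine card_bij' (fun q _ => q.1) (fun i _ => (i, F.σ i)) ?_ ?_ ?_ (by simp)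
      · simp only [mem_union, mem_filter, mem_univ, true_and]
        omega
      · simp only [mem_union, mem_filter, mem_univ, true_and, F.h_σ]
        omega
      · simp only [mem_filter, mem_univ, true_and]
        exact fun q hq => Prod.ext rfl (F.h_injective (by rw [F.h_σ]; omega))
    · simp only [disjoint_left, mem_filter, mem_univ, true_and]
      omega
  have hneg : #{i | F.h i < 0} = #{i | 0 < F.h i} := by
    refine card_bij' (fun i _ => F.σ i) (fun i _ => F.σ i) ?_ ?_ (by simp) (by simp)
    all_goals simp [F.h_σ]
  have hcard : #{i | F.h i < 0} + (#{i | F.h i = 0} + #{i | 0 < F.h i}) = Fintype.card ι := by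
    rw [← card_univ, ← card_union_of_disjoint, ← card_union_of_disjoint]
    · congr 1
      ext q
      simp only [mem_union, mem_filter, mem_univ, true_and, iff_true]
      omega
    all_goals
      simp only [disjoint_left, mem_union, mem_filter, mem_univ, true_and]
      omega
  have hl : F.live.ncard = #{q : ι × ι | F.h q.1 ≤ F.h q.2 ∧ F.h q.1 + F.h q.2 < 0} +
      if F.ε = -1 then #{q : ι × ι | F.h q.1 ≤ F.h q.2 ∧ F.h q.1 + F.h q.2 = 0} else 0 := by
    rw [Set.ncard_eq_toFinset_card']
    split_ifs with h
    · rw [← card_union_of_disjoint]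
      · congr 1
        ext q
        rw [Set.mem_toFinset]
        simp [live, h, and_or_left]
      · simp only [disjoint_left, mem_filter, mem_univ, true_and]
        omega
    · rw [add_zero]
      congr 1
      ext q
      rw [Set.mem_toFinset]
      simp [live, h]
  have htot := F.two_mul_card_filter_h_lt
  rw [F.card_filter_h_eq] at hup
  refine ⟨#{i | F.h i = 0}, by positivity, ?_, fun h => ?_, ?_⟩
  · have : #{i | F.h i = 0} ≤ 1 := by
      rw [card_le_one]
      simp only [mem_filter, mem_univ, true_and]
      exact fun a ha b hb => F.h_injective (ha.trans hb.symm)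
    exact_mod_cast this
  · simp [F.h_ne_zero h]
  · rw [hl]
    zify at htot hup hz hneg hcard hpm
    rcases F.ε_eq with h | h
    · rw [if_neg (by omega), h]
      push_cast
      linarith
    · have h0 : #{i | F.h i = 0} = 0 := by simp [F.h_ne_zero h]
      rw [if_pos h, h, h0]
      rw [h0] at hz hcard
      push_cast at hz hcard ⊢
      linarith

end count

section spectrum

variable [DecidableEq ι] [Fintype ι] {p : ℕ} [Fact p.Prime]

theorem exists_hasIndexGrowth_of_mem_Icc (h2 : F.ε = 1 → IsUnit (2 : (ZMod p)⟦X⟧))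
    (hpos : 0 < F.live.ncard) {y : ℝ} (hy : y ∈ Set.Icc (0 : ℝ) F.live.ncard) :
    ∃ (H : Subgroup (isometryGroup (F.form (ZMod p)⟦X⟧))) (a : ℕ → ℕ), HasIndexGrowth H a ∧
      Tendsto (fun k : ℕ => (a k : ℝ) / k) atTop (𝓝 y) := by
  obtain ⟨t, ht, h0, h1⟩ : ∃ t < F.live.ncard, (0 : ℝ) ≤ y - t ∧ y - t ≤ 1 := by
    rcases hy.2.lt_or_eq with h | h
    · refine ⟨⌊y⌋₊, (Nat.floor_lt hy.1).mpr h, sub_nonneg.mpr (Nat.floor_le hy.1), ?_⟩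
      linarith [Nat.lt_floor_add_one y]
    · refine ⟨F.live.ncard - 1, by omega, ?_, ?_⟩ <;> rw [h, Nat.cast_sub hpos] <;> simp
  simpa using F.exists_hasIndexGrowth h2 ht h0 h1

theorem Icc_subset_spectrum (h2 : F.ε = 1 → IsUnit (2 : (ZMod p)⟦X⟧)) (hpos : 0 < F.live.ncard)
    (hd : 0 < F.coords.ncard) : Set.Icc (0 : ℝ) (F.live.ncard / F.coords.ncard) ⊆
      standardHausdorffSpectrum (isometryGroup (F.form (ZMod p)⟦X⟧)) := by
  intro η hη
  have hd' : (0 : ℝ) < F.coords.ncard := by exact_mod_cast hd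
  obtain ⟨H, a, hH, ha⟩ := F.exists_hasIndexGrowth_of_mem_Icc h2 hpos
    (y := η * F.coords.ncard) ⟨mul_nonneg hη.1 hd'.le, (le_div_iff₀ hd').mp hη.2⟩
  exact mem_standardHausdorffSpectrum (isClosed_isometryGroup _) (F.cayleyDatum p h2).formalChart hd
    hH hη.1 ha

end spectrum

section characteristic_two

/-- An alternating form vanishes at `(v, v)`. -/
theorem sum_form_eq_zero {F : AntidiagonalForm ι} [Fintype ι] {R : Type*} [CommRing R] (hε : F.ε = -1) (v : ι → R) :
    ∑ i, v i * (F.s i * v (F.σ i)) = 0 := by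
  refine Finset.sum_involution (fun i _ => F.σ i) (fun i _ => ?_) (fun i _ _ => ?_)
    (fun i _ => Finset.mem_univ _) (fun i _ => F.σ_σ i)
  · rw [F.σ_σ, F.s_σ, hε]
    push_cast
    ring
  · intro h
    have h1 := F.h_σ i
    rw [h] at h1
    exact F.h_ne_zero hε i (by omega)

variable [DecidableEq ι] [Fintype ι] {ι' : Type} [DecidableEq ι'] [Fintype ι'] (r : ι' ≃ ι ⊕ Unit)
  {R : Type*} [CommRing R]

theorem _root_.Matrix.transpose_addFixedIndex (A : Matrix ι ι R) :
    (Matrix.addFixedIndex r R A)ᵀ = Matrix.addFixedIndex r R Aᵀ := by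
  ext i j
  rw [Matrix.transpose_apply, Matrix.addFixedIndex_apply, Matrix.addFixedIndex_apply]
  rcases r i with i | i <;> rcases r j with j | j <;> simp

theorem _root_.Matrix.addFixedIndex_injective : Function.Injective (Matrix.addFixedIndex r R) :=
  fun A B h => by
    rw [← Matrix.submatrix_addFixedIndex r A, h, Matrix.submatrix_addFixedIndex]

variable {F}

/-- The value at `(v, v)` of the sum of an alternating form and the square of a further variable is
the square of that variable, which isometries therefore fix in characteristic `2`. -/
theorem apply_eq_one_of_isometry [IsDomain R] [CharP R 2] (hε : F.ε = -1) {A : Matrix ι' ι' R}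
    (hA : Aᵀ * Matrix.addFixedIndex r R (F.form R) * A = Matrix.addFixedIndex r R (F.form R))
    (j : ι') : A (r.symm (Sum.inr ())) j = (1 : Matrix ι' ι' R) (r.symm (Sum.inr ())) j := by
  have h1 := congrFun₂ hA j j
  have h2 : (Aᵀ * Matrix.addFixedIndex r R (F.form R) * A) j j =
      A (r.symm (Sum.inr ())) j * A (r.symm (Sum.inr ())) j := by
    rw [Matrix.mul_assoc, Matrix.mul_apply, ← r.symm.sum_comp, Fintype.sum_sum_type]
    have h3 : ∀ i : ι, (Matrix.addFixedIndex r R (F.form R) * A) (r.symm (Sum.inl i)) j =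
        F.s i * A (r.symm (Sum.inl (F.σ i))) j := by
      intro i
      rw [Matrix.mul_apply, ← r.symm.sum_comp, Fintype.sum_sum_type]
      simp [Matrix.addFixedIndex_apply, form]
    have h4 : (Matrix.addFixedIndex r R (F.form R) * A) (r.symm (Sum.inr ())) j =
        A (r.symm (Sum.inr ())) j := by
      rw [Matrix.mul_apply, ← r.symm.sum_comp, Fintype.sum_sum_type]
      simp [Matrix.addFixedIndex_apply]
    simp only [h3, Matrix.transpose_apply]
    rw [sum_form_eq_zero hε fun i => A (r.symm (Sum.inl i)) j]
    simp [h4]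
  have h3 : Matrix.addFixedIndex r R (F.form R) j j =
      (1 : Matrix ι' ι' R) (r.symm (Sum.inr ())) j := by
    obtain ⟨x, rfl⟩ := r.symm.surjective j
    simp only [Matrix.addFixedIndex_apply, Matrix.one_apply, r.symm.injective.eq_iff,
      Equiv.apply_symm_apply]
    rcases x with i | i
    · have : i ≠ F.σ i := fun h => by
        have h1 := F.h_σ i
        rw [← h] at h1
        exact F.h_ne_zero hε i (by omega)
      simp [form, this]
    · simp
  rw [h2, h3] at h1
  have h4 : (1 : Matrix ι' ι' R) (r.symm (Sum.inr ())) j *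
      (1 : Matrix ι' ι' R) (r.symm (Sum.inr ())) j =
      (1 : Matrix ι' ι' R) (r.symm (Sum.inr ())) j := by
    rw [Matrix.one_apply]
    split_ifs <;> simp
  rw [← h4, mul_self_eq_mul_self_iff] at h1
  rcases h1 with h | h
  · exact h
  · rwa [CharTwo.neg_eq] at h

/-- In characteristic `2` every isometry of the sum of an alternating form and the square of a
further variable comes from an isometry of the alternating form. -/
theorem isometryGroup_addFixedIndex [IsDomain R] [CharP R 2] (hε : F.ε = -1) :
    isometryGroup (Matrix.addFixedIndex r R (F.form R)) =
      (isometryGroup (F.form R)).map (Units.map (Matrix.addFixedIndex r R)) := by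
  have key : ∀ A : Matrix ι ι R, (Matrix.addFixedIndex r R A)ᵀ *
      Matrix.addFixedIndex r R (F.form R) * Matrix.addFixedIndex r R A =
        Matrix.addFixedIndex r R (F.form R) ↔ Aᵀ * F.form R * A = F.form R := fun A => by
    rw [Matrix.transpose_addFixedIndex, ← map_mul, ← map_mul,
      (Matrix.addFixedIndex_injective r).eq_iff]
  have hsq : Matrix.addFixedIndex r R (F.form R) * Matrix.addFixedIndex r R (F.form R) = 1 := by
    rw [← map_mul]
    convert map_one (Matrix.addFixedIndex r R)
    ext a b
    rw [form_mul_apply, form, Matrix.of_apply, F.σ_σ, F.s_σ, Matrix.one_apply, hε]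
    by_cases hab : a = b
    · subst hab
      have := F.s_mul_s_cast (R := R) a
      rw [if_pos rfl, if_pos rfl]
      push_cast
      rw [neg_one_mul, CharTwo.neg_eq, this]
    · rw [if_neg (Ne.symm hab), if_neg hab, mul_zero]
  ext g
  rw [Subgroup.mem_map]
  constructor
  · intro hg
    have h1 : g.valᵀ * Matrix.addFixedIndex r R (F.form R) * g.val =
      Matrix.addFixedIndex r R (F.form R) := hg
    set K := Matrix.addFixedIndex r R (F.form R)
    set A := g.val
    -- the transposed matrix is an isometry as well
    have h2 : Aᵀᵀ * K * Aᵀ = K := by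
      have h3 : K * Aᵀ * K * A = 1 := by
        rw [Matrix.mul_assoc, Matrix.mul_assoc, ← Matrix.mul_assoc Aᵀ, h1, hsq]
      have h4 := mul_eq_one_comm.mp h3
      calc Aᵀᵀ * K * Aᵀ = A * (K * Aᵀ * K) * K := by
            rw [Matrix.transpose_transpose]
            simp only [Matrix.mul_assoc, hsq, Matrix.mul_one]
        _ = K := by rw [h4, Matrix.one_mul]
    have hrow := apply_eq_one_of_isometry r hε h1
    have hcol := apply_eq_one_of_isometry r hε h2
    have hA : Matrix.addFixedIndex r R
        (A.submatrix (r.symm ∘ Sum.inl) (r.symm ∘ Sum.inl)) = A := by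
      ext i j
      obtain ⟨x, rfl⟩ := r.symm.surjective i
      obtain ⟨y, rfl⟩ := r.symm.surjective j
      rw [Matrix.addFixedIndex_apply]
      rcases x with x | x <;> rcases y with y | y
      · simp
      · have := hcol (r.symm (Sum.inl x))
        rw [Matrix.transpose_apply] at this
        rw [this]
        simp
      · rw [hrow]
        simp
      · rw [hrow]
        simp
    rw [← hA] at h1
    obtain ⟨g', hg'⟩ := F.exists_isometry ((key _).mp h1)
    refine ⟨g', g'.2, Units.ext ?_⟩
    rw [Units.coe_map, hg']
    exact hA
  · rintro ⟨g', hg', rfl⟩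
    exact (key _).mpr hg'

end characteristic_two

end AntidiagonalForm

/-! ### The classical groups -/

namespace AntidiagonalForm

variable {ι : Type} (F : AntidiagonalForm ι) [DecidableEq ι] [Fintype ι] {p : ℕ} [Fact p.Prime]

theorem Icc_subset_spectrum_addFixedIndex [CharP (ZMod p)⟦X⟧ 2] {ι' : Type} [DecidableEq ι']
    [Fintype ι'] (r : ι' ≃ ι ⊕ Unit) (hε : F.ε = -1) (hpos : 0 < F.live.ncard)
    (hd : 0 < F.coords.ncard) : Set.Icc (0 : ℝ) (F.live.ncard / F.coords.ncard) ⊆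
      standardHausdorffSpectrum
        (isometryGroup (Matrix.addFixedIndex r (ZMod p)⟦X⟧ (F.form (ZMod p)⟦X⟧))) := by
  intro η hη
  have h2 : F.ε = 1 → IsUnit (2 : (ZMod p)⟦X⟧) := fun h => by omega
  have hd' : (0 : ℝ) < F.coords.ncard := by exact_mod_cast hd
  have hcl := isClosed_isometryGroup (Matrix.addFixedIndex r (ZMod p)⟦X⟧ (F.form (ZMod p)⟦X⟧))
  rw [isometryGroup_addFixedIndex r hε] at hcl ⊢
  obtain ⟨H, a, hH, ha⟩ := F.exists_hasIndexGrowth_of_mem_Icc h2 hpos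
    (y := η * F.coords.ncard) ⟨mul_nonneg hη.1 hd'.le, (le_div_iff₀ hd').mp hη.2⟩
  exact mem_standardHausdorffSpectrum hcl ((F.cayleyDatum p h2).formalChart.addFixedIndex r) hd
    (hH.addFixedIndex r) hη.1 ha

/-- The form defining `classicalSp`, with the heights `-n, …, -1, 1, …, n`. -/
def symplectic (n : ℕ) : AntidiagonalForm (Fin n ⊕ Fin n) where
  h := Sum.elim (fun i => (i : ℤ) - n) fun i => (i : ℤ) + 1
  σ := Sum.elim (fun i => Sum.inr i.rev) fun i => Sum.inl i.rev
  s := Sum.elim (fun _ => 1) fun _ => -1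
  ε := -1
  h_injective := by
    rintro (i | i) (j | j) h <;> simp only [Sum.elim_inl, Sum.elim_inr] at h
    · exact congrArg Sum.inl (Fin.ext (by omega))
    · omega
    · omega
    · exact congrArg Sum.inr (Fin.ext (by omega))
  h_σ := by
    rintro (i | i) <;> simp only [Sum.elim_inl, Sum.elim_inr, Fin.val_rev] <;> omega
  s_mul_s := by rintro (i | i) <;> simp
  s_σ := by rintro (i | i) <;> simp
  ε_eq := Or.inr rfl

theorem form_symplectic (R : Type*) [CommRing R] (n : ℕ) : (symplectic n).form R =
    Matrix.fromBlocks 0 (antidiagonalMatrix R n) (-antidiagonalMatrix R n) 0 := by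
  have h : ∀ i j : Fin n, i = j.rev ↔ j = i.rev := fun i j =>
    ⟨fun h => by rw [h, Fin.rev_rev], fun h => by rw [h, Fin.rev_rev]⟩
  ext (i | i) (j | j) <;> simp [form, symplectic, antidiagonalMatrix]
  split_ifs <;> simp

/-- The form defining `classicalSO`; doubled heights keep them integral for even `m`. -/
def orthogonal (m : ℕ) : AntidiagonalForm (Fin m) where
  h i := 2 * (i : ℤ) - (m - 1)
  σ := Fin.rev
  s _ := 1
  ε := 1
  h_injective i j h := Fin.ext (by simp only at h; omega)
  h_σ i := by rw [Fin.val_rev]; omega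
  s_mul_s _ := one_mul 1
  s_σ _ := (one_mul 1).symm
  ε_eq := Or.inl rfl

theorem form_orthogonal (R : Type*) [CommRing R] (m : ℕ) :
    (orthogonal m).form R = antidiagonalMatrix R m := by
  ext i j
  simp [form, orthogonal, antidiagonalMatrix]

theorem ncard_symplectic (n : ℕ) : (symplectic n).live.ncard = n * (n + 1) ∧
    (symplectic n).coords.ncard = n * (2 * n + 1) := by
  obtain ⟨z, -, -, hz, h⟩ := (symplectic n).four_mul_ncard_live
  have h' := (symplectic n).two_mul_ncard_coords
  rw [hz rfl] at h
  rw [show (symplectic n).ε = -1 from rfl, Fintype.card_sum, Fintype.card_fin] at h h'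
  push_cast at h h'
  constructor <;> zify
  · linarith
  · linarith

theorem ncard_orthogonal_even (n : ℕ) : (orthogonal (2 * n)).live.ncard = n * n ∧
    ((orthogonal (2 * n)).coords.ncard : ℤ) = n * (2 * n - 1) := by
  obtain ⟨z, hz0, hz1, -, h⟩ := (orthogonal (2 * n)).four_mul_ncard_live
  have h' := (orthogonal (2 * n)).two_mul_ncard_coords
  rw [show (orthogonal (2 * n)).ε = 1 from rfl, Fintype.card_fin] at h h'
  push_cast at h h'
  constructor
  · zify
    have : (2 * (n : ℤ)) ^ 2 = 4 * ((n : ℤ) * n) := by ring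
    omega
  · linarith

theorem ncard_orthogonal_odd (n : ℕ) : (orthogonal (2 * n + 1)).live.ncard = n * (n + 1) ∧
    (orthogonal (2 * n + 1)).coords.ncard = n * (2 * n + 1) := by
  obtain ⟨z, hz0, hz1, -, h⟩ := (orthogonal (2 * n + 1)).four_mul_ncard_live
  have h' := (orthogonal (2 * n + 1)).two_mul_ncard_coords
  rw [show (orthogonal (2 * n + 1)).ε = 1 from rfl, Fintype.card_fin] at h h'
  push_cast at h h'
  constructor <;> zify
  · have : (2 * (n : ℤ) + 1) ^ 2 = 4 * ((n : ℤ) * (n + 1)) + 1 := by ring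
    omega
  · linarith

/-- The decomposition of the indices `0, …, 2 n` into the first `n`, the last `n`, and the middle
one. -/
def middleSplit (n : ℕ) : Fin (2 * n + 1) ≃ (Fin n ⊕ Fin n) ⊕ Unit where
  toFun i := if h : (i : ℕ) < n then Sum.inl (Sum.inl ⟨i, h⟩)
    else if h' : (i : ℕ) = n then Sum.inr ()
    else Sum.inl (Sum.inr ⟨i - n - 1, by omega⟩)
  invFun := Sum.elim (Sum.elim (fun i => ⟨i, by omega⟩) fun i => ⟨n + 1 + i, by omega⟩)
    fun _ => ⟨n, by omega⟩
  left_inv i := by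
    dsimp only
    split_ifs with h h'
    · rfl
    · exact Fin.ext h'.symm
    · refine Fin.ext ?_
      simp only [Sum.elim_inl, Sum.elim_inr]
      omega
  right_inv := by
    rintro ((i | i) | _)
    · simp
    · have h1 : ¬ (n + 1 + (i : ℕ) < n) := by omega
      have h2 : ¬ (n + 1 + (i : ℕ) = n) := by omega
      refine (dif_neg h1).trans ((dif_neg h2).trans
        (congrArg (fun x => Sum.inl (Sum.inr x)) (Fin.ext ?_)))
      change n + 1 + (i : ℕ) - n - 1 = i
      omega
    · simp

/-- In characteristic `2` the antidiagonal matrix of odd size is the sum of a symplectic form and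
`1`. -/
theorem addFixedIndex_form_symplectic (R : Type*) [CommRing R] [CharP R 2] (n : ℕ) :
    Matrix.addFixedIndex (middleSplit n) R ((symplectic n).form R) =
      antidiagonalMatrix R (2 * n + 1) := by
  ext a b
  obtain ⟨x, rfl⟩ := (middleSplit n).symm.surjective a
  obtain ⟨y, rfl⟩ := (middleSplit n).symm.surjective b
  rw [Matrix.addFixedIndex_apply, Equiv.apply_symm_apply, Equiv.apply_symm_apply, form_symplectic]
  rcases x with (i | i) | _ <;> rcases y with (j | j) | _ <;>
    simp only [Matrix.fromBlocks_apply₁₁, Matrix.fromBlocks_apply₁₂, Matrix.fromBlocks_apply₂₁,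
      Matrix.fromBlocks_apply₂₂, Matrix.zero_apply, Matrix.neg_apply, CharTwo.neg_eq,
      antidiagonalMatrix, Matrix.of_apply, middleSplit, Equiv.coe_fn_symm_mk, Sum.elim_inl,
      Sum.elim_inr, Fin.ext_iff, Fin.val_rev, Matrix.one_apply]
  all_goals split_ifs <;> first | rfl | omega

end AntidiagonalForm

open AntidiagonalForm in
theorem corollary5p4 (p : ℕ) [Fact p.Prime] (n : ℕ) (hn : 1 ≤ n) :
    Set.Icc (0 : ℝ) (((n : ℝ) + 1) / (2 * n + 1)) ⊆
        standardHausdorffSpectrum (classicalSp (PowerSeries (ZMod p)) n) ∧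
      (p ≠ 2 → Set.Icc (0 : ℝ) ((n : ℝ) / (2 * n - 1)) ⊆
        standardHausdorffSpectrum (classicalSO (PowerSeries (ZMod p)) (2 * n))) ∧
      Set.Icc (0 : ℝ) (((n : ℝ) + 1) / (2 * n + 1)) ⊆
        standardHausdorffSpectrum (classicalSO (PowerSeries (ZMod p)) (2 * n + 1)) := by
  have hn0 : (n : ℝ) ≠ 0 := by positivity
  have hpos : 0 < n * (n + 1) := by positivity
  have hpos' : 0 < n * (2 * n + 1) := by positivity
  have hη : ((n : ℝ) + 1) / (2 * n + 1) = (n * (n + 1) : ℕ) / (n * (2 * n + 1) : ℕ) := by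
    push_cast
    rw [mul_div_mul_left _ _ hn0]
  have h2 : p ≠ 2 → IsUnit (2 : (ZMod p)⟦X⟧) := fun hp => by
    rw [PowerSeries.isUnit_iff_constantCoeff, map_ofNat, isUnit_iff_ne_zero]
    have := (ZMod.natCast_eq_zero_iff 2 p).not.mpr fun h =>
      hp ((Nat.prime_dvd_prime_iff_eq Fact.out Nat.prime_two).mp h)
    exact_mod_cast this
  obtain ⟨hs, hs'⟩ := ncard_symplectic n
  refine ⟨?_, fun hp => ?_, ?_⟩
  · rw [hη, classicalSp, ← form_symplectic, ← hs, ← hs']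
    exact (symplectic n).Icc_subset_spectrum (fun h => absurd h (by simp [symplectic]))
      (hs ▸ hpos) (hs' ▸ hpos')
  · obtain ⟨ho, ho'⟩ := ncard_orthogonal_even n
    have hη' : (n : ℝ) / (2 * n - 1) =
        ((orthogonal (2 * n)).live.ncard : ℝ) / (orthogonal (2 * n)).coords.ncard := by
      have : ((orthogonal (2 * n)).coords.ncard : ℝ) = n * (2 * n - 1) := by exact_mod_cast ho'
      rw [ho, this]
      push_cast
      rw [mul_div_mul_left _ _ hn0]
    rw [hη', classicalSO, ← form_orthogonal]
    refine (orthogonal (2 * n)).Icc_subset_spectrum (fun _ => h2 hp) (by rw [ho]; positivity) ?_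
    zify
    rw [ho']
    have : (1 : ℤ) ≤ n := by exact_mod_cast hn
    exact mul_pos (by omega) (by omega)
  · by_cases hp : p = 2
    · subst hp
      rw [hη, classicalSO, ← addFixedIndex_form_symplectic, ← hs, ← hs']
      exact (symplectic n).Icc_subset_spectrum_addFixedIndex _ rfl (hs ▸ hpos) (hs' ▸ hpos')
    · obtain ⟨ho, ho'⟩ := ncard_orthogonal_odd n
      rw [hη, classicalSO, ← form_orthogonal, ← ho, ← ho']
      exact (orthogonal (2 * n + 1)).Icc_subset_spectrum (fun _ => h2 hp) (ho ▸ hpos) (ho' ▸ hpos')
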